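/- Let $M$ and $N$ be dual lattices of finite rank $n$, let $\Sigma$ be a fan of strongly convex rational polyhedral cones in $N_{\mathbb R}$, and let $X=X_\Sigma$ be the toric variety of $\Sigma$ over a commutative noetherian ring $k$, with torus $T=\operatorname{Spec}k[M]$, base point $x_0=1\in T\subset X$ and affine charts $U_\sigma=\operatorname{Spec}k[\sigma^\vee\cap M]$, $\sigma\in\Sigma$. Let $\mathcal E$ be a $T$-equivariant vector bundle on $X$; its sections over each $U_\sigma$ are graded by $M$, so that the function $\chi^s$ has degree $s$, and $\mathcal O(\chi)$ denotes the equivariant line bundle generated in degree $\chi$. Its generic stalk is the fibre $E=\mathcal E_{x_0}$. *Klyachko filtration.* For a nonzero lattice vector $\alpha\in N$ that spans a ray $\rho\in\Sigma$, let $i_\alpha:\mathbb A^1\to U_\rho$ be the map that extends $z\mapsto\alpha(z)x_0$. Grade $\Gamma(\mathbb A^1,i_\alpha^*\mathcal E)$ so that the coordinate $z$ has weight $1$ and the pullback of a section of degree $m$ has weight $\langle\alpha,m\rangle$. For $j\in\mathbb Z$ let $E^\alpha_{\le j}\subseteq E$ be the set of values at $1\in\mathbb A^1$ of the sections of weight $j$.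 *The sheaf $\kappa(\mathcal E)$.* For $\sigma\in\Sigma$ and $\chi\in M$ let $\Theta(\sigma,\chi)$ be the extension by zero to $M_{\mathbb R}$ of the constant sheaf $k$ on the interior of $\chi+\sigma^\vee$. For $\sigma\in\Sigma$ let $\Theta(\sigma,\mathcal E)=\sum_{m\in M}\Gamma(U_\sigma,\mathcal E)_m\cdot\Theta(\sigma,m)$, a subsheaf of the constant sheaf $E$ on $M_{\mathbb R}$, sections being evaluated at $x_0$; it is $\bigoplus_i\Theta(\sigma,\chi_i)$ if $\mathcal E|_{U_\sigma}\cong\bigoplus_i\mathcal O(\chi_i)$. Then $\kappa(\mathcal E)$ is the object of the derived category of sheaves of $k$-modules on $M_{\mathbb R}$ that is obtained from the alternating Čech complex of $\mathcal E$ for the covering $\{U_\sigma\}_{\sigma\in\Sigma}$: its term in degree $p-n$ consists of the alternating families $(c_{\sigma_0,\dots,\sigma_p})$ with $c_{\sigma_0,\dots,\sigma_p}\in\Theta(\sigma_0\cap\dots\cap\sigma_p,\mathcal E)$. **Theorem.** There is an isomorphism $$H^0_c(M_{\mathbb R};\kappa(\mathcal E))\;\cong\;E,$$ natural in the equivariant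 vector bundle $\mathcal E$, with the following property. Let $\alpha\in N$ be a nonzero lattice vector that spans a ray of $\Sigma$ (for example its primitive generator), let $j$ be an integer and $t$ a real number with $j<t\le j+1$, and let $\alpha^{-1}(-\infty,t)=\{v\in M_{\mathbb R}:\langle\alpha,v\rangle<t\}$. Then the map $$H^0_c(\alpha^{-1}(-\infty,t);\kappa(\mathcal E))\to H^0_c(M_{\mathbb R};\kappa(\mathcal E))$$ is injective, and the isomorphism takes its image onto $E^\alpha_{\le j}\subseteq E$. In other words, the open Morse filtration piece at $t\in\mathbb R$ is $E^\alpha_{<t}:=\bigcup_{j<t}E^\alpha_{\le j}$, and $E^\alpha_{\le k}$ is the intersection of the Morse filtration pieces at all $t>k$. -/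

import Mathlib

open CategoryTheory TopologicalSpace

universe u w₁ w₂

noncomputable section

namespace Toric

/-! ### Lattices and fans

For a finite type `ι` the character lattice `M` and the cocharacter lattice `N` of the torus
`T = 𝔾ₘ^ι` are both `ι → ℤ`, paired by the dot product, and `M_ℝ = N_ℝ = ι → ℝ`. -/

section Fan

variable {ι : Type u} [Fintype ι]

/-- The inclusion of a lattice into its realification. -/
def toReal (m : ι → ℤ) : ι → ℝ := fun i => (m i : ℝ)

/-- A fan in `N_ℝ`: a finite nonempty set of strongly convex rational polyhedral cones that is
closed under taking faces, any two of which meet along a common face. -/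
structure Fan (ι : Type u) [Fintype ι] where
  cones : Set (PointedCone ℝ (ι → ℝ))
  finite : cones.Finite
  nonempty : cones.Nonempty
  rational : ∀ σ ∈ cones, ∃ s : Finset (ι → ℤ), σ = PointedCone.hull ℝ (toReal '' (s : Set (ι → ℤ)))
  stronglyConvex : ∀ σ ∈ cones, ∀ x ∈ σ, -x ∈ σ → x = 0
  face_mem : ∀ σ ∈ cones, ∀ τ : PointedCone ℝ (ι → ℝ), τ.IsFaceOf σ → τ ∈ cones
  inter_isFaceOf : ∀ σ ∈ cones, ∀ τ ∈ cones, (σ ⊓ τ).IsFaceOf σ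

/-- The cones of a fan, ordered by inclusion. -/
abbrev Fan.Cone (Δ : Fan ι) : Type u := {σ : PointedCone ℝ (ι → ℝ) // σ ∈ Δ.cones}

lemma Fan.bot_mem (Δ : Fan ι) : (⊥ : PointedCone ℝ (ι → ℝ)) ∈ Δ.cones := by
  obtain ⟨σ, hσ⟩ := Δ.nonempty
  refine Δ.face_mem σ hσ ⊥ ⟨bot_le, ?_⟩
  intro x y a hx hy ha h
  have h0 : a • x + y = 0 := by simpa using h
  have hax : a • x ∈ σ := σ.smul_mem ha.le hx
  have : a • x = 0 := Δ.stronglyConvex σ hσ _ hax (by rwa [neg_eq_of_add_eq_zero_right h0])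
  simpa [ha.ne'] using this

lemma Fan.inf_mem (Δ : Fan ι) {σ τ : PointedCone ℝ (ι → ℝ)} (hσ : σ ∈ Δ.cones)
    (hτ : τ ∈ Δ.cones) : σ ⊓ τ ∈ Δ.cones :=
  Δ.face_mem σ hσ _ (Δ.inter_isFaceOf σ hσ τ hτ)

lemma Fan.iInf_mem (Δ : Fan ι) {p : ℕ} (I : Fin (p + 1) → Δ.Cone) :
    (⨅ i, (I i).1) ∈ Δ.cones := by
  induction p with
  | zero => simp
  | succ p ih =>
    have : (⨅ i, (I i).1) = (I 0).1 ⊓ ⨅ i : Fin (p + 1), (I i.succ).1 := by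
      refine le_antisymm (le_inf (iInf_le _ _) (le_iInf fun i => iInf_le _ _))
        (le_iInf fun i => ?_)
      refine Fin.cases inf_le_left (fun j => inf_le_right.trans (iInf_le _ j)) i
    rw [this]
    exact Δ.inf_mem (I 0).2 (ih fun i => I i.succ)

/-- The zero cone, whose chart is the open orbit `T`. -/
def Fan.zero (Δ : Fan ι) : Δ.Cone := ⟨⊥, Δ.bot_mem⟩

lemma Fan.zero_le (Δ : Fan ι) (σ : Δ.Cone) : Δ.zero ≤ σ := (bot_le : ⊥ ≤ σ.1)

/-- `U_{σ₀} ∩ … ∩ U_{σ_p}` is the chart of the cone `σ₀ ∩ … ∩ σ_p`. -/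
def Fan.inter (Δ : Fan ι) {p : ℕ} (I : Fin (p + 1) → Δ.Cone) : Δ.Cone :=
  ⟨⨅ i, (I i).1, Δ.iInf_mem I⟩

/-- The semigroup `S_σ = σ^∨ ∩ M`. -/
def semigroup (σ : PointedCone ℝ (ι → ℝ)) : AddSubmonoid (ι → ℤ) where
  carrier := {m | ∀ x ∈ σ, 0 ≤ toReal m ⬝ᵥ x}
  zero_mem' x _ := by simp [toReal, dotProduct]
  add_mem' {a b} ha hb x hx := by
    have : toReal (a + b) = toReal a + toReal b := by ext i; simp [toReal]
    rw [this, add_dotProduct]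
    exact add_nonneg (ha x hx) (hb x hx)

lemma semigroup_anti {σ τ : PointedCone ℝ (ι → ℝ)} (h : τ ≤ σ) : semigroup σ ≤ semigroup τ :=
  fun _ hm x hx => hm x (h hx)

/-- The open set `(χ + σ^∨)°` of all `v` with `⟨v, -⟩ > ⟨χ, -⟩` on the nonzero elements of `σ`. -/
def openDual (σ : PointedCone ℝ (ι → ℝ)) (χ : ι → ℤ) : Set (ι → ℝ) :=
  {v | ∀ x ∈ σ, x ≠ 0 → toReal χ ⬝ᵥ x < v ⬝ᵥ x}

end Fan

/-! ### Equivariant vector bundles -/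

section Bundle

variable {ι : Type u} [Fintype ι] (k : Type u) [CommRing k]

/-- The coordinate ring `k[S_σ] = k[σ^∨ ∩ M]` of the affine chart `U_σ`. -/
abbrev Coord (σ : PointedCone ℝ (ι → ℝ)) : Type u := AddMonoidAlgebra k (semigroup σ)

/-- A `T`-equivariant vector bundle on the toric variety of the fan `Δ` over `k`, given on the
affine charts `U_σ = Spec k[S_σ]`. The sections over `U_σ` form a finitely generated projective
`k[S_σ]`-module; the `T`-equivariant structure is the grading of this module by characters, the
function `χ^s` being homogeneous of degree `s`; and for `τ ⊆ σ` restriction to `U_τ ⊆ U_σ`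
is the localization that inverts the functions `χ^s`, `s ∈ S_σ ∩ τ^⊥`. -/
structure Bundle (Δ : Fan ι) where
  sec : Δ.Cone → Type u
  [addCommGroup : ∀ σ, AddCommGroup (sec σ)]
  [module : ∀ σ, Module k (sec σ)]
  [moduleCoord : ∀ σ, Module (Coord k σ.1) (sec σ)]
  [isScalarTower : ∀ σ, IsScalarTower k (Coord k σ.1) (sec σ)]
  finite : ∀ σ, Module.Finite (Coord k σ.1) (sec σ)
  projective : ∀ σ, Module.Projective (Coord k σ.1) (sec σ)
  deg : ∀ σ, (ι → ℤ) → Submodule k (sec σ)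
  isInternal : ∀ σ, DirectSum.IsInternal (deg σ)
  single_smul_mem : ∀ σ (s : semigroup σ.1) (c : k) (m : ι → ℤ) (p : sec σ), p ∈ deg σ m →
    AddMonoidAlgebra.single s c • p ∈ deg σ (s.1 + m)
  res : ∀ {σ τ : Δ.Cone}, τ ≤ σ → sec σ →ₗ[k] sec τ
  res_single_smul : ∀ {σ τ : Δ.Cone} (h : τ ≤ σ) (s : semigroup σ.1) (c : k) (p : sec σ),
    res h (AddMonoidAlgebra.single s c • p) =
      (AddMonoidAlgebra.single (⟨s.1, semigroup_anti h s.2⟩ : semigroup τ.1) c : Coord k τ.1) •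
        res h p
  res_mem : ∀ {σ τ : Δ.Cone} (h : τ ≤ σ) (m : ι → ℤ) (p : sec σ), p ∈ deg σ m →
    res h p ∈ deg τ m
  res_refl : ∀ (σ : Δ.Cone) (p : sec σ), res (le_refl σ) p = p
  res_res : ∀ {σ τ υ : Δ.Cone} (h : τ ≤ σ) (h' : υ ≤ τ) (p : sec σ),
    res h' (res h p) = res (h'.trans h) p
  res_surj : ∀ {σ τ : Δ.Cone} (h : τ ≤ σ) (q : sec τ), ∃ (s : semigroup σ.1) (p : sec σ),
    -s.1 ∈ semigroup τ.1 ∧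
      res h p =
        (AddMonoidAlgebra.single (⟨s.1, semigroup_anti h s.2⟩ : semigroup τ.1) 1 : Coord k τ.1) • q
  res_eq_zero : ∀ {σ τ : Δ.Cone} (h : τ ≤ σ) (p : sec σ), res h p = 0 →
    ∃ s : semigroup σ.1, -s.1 ∈ semigroup τ.1 ∧ (AddMonoidAlgebra.single s 1 : Coord k σ.1) • p = 0

attribute [instance] Bundle.addCommGroup Bundle.module Bundle.moduleCoord Bundle.isScalarTower

variable {k} {Δ : Fan ι}

/-- A morphism of equivariant vector bundles. -/
@[ext]
structure Bundle.Hom (E E' : Bundle k Δ) where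
  app : ∀ σ, E.sec σ →ₗ[Coord k σ.1] E'.sec σ
  app_mem : ∀ σ (m : ι → ℤ) (p : E.sec σ), p ∈ E.deg σ m → app σ p ∈ E'.deg σ m
  app_res : ∀ {σ τ : Δ.Cone} (h : τ ≤ σ) (p : E.sec σ),
    app τ (E.res h p) = E'.res h (app σ p)

instance : Category (Bundle k Δ) where
  Hom := Bundle.Hom
  id E := ⟨fun _ => LinearMap.id, fun _ _ _ h => h, fun _ _ => rfl⟩
  comp f g := ⟨fun σ => (g.app σ).comp (f.app σ),
    fun σ m p h => g.app_mem σ m _ (f.app_mem σ m p h),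
    fun h p => by simp [f.app_res, g.app_res]⟩

variable (k) in
/-- The point `x₀ = 1` of the chart `U_σ` (it lies in the open orbit): evaluation of functions,
`χ^s ↦ 1`. -/
def evalOne (σ : PointedCone ℝ (ι → ℝ)) : Coord k σ →ₐ[k] k :=
  AddMonoidAlgebra.lift k k (semigroup σ) 1

/-- The sections over the open orbit `T = U_0` that vanish at `x₀`: the submodule generated by
the products of sections with functions vanishing at `x₀`. -/
def Bundle.vanishing (E : Bundle k Δ) : Submodule (Coord k Δ.zero.1) (E.sec Δ.zero) :=
  RingHom.ker (evalOne k Δ.zero.1) • ⊤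

/-- The fibre `E = 𝓔_{x₀}` of the bundle at the point `x₀` of the open orbit. -/
def Bundle.fiber (E : Bundle k Δ) : Type u := E.sec Δ.zero ⧸ E.vanishing

instance (E : Bundle k Δ) : AddCommGroup E.fiber :=
  inferInstanceAs (AddCommGroup (E.sec Δ.zero ⧸ E.vanishing))

instance (E : Bundle k Δ) : Module k E.fiber :=
  inferInstanceAs (Module k (E.sec Δ.zero ⧸ E.vanishing))

/-- The value at `x₀` of a section over the open orbit. -/
def Bundle.fiberMk (E : Bundle k Δ) : E.sec Δ.zero →ₗ[k] E.fiber :=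
  E.vanishing.mkQ.restrictScalars k

lemma Bundle.fiberMk_surjective (E : Bundle k Δ) : Function.Surjective E.fiberMk :=
  Submodule.mkQ_surjective E.vanishing

lemma Bundle.fiberMk_eq_iff (E : Bundle k Δ) (p q : E.sec Δ.zero) :
    E.fiberMk p = E.fiberMk q ↔ p - q ∈ E.vanishing :=
  Submodule.Quotient.eq E.vanishing

/-- The value at `x₀` of a section over `U_σ`. -/
def Bundle.value (E : Bundle k Δ) (σ : Δ.Cone) : E.sec σ →ₗ[k] E.fiber :=
  E.fiberMk.comp (E.res (Δ.zero_le σ))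

lemma Bundle.value_smul (E : Bundle k Δ) (σ : Δ.Cone) (a : Coord k σ.1) (p : E.sec σ) :
    E.value σ (a • p) = evalOne k σ.1 a • E.value σ p := by
  induction a using AddMonoidAlgebra.induction_linear with
  | zero => simp
  | add a b ha hb => simp only [add_smul, map_add, ha, hb]
  | single s c =>
    have hs : (AddMonoidAlgebra.single (⟨s.1, semigroup_anti (Δ.zero_le σ) s.2⟩ :
        semigroup Δ.zero.1) c : Coord k Δ.zero.1) - algebraMap k _ c ∈
          RingHom.ker (evalOne k Δ.zero.1) := by
      simp [RingHom.mem_ker, evalOne]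
    have hm := Submodule.smul_mem_smul hs (Submodule.mem_top (x := E.res (Δ.zero_le σ) p))
    rw [sub_smul, algebraMap_smul] at hm
    have hc : evalOne k σ.1 (AddMonoidAlgebra.single s c) = c := by simp [evalOne]
    rw [hc, ← map_smul, Bundle.value, LinearMap.comp_apply, LinearMap.comp_apply,
      E.res_single_smul, (E.res (Δ.zero_le σ)).map_smul]
    exact (E.fiberMk_eq_iff _ _).2 hm

/-- The action of a morphism on fibres at `x₀`. -/
def Bundle.Hom.fiberMap {E E' : Bundle k Δ} (f : Bundle.Hom E E') : E.fiber →ₗ[k] E'.fiber :=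
  (Submodule.mapQ E.vanishing E'.vanishing (f.app Δ.zero) (by
    rw [← Submodule.map_le_iff_le_comap, Bundle.vanishing, Submodule.map_smul'']
    exact Submodule.smul_mono le_rfl le_top)).restrictScalars k

lemma Bundle.Hom.fiberMap_fiberMk {E E' : Bundle k Δ} (f : Bundle.Hom E E')
    (p : E.sec Δ.zero) : f.fiberMap (E.fiberMk p) = E'.fiberMk (f.app Δ.zero p) :=
  rfl

lemma Bundle.Hom.fiberMap_value {E E' : Bundle k Δ} (f : Bundle.Hom E E') (σ : Δ.Cone)
    (p : E.sec σ) : f.fiberMap (E.value σ p) = E'.value σ (f.app σ p) := by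
  rw [Bundle.value, LinearMap.comp_apply, f.fiberMap_fiberMk, f.app_res]
  rfl

lemma Bundle.fiberMap_id (E : Bundle k Δ) :
    Bundle.Hom.fiberMap (𝟙 E) = LinearMap.id := by
  ext x
  obtain ⟨x, rfl⟩ := E.fiberMk_surjective x
  exact Bundle.Hom.fiberMap_fiberMk _ _

lemma Bundle.fiberMap_comp {E E' E'' : Bundle k Δ} (f : E ⟶ E') (g : E' ⟶ E'') :
    Bundle.Hom.fiberMap (f ≫ g) = (Bundle.Hom.fiberMap g).comp (Bundle.Hom.fiberMap f) := by
  ext x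
  obtain ⟨x, rfl⟩ := E.fiberMk_surjective x
  rw [LinearMap.comp_apply, Bundle.Hom.fiberMap_fiberMk, Bundle.Hom.fiberMap_fiberMk]
  exact Bundle.Hom.fiberMap_fiberMk _ _

variable (k Δ) in
/-- The generic stalk, as a functor of the equivariant vector bundle. -/
def genericStalk : Bundle k Δ ⥤ ModuleCat.{u} k where
  obj E := ModuleCat.of k E.fiber
  map f := ModuleCat.ofHom (Bundle.Hom.fiberMap f)
  map_id E := by rw [Bundle.fiberMap_id]; rfl
  map_comp f g := by rw [Bundle.fiberMap_comp]; rfl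

/-! ### The Klyachko filtrations

A cocharacter `α` in the cone `σ` gives the equivariant map `i_α : 𝔸¹ → U_σ` with `1 ↦ x₀` and
`z ↦ α(z) x₀` for `z ≠ 0`. -/

variable (k) in
/-- The pullback of functions along `i_α : 𝔸¹ → U_σ`, that is, `χ^s ↦ z^⟨α, s⟩`. -/
def curve (σ : PointedCone ℝ (ι → ℝ)) (α : ι → ℤ) (hα : toReal α ∈ σ) :
    Coord k σ →ₐ[k] Polynomial k :=
  AddMonoidAlgebra.lift k (Polynomial k) (semigroup σ)
    { toFun := fun s => Polynomial.X ^ (α ⬝ᵥ s.toAdd.1).toNat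
      map_one' := by simp
      map_mul' := fun s t => by
        have h : ∀ s : semigroup σ, 0 ≤ α ⬝ᵥ s.1 := fun s => by
          have := s.2 _ hα
          have e : toReal s.1 ⬝ᵥ toReal α = ((α ⬝ᵥ s.1 : ℤ) : ℝ) := by
            simp [toReal, dotProduct, mul_comm]
          rw [e] at this
          exact_mod_cast this
        rw [← pow_add, ← Int.toNat_add (h _) (h _), ← dotProduct_add]
        rfl }

lemma eval_curve (σ : PointedCone ℝ (ι → ℝ)) (α : ι → ℤ) (hα : toReal α ∈ σ) (a : Coord k σ) :
    (curve k σ α hα a).eval 1 = evalOne k σ a := by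
  induction a using AddMonoidAlgebra.induction_linear with
  | zero => simp
  | add a b ha hb => simp only [map_add, Polynomial.eval_add, ha, hb]
  | single s c => simp [curve, evalOne]

variable (k) in
/-- The coordinate ring `k[z]` of `𝔸¹`, as an algebra over `k[S_σ]` through `i_α`. -/
def CurveRing (σ : PointedCone ℝ (ι → ℝ)) (α : ι → ℤ) (_ : toReal α ∈ σ) : Type u :=
  Polynomial k

instance (σ : PointedCone ℝ (ι → ℝ)) (α : ι → ℤ) (hα : toReal α ∈ σ) :
    CommRing (CurveRing k σ α hα) :=
  inferInstanceAs (CommRing (Polynomial k))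

instance (σ : PointedCone ℝ (ι → ℝ)) (α : ι → ℤ) (hα : toReal α ∈ σ) :
    Algebra (Coord k σ) (CurveRing k σ α hα) :=
  RingHom.toAlgebra (curve k σ α hα).toRingHom

/-- The module `Γ(i_α^* 𝓔) = k[z] ⊗_{k[S_σ]} Γ(U_σ, 𝓔)` of global sections on `𝔸¹` of the pullback
of the bundle along `i_α`. -/
abbrev Bundle.CurveSec (E : Bundle k Δ) (σ : Δ.Cone) (α : ι → ℤ) (hα : toReal α ∈ σ.1) : Type u :=
  TensorProduct (Coord k σ.1) (CurveRing k σ.1 α hα) (E.sec σ)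

section CurveSec

variable (E : Bundle k Δ) (σ : Δ.Cone) (α : ι → ℤ) (hα : toReal α ∈ σ.1)

/-- The section `f ⊗ p` of `i_α^* 𝓔`. -/
def Bundle.curveTmul (f : Polynomial k) (p : E.sec σ) : E.CurveSec σ α hα :=
  TensorProduct.tmul (Coord k σ.1) (f : CurveRing k σ.1 α hα) p

/-- The value at `1 ∈ 𝔸¹` of a section of `i_α^* 𝓔`, in the fibre `(i_α^* 𝓔)_1 = 𝓔_{x₀}`;
it sends `f ⊗ p` to `f(1) p(x₀)`. -/
def Bundle.curveValue : E.CurveSec σ α hα →+ E.fiber :=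
  TensorProduct.liftAddHom
    (AddMonoidHom.mk' (fun f : CurveRing k σ.1 α hα =>
        (Polynomial.eval (1 : k) (f : Polynomial k) • E.value σ).toAddMonoidHom)
      (fun f g => by
        ext p
        exact (congrArg (· • E.value σ p)
          (Polynomial.eval_add (p := (f : Polynomial k)) (q := g) (x := 1))).trans
            (add_smul _ _ _)))
    (fun a f p => by
      have h : Polynomial.eval (1 : k) (a • f : CurveRing k σ.1 α hα) =
          evalOne k σ.1 a * Polynomial.eval (1 : k) (f : Polynomial k) :=
        (Polynomial.eval_mul (p := curve k σ.1 α hα a) (q := f) (x := 1)).trans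
          (by rw [eval_curve])
      change Polynomial.eval (1 : k) (a • f : CurveRing k σ.1 α hα) • E.value σ p =
        Polynomial.eval (1 : k) (f : Polynomial k) • E.value σ (a • p)
      rw [h, E.value_smul, ← mul_smul, mul_comm])

lemma Bundle.curveValue_curveTmul (f : Polynomial k) (p : E.sec σ) :
    E.curveValue σ α hα (E.curveTmul σ α hα f p) = f.eval 1 • E.value σ p :=
  rfl

/-- The homogeneous sections of `i_α^* 𝓔` of weight `j`: the grading is the one for which the
coordinate `z` of `𝔸¹` has weight `1` and a section `p` of `𝓔` of degree `m` has weight `⟨α, m⟩`. -/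
def Bundle.curveWeight (j : ℤ) : AddSubgroup (E.CurveSec σ α hα) :=
  AddSubgroup.closure {s | ∃ (n : ℕ) (m : ι → ℤ) (p : E.sec σ), p ∈ E.deg σ m ∧
    (n : ℤ) + α ⬝ᵥ m = j ∧ s = E.curveTmul σ α hα (Polynomial.X ^ n) p}

lemma Bundle.curveWeight_value_smul (j : ℤ) (c : k) {e : E.fiber}
    (he : e ∈ (E.curveWeight σ α hα j).map (E.curveValue σ α hα)) :
    c • e ∈ (E.curveWeight σ α hα j).map (E.curveValue σ α hα) := by
  obtain ⟨s, hs, rfl⟩ := he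
  refine AddSubgroup.closure_induction (p := fun s _ => c • E.curveValue σ α hα s ∈
    (E.curveWeight σ α hα j).map (E.curveValue σ α hα)) ?_ ?_ ?_ ?_ hs
  · rintro _ ⟨n, m, p, hp, hj, rfl⟩
    refine ⟨_, AddSubgroup.subset_closure ⟨n, m, c • p, (E.deg σ m).smul_mem c hp, hj, rfl⟩, ?_⟩
    simp [E.curveValue_curveTmul]
  · simp
  · intro x y _ _ hx hy
    rw [map_add, smul_add]
    exact add_mem hx hy
  · intro x _ hx
    rw [map_neg, smul_neg]
    exact neg_mem hx

end CurveSec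

/-- The piece `E^α_{≤ j}` of the Klyachko filtration of the generic stalk attached to a lattice
point `α` of the cone `σ`: the values at `1` of the sections of `i_α^* 𝓔` of weight `j`. -/
def Bundle.klyachko (E : Bundle k Δ) (σ : Δ.Cone) (α : ι → ℤ) (hα : toReal α ∈ σ.1) (j : ℤ) :
    Submodule k E.fiber where
  __ := (E.curveWeight σ α hα j).map (E.curveValue σ α hα)
  smul_mem' c _ he := E.curveWeight_value_smul σ α hα j c he

end Bundle

/-! ### Sheaves of locally constant sections -/

section LocallyConstant

variable {k : Type u} [CommRing k] {X : TopCat.{u}}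

/-- For submodules `A x ⊆ W` depending on the point `x`, the locally constant functions `s` on `U`
with values in `W` such that `s x ∈ A x` for all `x`. -/
def lcSections {W : Type u} [AddCommGroup W] [Module k W] (A : X → Submodule k W) (U : Opens X) :
    Submodule k (U → W) where
  carrier := {s | IsLocallyConstant s ∧ ∀ x : U, s x ∈ A x}
  zero_mem' := ⟨IsLocallyConstant.const 0, fun _ => zero_mem _⟩
  add_mem' hs ht := ⟨hs.1.add ht.1, fun x => add_mem (hs.2 x) (ht.2 x)⟩
  smul_mem' c _ hs := ⟨hs.1.comp (c • ·), fun x => (A x).smul_mem c (hs.2 x)⟩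

/-- Restriction of sections. -/
def lcRestrict {W : Type u} [AddCommGroup W] [Module k W] (A : X → Submodule k W) {U V : Opens X}
    (h : V ≤ U) : lcSections A U →ₗ[k] lcSections A V where
  toFun s := ⟨fun x => s.1 ⟨x.1, h x.2⟩,
    s.2.1.comp_continuous (continuous_inclusion h), fun x => s.2.2 ⟨x.1, h x.2⟩⟩
  map_add' _ _ := rfl
  map_smul' _ _ := rfl

/-- The presheaf `U ↦ lcSections A U`. -/
def lcPresheaf {W : Type u} [AddCommGroup W] [Module k W] (A : X → Submodule k W) :
    TopCat.Presheaf (ModuleCat.{u} k) X where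
  obj U := ModuleCat.of k (lcSections A U.unop)
  map f := ModuleCat.ofHom (lcRestrict A f.unop.le)
  map_id _ := rfl
  map_comp _ _ := rfl

/-- The condition defining `lcSections` is local. -/
def lcLocal {W : Type u} [AddCommGroup W] [Module k W] (A : X → Submodule k W) :
    TopCat.LocalPredicate (fun _ : X => W) where
  pred {U} s := s ∈ lcSections A U
  res i f h := (lcRestrict A i.le ⟨f, h⟩).2
  locality {U} f h := by
    refine ⟨?_, fun x => ?_⟩
    · rw [IsLocallyConstant.iff_exists_open]
      intro x
      obtain ⟨V, hx, i, hV⟩ := h x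
      obtain ⟨O, hO, hxO, hc⟩ := (IsLocallyConstant.iff_exists_open _).1 hV.1 ⟨x.1, hx⟩
      refine ⟨(fun y : V => (i y : U)) '' O, ?_, ⟨⟨x.1, hx⟩, hxO, rfl⟩, ?_⟩
      · exact (Opens.isOpenEmbedding_of_le i.le).isOpenMap _ hO
      · rintro _ ⟨y, hy, rfl⟩
        exact hc y hy
    · obtain ⟨V, hx, i, hV⟩ := h x
      exact hV.2 ⟨x.1, hx⟩

/-- The subsheaf of the constant sheaf `W` formed by the sections `s` with `s x ∈ A x`. -/
def lcSheaf {W : Type u} [AddCommGroup W] [Module k W] (A : X → Submodule k W) :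
    TopCat.Sheaf (ModuleCat.{u} k) X :=
  ⟨lcPresheaf A, (TopCat.Presheaf.isSheaf_iff_isSheaf_comp (forget (ModuleCat.{u} k)) _).2
    (TopCat.subpresheafToTypes.isSheaf (lcLocal A))⟩

/-- The morphism induced by a linear map that respects the submodules `A x`. -/
def lcMap {W W' : Type u} [AddCommGroup W] [Module k W] [AddCommGroup W'] [Module k W']
    (A : X → Submodule k W) (A' : X → Submodule k W') (g : W →ₗ[k] W')
    (hg : ∀ x, ∀ w ∈ A x, g w ∈ A' x) : lcSheaf A ⟶ lcSheaf A' :=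
  ObjectProperty.homMk
    { app := fun U => ModuleCat.ofHom
        { toFun := fun s : lcSections A U.unop =>
            (⟨fun x => g (s.1 x), s.2.1.comp g, fun x => hg x _ (s.2.2 x)⟩ : lcSections A' U.unop)
          map_add' := fun _ _ => Subtype.ext (funext fun _ => g.map_add _ _)
          map_smul' := fun _ _ => Subtype.ext (funext fun _ => g.map_smul _ _) }
      naturality := fun _ _ _ => rfl }

lemma lcMap_comp {W W' W'' : Type u} [AddCommGroup W] [Module k W] [AddCommGroup W'] [Module k W']
    [AddCommGroup W''] [Module k W''] (A : X → Submodule k W) (A' : X → Submodule k W')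
    (A'' : X → Submodule k W'') (g : W →ₗ[k] W') (g' : W' →ₗ[k] W'') (hg hg') :
    lcMap A A' g hg ≫ lcMap A' A'' g' hg' =
      lcMap A A'' (g'.comp g) (fun x w hw => hg' x _ (hg x w hw)) :=
  rfl

lemma lcMap_congr {W W' : Type u} [AddCommGroup W] [Module k W] [AddCommGroup W'] [Module k W']
    {A : X → Submodule k W} {A' : X → Submodule k W'} {g g' : W →ₗ[k] W'} (h : g = g') (hg hg') :
    lcMap A A' g hg = lcMap A A' g' hg' := by
  subst h
  rfl

lemma lcMap_id {W : Type u} [AddCommGroup W] [Module k W] (A : X → Submodule k W) :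
    lcMap A A LinearMap.id (fun _ _ h => h) = 𝟙 (lcSheaf A) :=
  rfl

lemma lcMap_zero {W W' : Type u} [AddCommGroup W] [Module k W] [AddCommGroup W'] [Module k W']
    (A : X → Submodule k W) (A' : X → Submodule k W') (hg) :
    lcMap A A' (0 : W →ₗ[k] W') hg = 0 :=
  rfl

end LocallyConstant

/-! ### Compactly supported cohomology -/

section Compact

variable (k : Type u) [CommRing k] (X : TopCat.{u})

/-- The category of sheaves of `k`-modules on `X`. -/
abbrev Sh := TopCat.Sheaf (ModuleCat.{u} k) X

variable {k X} [T2Space X]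

/-- Sections of `F` over the open set `U` with compact support, regarded as global sections through
extension by zero: the global sections that vanish outside a compact subset of `U`. -/
def compactSections (U : Opens X) (F : Sh k X) : Submodule k (F.presheaf.obj (.op ⊤)) where
  carrier := {s | ∃ (K : Set X) (hK : IsCompact K), K ⊆ U ∧
    F.presheaf.map (homOfLE (le_top : (⟨Kᶜ, hK.isClosed.isOpen_compl⟩ : Opens X) ≤ ⊤)).op s = 0}
  zero_mem' := ⟨∅, isCompact_empty, by simp, map_zero _⟩
  add_mem' {s t} := by
    rintro ⟨K, hK, hKU, hs⟩ ⟨L, hL, hLU, ht⟩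
    refine ⟨K ∪ L, hK.union hL, Set.union_subset hKU hLU, ?_⟩
    have h1 : (⟨(K ∪ L)ᶜ, (hK.union hL).isClosed.isOpen_compl⟩ : Opens X) ≤
        ⟨Kᶜ, hK.isClosed.isOpen_compl⟩ := Set.compl_subset_compl.2 Set.subset_union_left
    have h2 : (⟨(K ∪ L)ᶜ, (hK.union hL).isClosed.isOpen_compl⟩ : Opens X) ≤
        ⟨Lᶜ, hL.isClosed.isOpen_compl⟩ := Set.compl_subset_compl.2 Set.subset_union_right
    have e1 := congrArg (F.presheaf.map (homOfLE h1).op) hs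
    have e2 := congrArg (F.presheaf.map (homOfLE h2).op) ht
    rw [map_zero, ← ModuleCat.comp_apply, ← Functor.map_comp] at e1 e2
    rw [map_add]
    exact (congrArg₂ (· + ·) e1 e2).trans (add_zero _)
  smul_mem' c s := by
    rintro ⟨K, hK, hKU, hs⟩
    exact ⟨K, hK, hKU, by rw [map_smul, hs, smul_zero]⟩

/-- The left exact functor `F ↦ Γ_c(U; F)`. -/
def gammaC (U : Opens X) : Sh k X ⥤ ModuleCat.{u} k where
  obj F := ModuleCat.of k (compactSections U F)
  map {F G} f := ModuleCat.ofHom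
    (LinearMap.restrict (p := compactSections U F) (q := compactSections U G)
      (f.hom.app (.op ⊤)).hom (by
        rintro s ⟨K, hK, hKU, hs⟩
        refine ⟨K, hK, hKU, ?_⟩
        have := congrArg (f.hom.app (.op ⟨Kᶜ, hK.isClosed.isOpen_compl⟩)) hs
        rw [map_zero] at this
        rw [← this]
        exact (ConcreteCategory.congr_hom (f.hom.naturality _) s).symm))
  map_id _ := rfl
  map_comp _ _ := rfl

instance (U : Opens X) : (gammaC (k := k) U).Additive where
  map_add := rfl

/-- Extension by zero `Γ_c(U; F) → Γ_c(V; F)` for `U ⊆ V`. -/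
def gammaCExt {U V : Opens X} (h : U ≤ V) : gammaC (k := k) U ⟶ gammaC V where
  app F := ModuleCat.ofHom (Submodule.inclusion (p := compactSections U F)
    (p' := compactSections V F)
    fun _ ⟨K, hK, hKU, hs⟩ => ⟨K, hK, hKU.trans h, hs⟩)
  naturality _ _ _ := rfl

variable [HasDerivedCategory.{w₁} (Sh k X)] [HasDerivedCategory.{w₂} (ModuleCat.{u} k)]

/-- Compactly supported (hyper)cohomology `H^i_c(U; F)` of a bounded below complex of sheaves,
the cohomology of the right derived functor of `Γ_c(U; -)`. -/
def cohomologyC (i : ℤ) (U : Opens X) : DerivedCategory.Plus (Sh k X) ⥤ ModuleCat.{u} k :=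
  (gammaC U).rightDerivedFunctorPlus ⋙ DerivedCategory.Plus.homologyFunctor _ i

/-- The natural transformation on bounded below homotopy categories induced by extension by zero. -/
def gammaCExtPlus {U V : Opens X} (h : U ≤ V) :
    (gammaC (k := k) U).mapHomotopyCategoryPlus ⟶ (gammaC V).mapHomotopyCategoryPlus where
  app K := ObjectProperty.homMk
    ((NatTrans.mapHomotopyCategory (gammaCExt (k := k) h) (ComplexShape.up ℤ)).app K.obj)
  naturality K L f := by
    ext : 1
    exact (NatTrans.mapHomotopyCategory (gammaCExt (k := k) h) (ComplexShape.up ℤ)).naturality f.hom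

/-- The covariant functoriality `H^i_c(U; F) → H^i_c(V; F)` for an inclusion `U ⊆ V` of open sets,
induced by extension by zero. -/
def cohomologyCExt (i : ℤ) {U V : Opens X} (h : U ≤ V) :
    cohomologyC (k := k) i U ⟶ cohomologyC i V :=
  Functor.whiskerRight
    (Functor.rightDerivedNatTrans _ _
      (gammaC (k := k) U).rightDerivedFunctorPlusUnit (gammaC V).rightDerivedFunctorPlusUnit
      (HomotopyCategory.Plus.quasiIso _)
      (Functor.whiskerRight (gammaCExtPlus h) DerivedCategory.Plus.Qh))
    (DerivedCategory.Plus.homologyFunctor _ i)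

end Compact

/-! ### Alternating cochains -/

section Alternating

/-- The alternating `p`-cochains on an index set `S` with values in a module `W`: the functions of
`(p + 1)`-tuples that change by the sign of a permutation of the entries and vanish on the tuples
with a repeated entry. -/
def altCochains (k : Type u) [CommRing k] (S W : Type u) [AddCommGroup W] [Module k W] (p : ℕ) :
    Submodule k ((Fin (p + 1) → S) → W) where
  carrier := {c | (∀ (I : Fin (p + 1) → S) (π : Equiv.Perm (Fin (p + 1))),
    c (I ∘ π) = (Equiv.Perm.sign π : ℤ) • c I) ∧ ∀ I, ¬ Function.Injective I → c I = 0}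
  zero_mem' := ⟨fun _ _ => by simp, fun _ _ => rfl⟩
  add_mem' {a b} ha hb := ⟨fun I π => by simp [ha.1 I π, hb.1 I π],
    fun I hI => by simp [ha.2 I hI, hb.2 I hI]⟩
  smul_mem' r a ha := ⟨fun I π => by simp [ha.1 I π, smul_comm r],
    fun I hI => by simp [ha.2 I hI]⟩

variable {k : Type u} [CommRing k] {S W W' : Type u} [AddCommGroup W] [Module k W]
  [AddCommGroup W'] [Module k W']

/-- The Čech differential `(dc)(σ₀, …, σ_{p+1}) = ∑ i, (-1)^i c(σ₀, …, σ̂_i, …, σ_{p+1})`. -/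
def cechD {p : ℕ} (c : (Fin (p + 1) → S) → W) (I : Fin (p + 2) → S) : W :=
  ∑ i : Fin (p + 2), (-1 : ℤ) ^ (i : ℕ) • c (I ∘ i.succAbove)

lemma cechD_swap {p : ℕ} {c : (Fin (p + 1) → S) → W} (hc : c ∈ altCochains k S W p)
    (I : Fin (p + 2) → S) (j : Fin (p + 1)) :
    cechD c (I ∘ Equiv.swap j.castSucc j.succ) = - cechD c I := by
  have hne : j.castSucc ≠ j.succ := (Fin.castSucc_lt_succ).ne
  have h0 : ∀ l, l ≠ j.castSucc → l ≠ j.succ → c ((I ∘ Equiv.swap j.castSucc j.succ) ∘ l.succAbove) =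
      - c (I ∘ l.succAbove) := by
    intro l h1 h2
    obtain ⟨a, ha⟩ := Fin.exists_succAbove_eq h1.symm
    obtain ⟨b, hb⟩ := Fin.exists_succAbove_eq h2.symm
    have hab : a ≠ b := by rintro rfl; exact hne (ha.symm.trans hb)
    have := Function.Injective.swap_comp (Fin.succAbove_right_injective (p := l)) a b
    rw [ha, hb] at this
    rw [Function.comp_assoc, this, ← Function.comp_assoc, hc.1, Equiv.Perm.sign_swap hab]
    simp
  have h1 : ∀ J : Fin (p + 2) → S, c ((J ∘ Equiv.swap j.castSucc j.succ) ∘ j.castSucc.succAbove) =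
      c (J ∘ j.succ.succAbove) := by
    intro J
    congr 1
    ext x
    simp only [Function.comp_apply]
    congr 1
    rcases lt_trichotomy x j with h | h | h
    · rw [Fin.succAbove_of_castSucc_lt _ _ (by simpa using h),
        Fin.succAbove_of_castSucc_lt _ _ (Fin.castSucc_lt_succ_iff.2 h.le),
        Equiv.swap_apply_of_ne_of_ne]
      · simpa using h.ne
      · exact (Fin.castSucc_lt_succ_iff.2 h.le).ne
    · subst h
      simp
    · rw [Fin.succAbove_of_le_castSucc _ _ (by simpa using h.le),
        Fin.succAbove_of_le_castSucc _ _ (Fin.succ_le_castSucc_iff.2 h),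
        Equiv.swap_apply_of_ne_of_ne]
      · exact (Fin.castSucc_lt_succ_iff.2 h.le).ne'
      · simpa using h.ne'
  have h2 : c ((I ∘ Equiv.swap j.castSucc j.succ) ∘ j.succ.succAbove) =
      c (I ∘ j.castSucc.succAbove) := by
    rw [← h1]
    congr 2
    ext x
    simp
  rw [eq_neg_iff_add_eq_zero, cechD, cechD, ← Finset.sum_add_distrib,
    Fintype.sum_eq_add j.castSucc j.succ hne (fun l hl => by rw [h0 l hl.1 hl.2]; simp), h1, h2]
  simp only [Fin.val_castSucc, Fin.val_succ, pow_succ, mul_neg, mul_one, neg_smul]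
  abel

lemma cechD_perm {p : ℕ} {c : (Fin (p + 1) → S) → W} (hc : c ∈ altCochains k S W p)
    (I : Fin (p + 2) → S) (π : Equiv.Perm (Fin (p + 2))) :
    cechD c (I ∘ π) = (Equiv.Perm.sign π : ℤ) • cechD c I := by
  have hπ : π ∈ Submonoid.closure (Set.range fun i : Fin (p + 1) ↦
      Equiv.swap i.castSucc i.succ) := by
    rw [Equiv.Perm.mclosure_swap_castSucc_succ]; trivial
  induction hπ using Submonoid.closure_induction generalizing I with
  | mem π h =>
    obtain ⟨j, rfl⟩ := h
    dsimp only
    rw [cechD_swap hc, Equiv.Perm.sign_swap (Fin.castSucc_lt_succ).ne]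
    simp
  | one => simp
  | mul π ρ _ _ hπ hρ =>
    rw [Equiv.Perm.coe_mul, ← Function.comp_assoc, hρ, hπ, smul_smul, map_mul, mul_comm]
    simp

lemma cechD_mem {p : ℕ} {c : (Fin (p + 1) → S) → W} (hc : c ∈ altCochains k S W p) :
    cechD c ∈ altCochains k S W (p + 1) := by
  refine ⟨cechD_perm hc, fun I hI => ?_⟩
  obtain ⟨a, b, hab, hne⟩ : ∃ a b, I a = I b ∧ a ≠ b := by
    simpa [Function.Injective] using hI
  obtain ⟨π, h0, h1⟩ : ∃ π : Equiv.Perm (Fin (p + 2)), π 0 = a ∧ π 1 = b := by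
    refine ⟨Equiv.swap (Equiv.swap 0 a 1) b * Equiv.swap 0 a, ?_, ?_⟩
    · rw [Equiv.Perm.mul_apply, Equiv.swap_apply_left, Equiv.swap_apply_of_ne_of_ne _ hne]
      intro h
      have := (Equiv.swap (0 : Fin (p + 2)) a).injective
        ((Equiv.swap_apply_left (0 : Fin (p + 2)) a).trans h)
      simp at this
    · simp [Equiv.Perm.mul_apply]
  have hJ : cechD c (I ∘ π) = 0 := by
    have hne' : (0 : Fin (p + 2)) ≠ 1 := by simp
    have e : (I ∘ π) ∘ (0 : Fin (p + 2)).succAbove = (I ∘ π) ∘ (1 : Fin (p + 2)).succAbove := by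
      ext x
      refine Fin.cases ?_ (fun y => ?_) x
      · simp [h0, h1, hab]
      · simp
    rw [cechD, Fintype.sum_eq_add 0 1 hne', e]
    · simp
    · intro l hl
      rw [hc.2, smul_zero]
      intro hinj
      obtain ⟨x, hx⟩ := Fin.exists_succAbove_eq hl.1.symm
      obtain ⟨y, hy⟩ := Fin.exists_succAbove_eq hl.2.symm
      have : x = y := hinj (by simp [hx, hy, h0, h1, hab])
      exact hne' (by rw [← hx, ← hy, this])
  have := cechD_perm hc I π
  rw [hJ] at this
  rcases Int.units_eq_one_or (Equiv.Perm.sign π) with h | h <;> simpa [h] using this.symm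

lemma cechD_cechD {p : ℕ} (c : (Fin (p + 1) → S) → W) : cechD (cechD c) = 0 := by
  ext I
  simp only [cechD, Finset.smul_sum, smul_smul, ← pow_add, ← Finset.sum_product', Pi.zero_apply]
  refine Finset.sum_involution (fun x _ => (x.1.succAbove x.2, x.2.predAbove x.1)) ?_ ?_ ?_ ?_
  · rintro ⟨i, j⟩ _
    have e : ((I ∘ (i.succAbove j).succAbove) ∘ (j.predAbove i).succAbove) =
        (I ∘ i.succAbove) ∘ j.succAbove := by
      ext x
      simp [Fin.succAbove_succAbove_succAbove_predAbove]
    dsimp only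
    rw [e, Fin.neg_one_pow_succAbove_add_predAbove, neg_smul, add_neg_cancel]
  · rintro ⟨i, j⟩ _ _ h
    exact Fin.succAbove_ne i j (congrArg Prod.fst h)
  · intro _ _
    exact Finset.mem_product.2 ⟨Finset.mem_univ _, Finset.mem_univ _⟩
  · rintro ⟨i, j⟩ _
    simp [Fin.succAbove_succAbove_predAbove, Fin.predAbove_predAbove_succAbove]

variable (k S W) in
/-- The Čech differential on alternating cochains. -/
def altD (p : ℕ) : altCochains k S W p →ₗ[k] altCochains k S W (p + 1) where
  toFun c := ⟨cechD c.1, cechD_mem c.2⟩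
  map_add' a b := by
    ext I
    simp [cechD, Finset.sum_add_distrib]
  map_smul' r a := by
    ext I
    simp [cechD, Finset.smul_sum, smul_comm r]

lemma altD_altD (p : ℕ) (c : altCochains k S W p) : altD k S W (p + 1) (altD k S W p c) = 0 :=
  Subtype.ext (cechD_cechD c.1)

variable (S) in
/-- The map on cochains induced by a linear map of coefficients. -/
def altMap (g : W →ₗ[k] W') (p : ℕ) : altCochains k S W p →ₗ[k] altCochains k S W' p where
  toFun c := ⟨fun I => g (c.1 I), fun I π => by simp [c.2.1 I π], fun I hI => by simp [c.2.2 I hI]⟩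
  map_add' a b := by ext I; simp
  map_smul' r a := by ext I; simp

lemma altMap_altD (g : W →ₗ[k] W') (p : ℕ) (c : altCochains k S W p) :
    altMap S g (p + 1) (altD k S W p c) = altD k S W' p (altMap S g p c) := by
  ext I
  simp [altMap, altD, cechD]

end Alternating

/-! ### The coherent-constructible correspondence -/

section Kappa

variable {ι : Type u} [Fintype ι] {k : Type u} [CommRing k] {Δ : Fan ι}

variable (ι) in
/-- The real vector space `M_ℝ`, as a topological space. -/
abbrev space : TopCat.{u} := TopCat.of (ι → ℝ)

/-- The stalk at `v` of the sheaf that corresponds to `j_{σ*} j_σ^* 𝓔`. This sheaf is the subsheaf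
`∑_m Γ(U_σ, 𝓔)_m · Θ(σ, m)` of the constant sheaf with value the generic stalk `E`, where `Θ(σ, m)` is
the extension by zero of the constant sheaf `k` on `(m + σ^∨)°`. See `kappaStalk_eq_span`: if
`𝓔|_{U_σ}` is a sum of line bundles `𝒪(χ_i)`, this is the sum of the sheaves `Θ(σ, χ_i)`. -/
def Bundle.kappaStalk (E : Bundle k Δ) (σ : Δ.Cone) (v : ι → ℝ) : Submodule k E.fiber :=
  ⨆ (m : ι → ℤ) (_ : v ∈ openDual σ.1 m), (E.deg σ m).map (E.value σ)

lemma openDual_anti {σ τ : PointedCone ℝ (ι → ℝ)} (h : τ ≤ σ) (χ : ι → ℤ) :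
    openDual σ χ ⊆ openDual τ χ :=
  fun _ hv x hx => hv x (h hx)

/-- If the sections over `U_σ` split as `⨁ 𝒪(χ_i)`, with generators of value `e i` at `x₀`,
then the stalk at `v` is spanned by the `e i` for which `v ∈ (χ_i + σ^∨)°`. -/
lemma Bundle.kappaStalk_eq_span (E : Bundle k Δ) (σ : Δ.Cone) {J : Type*} (e : J → E.fiber)
    (χ : J → ι → ℤ)
    (h : ∀ m, (E.deg σ m).map (E.value σ) =
      Submodule.span k (e '' {i | m - χ i ∈ semigroup σ.1})) (v : ι → ℝ) :
    E.kappaStalk σ v = Submodule.span k (e '' {i | v ∈ openDual σ.1 (χ i)}) := by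
  have hz : ∀ i, χ i - χ i ∈ semigroup σ.1 := fun i => by rw [sub_self]; exact zero_mem _
  refine le_antisymm (iSup₂_le fun m hm => ?_) (Submodule.span_le.2 ?_)
  · rw [h]
    refine Submodule.span_mono (Set.image_mono fun i hi x hx hx0 => ?_)
    have h1 := hi x hx
    have h2 : toReal (m - χ i) = toReal m - toReal (χ i) := by ext i; simp [toReal]
    rw [h2, sub_dotProduct] at h1
    exact (sub_nonneg.1 h1).trans_lt (hm x hx hx0)
  · rintro _ ⟨i, hi, rfl⟩
    refine Submodule.mem_iSup_of_mem (χ i) (Submodule.mem_iSup_of_mem hi ?_)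
    rw [h]
    exact Submodule.subset_span ⟨i, hz i, rfl⟩

lemma Bundle.kappaStalk_mono (E : Bundle k Δ) {σ τ : Δ.Cone} (h : τ ≤ σ) (v : ι → ℝ) :
    E.kappaStalk σ v ≤ E.kappaStalk τ v := by
  refine iSup₂_le fun m hm => ?_
  rintro _ ⟨p, hp, rfl⟩
  refine Submodule.mem_iSup_of_mem m (Submodule.mem_iSup_of_mem (openDual_anti h m hm) ?_)
  refine ⟨E.res h p, E.res_mem h m p hp, ?_⟩
  simp [Bundle.value, E.res_res]

lemma Bundle.Hom.fiberMap_mem_kappaStalk {E E' : Bundle k Δ} (f : Bundle.Hom E E') (σ : Δ.Cone)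
    (v : ι → ℝ) {e : E.fiber} (he : e ∈ E.kappaStalk σ v) :
    f.fiberMap e ∈ E'.kappaStalk σ v := by
  suffices h : E.kappaStalk σ v ≤ (E'.kappaStalk σ v).comap f.fiberMap from h he
  refine iSup₂_le fun m hm => ?_
  rintro _ ⟨p, hp, rfl⟩
  refine Submodule.mem_iSup_of_mem m (Submodule.mem_iSup_of_mem hm ?_)
  exact ⟨f.app σ p, f.app_mem σ m p hp, (f.fiberMap_value σ p).symm⟩

lemma Fan.inter_le (Δ : Fan ι) {p : ℕ} (I : Fin (p + 2) → Δ.Cone) (i : Fin (p + 2)) :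
    Δ.inter I ≤ Δ.inter (I ∘ i.succAbove) :=
  (le_iInf fun j => iInf_le _ (i.succAbove j) : (⨅ i, (I i).1) ≤ ⨅ j, (I (i.succAbove j)).1)

/-- The stalk at `v` of the sheaf that corresponds to the `p`-th term of the (alternating) Čech
complex of the bundle for the covering of the toric variety by the affine charts `U_σ`: the
component at `(σ₀, …, σ_p)` lies in the sheaf attached to `U_{σ₀} ∩ … ∩ U_{σ_p}`. -/
def Bundle.cechStalk (E : Bundle k Δ) (p : ℕ) (v : space ι) :
    Submodule k (altCochains k Δ.Cone E.fiber p) where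
  carrier := {c | ∀ I, c.1 I ∈ E.kappaStalk (Δ.inter I) v}
  zero_mem' _ := zero_mem _
  add_mem' ha hb I := add_mem (ha I) (hb I)
  smul_mem' r _ ha I := Submodule.smul_mem _ r (ha I)

lemma Bundle.altD_mem_cechStalk (E : Bundle k Δ) (p : ℕ) (v : space ι)
    (c : altCochains k Δ.Cone E.fiber p) (hc : c ∈ E.cechStalk p v) :
    altD k Δ.Cone E.fiber p c ∈ E.cechStalk (p + 1) v := by
  intro I
  change ∑ i : Fin (p + 2), (-1 : ℤ) ^ (i : ℕ) • c.1 (I ∘ i.succAbove) ∈ _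
  exact sum_mem fun i _ => zsmul_mem (E.kappaStalk_mono (Δ.inter_le I i) v (hc _)) _

/-- The terms of the complex of sheaves that corresponds to the Čech complex of the bundle. -/
def Bundle.cechSheaf (E : Bundle k Δ) (p : ℕ) : Sh k (space ι) := lcSheaf (E.cechStalk p)

/-- Its differential. -/
def Bundle.cechDiff (E : Bundle k Δ) (p : ℕ) : E.cechSheaf p ⟶ E.cechSheaf (p + 1) :=
  lcMap _ _ (altD k Δ.Cone E.fiber p) (E.altD_mem_cechStalk p)

lemma Bundle.cechDiff_comp (E : Bundle k Δ) (p : ℕ) : E.cechDiff p ≫ E.cechDiff (p + 1) = 0 := by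
  refine (lcMap_comp (E.cechStalk p) (E.cechStalk (p + 1)) (E.cechStalk (p + 2)) (altD _ _ _ p)
    (altD _ _ _ (p + 1)) (E.altD_mem_cechStalk p) (E.altD_mem_cechStalk (p + 1))).trans ?_
  exact (lcMap_congr (LinearMap.ext (altD_altD p)) _ (by simp)).trans (lcMap_zero _ _ _)

/-- The complex of sheaves that corresponds to the Čech complex of the bundle. -/
def Bundle.cechComplex (E : Bundle k Δ) : CochainComplex (Sh k (space ι)) ℕ :=
  CochainComplex.of E.cechSheaf E.cechDiff E.cechDiff_comp

lemma Bundle.Hom.altMap_mem_cechStalk {E E' : Bundle k Δ} (f : Bundle.Hom E E') (p : ℕ)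
    (v : space ι) (c : altCochains k Δ.Cone E.fiber p) (hc : c ∈ E.cechStalk p v) :
    altMap Δ.Cone f.fiberMap p c ∈ E'.cechStalk p v :=
  fun I => f.fiberMap_mem_kappaStalk (Δ.inter I) v (hc I)

/-- The action of a morphism of bundles on the terms of the complexes. -/
def Bundle.Hom.cechSheafMap {E E' : Bundle k Δ} (f : Bundle.Hom E E') (p : ℕ) :
    E.cechSheaf p ⟶ E'.cechSheaf p :=
  lcMap _ _ (altMap Δ.Cone f.fiberMap p) (f.altMap_mem_cechStalk p)

lemma Bundle.Hom.cechSheafMap_comm {E E' : Bundle k Δ} (f : Bundle.Hom E E') (p : ℕ) :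
    f.cechSheafMap p ≫ E'.cechDiff p = E.cechDiff p ≫ f.cechSheafMap (p + 1) := by
  refine (lcMap_comp (E.cechStalk p) (E'.cechStalk p) (E'.cechStalk (p + 1)) _ _
    (f.altMap_mem_cechStalk p) (E'.altD_mem_cechStalk p)).trans ?_
  refine Eq.trans ?_
    (lcMap_comp (E.cechStalk p) (E.cechStalk (p + 1)) (E'.cechStalk (p + 1)) _ _
      (E.altD_mem_cechStalk p) (f.altMap_mem_cechStalk (p + 1))).symm
  exact lcMap_congr (LinearMap.ext fun c => (altMap_altD f.fiberMap p c).symm) _ _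

/-- The action of a morphism of bundles on the complexes of sheaves. -/
def Bundle.Hom.cechMap {E E' : Bundle k Δ} (f : Bundle.Hom E E') :
    E.cechComplex ⟶ E'.cechComplex :=
  CochainComplex.ofHom (X := E.cechComplex) (Y := E'.cechComplex) f.cechSheafMap (fun p => by
    simpa [Bundle.cechComplex] using f.cechSheafMap_comm p)

lemma Bundle.cechSheafMap_id (E : Bundle k Δ) (p : ℕ) :
    Bundle.Hom.cechSheafMap (𝟙 E) p = 𝟙 (E.cechSheaf p) := by
  refine Eq.trans ?_ (lcMap_id (E.cechStalk p))
  refine lcMap_congr (LinearMap.ext fun c => ?_) _ _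
  rw [Bundle.fiberMap_id]
  rfl

lemma Bundle.cechSheafMap_comp {E E' E'' : Bundle k Δ} (f : E ⟶ E') (g : E' ⟶ E'') (p : ℕ) :
    Bundle.Hom.cechSheafMap (f ≫ g) p =
      Bundle.Hom.cechSheafMap f p ≫ Bundle.Hom.cechSheafMap g p := by
  refine Eq.trans ?_
    (lcMap_comp (E.cechStalk p) (E'.cechStalk p) (E''.cechStalk p) _ _
      (Bundle.Hom.altMap_mem_cechStalk f p) (Bundle.Hom.altMap_mem_cechStalk g p)).symm
  refine lcMap_congr (LinearMap.ext fun c => ?_) _ _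
  rw [Bundle.fiberMap_comp]
  rfl

variable (k Δ) in
/-- The functor that sends a bundle to the complex of sheaves of its Čech complex. -/
def cechFunctor : Bundle k Δ ⥤ CochainComplex (Sh k (space ι)) ℕ where
  obj E := E.cechComplex
  map f := Bundle.Hom.cechMap f
  map_id E := by
    ext p : 1
    exact E.cechSheafMap_id p
  map_comp f g := by
    ext p : 1
    exact Bundle.cechSheafMap_comp f g p

variable (k Δ) in
/-- `κ(𝓔)` as a bounded below complex of sheaves on `M_ℝ`: the `p`-th term of the Čech complex is
placed in degree `p - dim M_ℝ`. -/
def kappaComplex : Bundle k Δ ⥤ CochainComplex.Plus (Sh k (space ι)) :=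
  ObjectProperty.lift _
    (cechFunctor k Δ ⋙ ComplexShape.embeddingUpNat.extendFunctor _ ⋙
      shiftFunctor (CochainComplex (Sh k (space ι)) ℤ) (Fintype.card ι : ℤ))
    (fun E => ⟨-(Fintype.card ι : ℤ), CochainComplex.isStrictlyGE_shift
      (E.cechComplex.extend ComplexShape.embeddingUpNat) 0 _ _ (by simp)⟩)

variable (k Δ) in
/-- The functor `κ` from equivariant vector bundles to the derived category of sheaves on `M_ℝ`. -/
def kappa [HasDerivedCategory.{w₁} (Sh k (space ι))] :
    Bundle k Δ ⥤ DerivedCategory.Plus (Sh k (space ι)) :=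
  kappaComplex k Δ ⋙ DerivedCategory.Plus.Q

/-- The open half-space `α⁻¹(-∞, t) = {v ∈ M_ℝ | ⟨α, v⟩ < t}`. -/
def halfSpace (α : ι → ℤ) (t : ℝ) : Opens (space ι) :=
  ⟨{v | toReal α ⬝ᵥ v < t}, isOpen_lt (by fun_prop) continuous_const⟩

/-- `α` is a lattice generator of the ray `ρ` of the fan. -/
def IsRayGenerator (ρ : Δ.Cone) (α : ι → ℤ) : Prop :=
  α ≠ 0 ∧ ρ.1 = PointedCone.hull ℝ {toReal α}

lemma IsRayGenerator.mem {ρ : Δ.Cone} {α : ι → ℤ} (h : IsRayGenerator ρ α) : toReal α ∈ ρ.1 := by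
  rw [h.2]
  exact PointedCone.subset_hull rfl

end Kappa

end Toric

end

noncomputable section

namespace Toric

/-! ### Compactly supported cohomology of flabby complexes -/

section Flabby

open Set Topology

set_option linter.unusedSectionVars false

/-- The global sections of a bounded below complex of flabby sheaves, together with the open set
`z s` on which a section `s` vanishes. -/
structure FlabbyCx (X : Type*) [TopologicalSpace X] where
  M : ℤ → Type*
  [grp : ∀ q, AddCommGroup (M q)]
  d : ∀ q, M q →+ M (q + 1)
  d_d : ∀ q s, d (q + 1) (d q s) = 0
  z : ∀ {q}, M q → Set X
  isOpen_z : ∀ {q} (s : M q), IsOpen (z s)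
  z_zero : ∀ {q}, z (0 : M q) = univ
  eq_zero : ∀ {q} (s : M q), z s = univ → s = 0
  z_neg : ∀ {q} (s : M q), z s ⊆ z (-s)
  z_add : ∀ {q} (s t : M q), z s ∩ z t ⊆ z (s + t)
  z_d : ∀ {q} (s : M q), z s ⊆ z (d q s)
  glue : ∀ {q} (s t : M q) (V W : Set X), IsOpen V → IsOpen W → V ∩ W ⊆ z (s - t) →
    ∃ r : M q, V ⊆ z (r - s) ∧ W ⊆ z (r - t)
  bounded : ∃ n, ∀ q < n, Subsingleton (M q)

attribute [instance] FlabbyCx.grp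

namespace FlabbyCx

section Basic

variable {X : Type*} [TopologicalSpace X] (J : FlabbyCx X)

lemma mem_z_zero {q} (x : X) : x ∈ J.z (0 : J.M q) := by rw [J.z_zero]; trivial

variable {J}

lemma mem_neg {q} {s : J.M q} {x : X} (hs : x ∈ J.z s) : x ∈ J.z (-s) := J.z_neg s hs

lemma mem_add {q} {s t : J.M q} {x : X} (hs : x ∈ J.z s) (ht : x ∈ J.z t) : x ∈ J.z (s + t) :=
  J.z_add s t ⟨hs, ht⟩

lemma mem_sub {q} {s t : J.M q} {x : X} (hs : x ∈ J.z s) (ht : x ∈ J.z t) : x ∈ J.z (s - t) := by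
  rw [sub_eq_add_neg]
  exact mem_add hs (mem_neg ht)

lemma mem_d {q} {s : J.M q} {x : X} (hs : x ∈ J.z s) : x ∈ J.z (J.d q s) := J.z_d s hs

lemma mem_trans {q} {r s t : J.M q} {x : X} (h : x ∈ J.z (r - s)) (h' : x ∈ J.z (s - t)) :
    x ∈ J.z (r - t) := by
  simpa using mem_add h h'

lemma mem_symm {q} {r s : J.M q} {x : X} (h : x ∈ J.z (r - s)) : x ∈ J.z (s - r) := by
  simpa using mem_neg h

lemma mem_of_mem_sub {q} {r s : J.M q} {x : X} (h : x ∈ J.z (r - s)) (h' : x ∈ J.z s) :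
    x ∈ J.z r := by
  simpa using mem_add h h'

lemma mem_sub_d_of {q} {s : J.M (q + 1)} {t t' : J.M q} {x : X} (h : x ∈ J.z (s - J.d q t))
    (h' : x ∈ J.z (t' - t)) : x ∈ J.z (s - J.d q t') := by
  have := mem_sub h (mem_d h')
  rwa [map_sub, sub_sub, add_sub_cancel] at this

variable (J)

/-- The sections with compact support in `U`. -/
def CS (U : Set X) {q} (s : J.M q) : Prop := ∃ K, IsCompact K ∧ K ⊆ U ∧ Kᶜ ⊆ J.z s

/-- Exactness at a point. -/
def ExactAt (x : X) : Prop := ∀ q (s : J.M (q + 1)), x ∈ J.z (J.d _ s) →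
  ∃ t : J.M q, x ∈ J.z (s - J.d q t)

/-- Sections with compact support in `U` that are closed near `C` are exact near `C`. -/
def ExactNear (U C : Set X) (q : ℤ) : Prop := ∀ s : J.M (q + 1), J.CS U s → C ⊆ J.z (J.d _ s) →
  ∃ t : J.M q, J.CS U t ∧ C ⊆ J.z (s - J.d q t)

variable {J} {U : Set X}

lemma CS.zero {q} : J.CS U (0 : J.M q) := ⟨∅, isCompact_empty, by simp, by simp [J.z_zero]⟩

lemma CS.add {q} {s t : J.M q} (hs : J.CS U s) (ht : J.CS U t) : J.CS U (s + t) := by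
  obtain ⟨K, hK, hKU, h⟩ := hs
  obtain ⟨L, hL, hLU, h'⟩ := ht
  refine ⟨K ∪ L, hK.union hL, union_subset hKU hLU, fun x hx => ?_⟩
  rw [compl_union] at hx
  exact mem_add (h hx.1) (h' hx.2)

lemma CS.neg {q} {s : J.M q} (hs : J.CS U s) : J.CS U (-s) := by
  obtain ⟨K, hK, hKU, h⟩ := hs
  exact ⟨K, hK, hKU, h.trans (J.z_neg s)⟩

lemma CS.sub {q} {s t : J.M q} (hs : J.CS U s) (ht : J.CS U t) : J.CS U (s - t) := by
  rw [sub_eq_add_neg]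
  exact hs.add ht.neg

lemma CS.d {q} {s : J.M q} (hs : J.CS U s) : J.CS U (J.d q s) := by
  obtain ⟨K, hK, hKU, h⟩ := hs
  exact ⟨K, hK, hKU, h.trans (J.z_d s)⟩

lemma glue_closed [NormalSpace X] {q} (s t : J.M q) {C D : Set X} (hC : IsClosed C)
    (hD : IsClosed D) (h : C ∩ D ⊆ J.z (s - t)) :
    ∃ r : J.M q, C ⊆ J.z (r - s) ∧ D ⊆ J.z (r - t) := by
  have hz := J.isOpen_z (s - t)
  obtain ⟨V, W, hV, hW, hCV, hDW, hVW⟩ := normal_separation (hC.sdiff hz) (hD.sdiff hz) (by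
    rw [disjoint_left]
    rintro x ⟨hx, hx'⟩ ⟨hy, -⟩
    exact hx' (h ⟨hx, hy⟩))
  obtain ⟨r, h1, h2⟩ := J.glue s t (V ∪ J.z (s - t)) (W ∪ J.z (s - t)) (hV.union hz)
    (hW.union hz) (by
      rw [← inter_union_distrib_right, hVW.inter_eq]
      simp)
  refine ⟨r, fun x hx => h1 ?_, fun x hx => h2 ?_⟩
  · by_cases hxz : x ∈ J.z (s - t)
    · exact Or.inr hxz
    · exact Or.inl (hCV ⟨hx, hxz⟩)
  · by_cases hxz : x ∈ J.z (s - t)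
    · exact Or.inr hxz
    · exact Or.inl (hDW ⟨hx, hxz⟩)

lemma degree_induction {P : ℤ → Prop} (h0 : ∀ q, Subsingleton (J.M (q + 1)) → P q)
    (h1 : ∀ q, P q → P (q + 1)) (q : ℤ) : P q := by
  obtain ⟨n, hn⟩ := J.bounded
  have h : ∀ m : ℕ, P (n - 2 + m) := by
    intro m
    induction m with
    | zero => exact h0 _ (hn _ (by simp; omega))
    | succ m ih => rw [Nat.cast_succ, ← add_assoc]; exact h1 _ ih
  by_cases hq : q < n - 1
  · exact h0 q (hn _ (by omega))
  · have := h (q - (n - 2)).toNat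
    rwa [Int.toNat_of_nonneg (by omega), add_sub_cancel] at this

lemma ExactNear.of_subsingleton {C : Set X} {q : ℤ} (h : Subsingleton (J.M (q + 1))) :
    J.ExactNear U C q := fun s _ _ => by
  refine ⟨0, CS.zero, fun x _ => ?_⟩
  rw [Subsingleton.elim (s - _) 0]
  exact J.mem_z_zero x

variable [LocallyCompactSpace X] [NormalSpace X]

lemma exists_cs_eq (hU : IsOpen U) {q} (t : J.M q) {C K : Set X} (hC : IsClosed C)
    (hK : IsCompact K) (hKU : K ⊆ U) (h : C \ K ⊆ J.z t) :
    ∃ t' : J.M q, J.CS U t' ∧ C ⊆ J.z (t' - t) := by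
  obtain ⟨L, hL, hKL, hLU⟩ := exists_compact_between hK hU hKU
  obtain ⟨r, h1, h2⟩ := glue_closed t 0 hC (isOpen_interior (s := L)).isClosed_compl (by
    rw [sub_zero]
    exact fun x hx => h ⟨hx.1, fun hxK => hx.2 (hKL hxK)⟩)
  refine ⟨r, ⟨L, hL, hLU, fun x hx => ?_⟩, h1⟩
  simpa using h2 (fun hx' => hx (interior_subset hx') : x ∈ (interior L)ᶜ)

lemma glue_closed_cs (hU : IsOpen U) {q} {s t : J.M q} (hs : J.CS U s) (ht : J.CS U t)
    {C D : Set X} (hC : IsClosed C) (hD : IsClosed D) (h : C ∩ D ⊆ J.z (s - t)) :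
    ∃ r : J.M q, J.CS U r ∧ C ⊆ J.z (r - s) ∧ D ⊆ J.z (r - t) := by
  obtain ⟨r, h1, h2⟩ := glue_closed s t hC hD h
  obtain ⟨K, hK, hKU, h⟩ := hs
  obtain ⟨L, hL, hLU, h'⟩ := ht
  obtain ⟨r', hr', h3⟩ := exists_cs_eq hU r (hC.union hD) (hK.union hL) (union_subset hKU hLU) (by
    rintro x ⟨hx | hx, hx'⟩
    · exact mem_of_mem_sub (h1 hx) (h fun h => hx' (Or.inl h))
    · exact mem_of_mem_sub (h2 hx) (h' fun h => hx' (Or.inr h)))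
  exact ⟨r', hr', fun x hx => mem_trans (h3 (Or.inl hx)) (h1 hx),
    fun x hx => mem_trans (h3 (Or.inr hx)) (h2 hx)⟩

lemma exact_union (hU : IsOpen U) {q} {s : J.M (q + 1 + 1)} {C D : Set X} (hC : IsClosed C)
    (hD : IsClosed D) (hCD : J.ExactNear U (C ∩ D) q)
    (h : ∃ t, J.CS U t ∧ C ⊆ J.z (s - J.d _ t)) (h' : ∃ t, J.CS U t ∧ D ⊆ J.z (s - J.d _ t)) :
    ∃ t, J.CS U t ∧ C ∪ D ⊆ J.z (s - J.d _ t) := by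
  obtain ⟨t, ht, hs⟩ := h
  obtain ⟨t', ht', hs'⟩ := h'
  obtain ⟨v, hv, h⟩ := hCD (t - t') (ht.sub ht') (fun x hx => by
    have := mem_trans (mem_symm (hs hx.1)) (hs' hx.2)
    rwa [← map_sub] at this)
  obtain ⟨r, hr, h1, h2⟩ := glue_closed_cs (s := t) (t := t' + J.d _ v) hU ht (ht'.add hv.d) hC hD
    (by rwa [← sub_sub])
  refine ⟨r, hr, union_subset (fun x hx => mem_sub_d_of (hs hx) (h1 hx)) fun x hx => ?_⟩
  refine mem_sub_d_of (t := t' + J.d _ v) ?_ (h2 hx)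
  rw [map_add, J.d_d, add_zero]
  exact hs' hx

variable [T2Space X]

lemma exists_exact_point (hU : IsOpen U) {q} {s : J.M (q + 1)} {x : X} (hx : x ∈ U)
    (hs : x ∈ J.z (J.d _ s)) (h : J.ExactAt x) :
    ∃ t, J.CS U t ∧ x ∈ J.z (s - J.d q t) := by
  obtain ⟨t, ht⟩ := h q s hs
  obtain ⟨t', ht', h'⟩ := exists_cs_eq hU t (isClosed_singleton (x := x)) isCompact_singleton
    (by simpa using hx) (by simp)
  exact ⟨t', ht', mem_sub_d_of ht (h' rfl)⟩

lemma exactNear_of_exactAt (hU : IsOpen U) {C : Set X} (hC : IsClosed C)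
    (h : ∀ x ∈ C, x ∈ U → J.ExactAt x) (q : ℤ) : J.ExactNear U C q := by
  refine degree_induction (J := J) (P := fun q => ∀ C : Set X, IsClosed C →
    (∀ x ∈ C, x ∈ U → J.ExactAt x) → J.ExactNear U C q)
    (fun q hq C _ _ => ExactNear.of_subsingleton hq) (fun q ih C hC h => ?_) q C hC h
  intro s hs hds
  have hcs := hs
  obtain ⟨K, hK, hKU, hKs⟩ := hs
  obtain ⟨L, hL, hKL, hLU⟩ := exists_compact_between hK hU hKU
  have key : ∃ t, J.CS U t ∧ C ∩ closure L ⊆ J.z (s - J.d _ t) := by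
    refine hL.induction_on (p := fun A => ∃ t, J.CS U t ∧ C ∩ closure A ⊆ J.z (s - J.d _ t))
      ⟨0, CS.zero, by simp⟩ ?_ ?_ ?_
    · rintro A B hAB ⟨t, ht, h⟩
      exact ⟨t, ht, (inter_subset_inter_right _ (closure_mono hAB)).trans h⟩
    · intro A B hA hB
      rw [closure_union, inter_union_distrib_left]
      have hA' : IsClosed (C ∩ closure A) := hC.inter isClosed_closure
      have hB' : IsClosed (C ∩ closure B) := hC.inter isClosed_closure
      exact exact_union hU hA' hB' (ih _ (hA'.inter hB') fun x hx => h x hx.1.1) hA hB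
    · intro x hx
      by_cases hxC : x ∈ C
      · obtain ⟨t, ht, hxt⟩ := exists_exact_point hU (hLU hx) (hds hxC) (h x hxC (hLU hx))
        obtain ⟨A, hA, hAc, hAz⟩ := exists_mem_nhds_isClosed_subset
          ((J.isOpen_z _).mem_nhds hxt)
        refine ⟨A, mem_nhdsWithin_of_mem_nhds hA, t, ht, ?_⟩
        rw [hAc.closure_eq]
        exact inter_subset_right.trans hAz
      · obtain ⟨A, hA, hAc, hAz⟩ := exists_mem_nhds_isClosed_subset
          (hC.isOpen_compl.mem_nhds hxC)
        refine ⟨A, mem_nhdsWithin_of_mem_nhds hA, 0, CS.zero, ?_⟩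
        rw [hAc.closure_eq]
        exact fun y hy => absurd hy.1 (hAz hy.2)
  rw [hL.isClosed.closure_eq] at key
  have hC1 : IsClosed (C ∩ L) := hC.inter hL.isClosed
  have hC2 : IsClosed (C ∩ (interior L)ᶜ) := hC.inter isOpen_interior.isClosed_compl
  obtain ⟨t, ht, htC⟩ := exact_union (s := s) hU hC1 hC2
    (ih _ (hC1.inter hC2) fun x hx => h x hx.1.1) key ⟨0, CS.zero, fun x hx => by
      rw [map_zero, sub_zero]
      exact hKs fun hxK => hx.2 (hKL hxK)⟩
  refine ⟨t, ht, fun x hx => htC ?_⟩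
  by_cases hxL : x ∈ L
  · exact Or.inl ⟨hx, hxL⟩
  · exact Or.inr ⟨hx, fun h => hxL (interior_subset h)⟩

end Basic

section Radial

variable {X : Type*} [NormedAddCommGroup X] [NormedSpace ℝ X] [ProperSpace X]

/-- The complex `J` behaves on the segments that end at `p` as if its cohomology sheaves were
extended uniquely from each point of `U` towards `p`, and it is exact at `p`. -/
structure IsRadial (J : FlabbyCx X) (U : Set X) (p : X) : Prop where
  extend : ∀ q (m : J.M (q + 1)), ∀ y ∈ U, y ∈ J.z (J.d _ m) →
    ∃ (m' : J.M (q + 1)) (v : J.M q), segment ℝ p y ⊆ J.z (J.d _ m') ∧ y ∈ J.z (m - m' - J.d _ v)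
  exact_of_near : ∀ q (m : J.M (q + 1)), ∀ x ∈ U, x ∈ J.z (J.d _ m) → ∀ᶠ y in 𝓝 x, y ∈ U →
    x ∈ segment ℝ p y → (∃ t, y ∈ J.z (m - J.d q t)) → ∃ t, x ∈ J.z (m - J.d q t)
  exactAt : J.ExactAt p

variable {J : FlabbyCx X} {U : Set X} {p θ : X}

lemma isometry_ray (hθ : ‖θ‖ = 1) : Isometry fun r : ℝ => p + r • θ :=
  Isometry.of_dist_eq fun a b => by
    simp [dist_eq_norm, ← sub_smul, norm_smul, hθ]

lemma ray_mem_segment {a b : ℝ} (ha : 0 ≤ a) (hab : a ≤ b) :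
    p + a • θ ∈ segment ℝ p (p + b • θ) := by
  rw [segment_eq_image']
  rcases eq_or_lt_of_le (ha.trans hab) with h | h
  · obtain rfl : a = 0 := le_antisymm (hab.trans h.symm.le) ha
    exact ⟨0, by simp, by simp⟩
  · refine ⟨a / b, ⟨by positivity, (div_le_one h).2 hab⟩, ?_⟩
    simp only [add_sub_cancel_left, smul_smul]
    rw [div_mul_cancel₀ _ h.ne']

/-- Along a ray, exactness spreads from the outer end of a segment towards `p`. -/
lemma IsRadial.exact_ray_step (hJ : J.IsRadial U p) (hθ : ‖θ‖ = 1) {q} {s : J.M (q + 1 + 1)}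
    {R : ℝ} (hRU : ∀ r ∈ Icc 0 R, p + r • θ ∈ U)
    (hs : ∀ r ∈ Icc 0 R, p + r • θ ∈ J.z (J.d _ s)) {G : Set ℝ}
    (hG : G = {r ∈ Icc 0 R | ∃ t, (∀ r' ∈ Icc r R, p + r' • θ ∈ J.z (s - J.d _ t)) ∧
      p + R • θ ∈ J.z t}) {a : ℝ} (ha : a ∈ Icc 0 R)
    (haG : ∀ δ > 0, ∃ r ∈ G, a ≤ r ∧ r < a + δ) :
    ∃ δ > 0, ∀ r, 0 ≤ r → a - δ < r → r ≤ a → r ∈ G := by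
  have hγ := isometry_ray (p := p) hθ
  have hc := hγ.continuous
  obtain ⟨δ₀, hδ₀, h₀⟩ := Metric.eventually_nhds_iff.1
    (hJ.exact_of_near _ s _ (hRU a ha) (hs a ha))
  obtain ⟨b, hb, hab, hb'⟩ := haG δ₀ hδ₀
  rw [hG] at hb
  obtain ⟨hbR, t₂, ht₂, -⟩ := hb
  obtain ⟨t₁, ht₁⟩ := h₀ (y := p + b • θ)
    (by rw [hγ.dist_eq, Real.dist_eq, abs_of_nonneg] <;> linarith) (hRU b hbR)
    (ray_mem_segment ha.1 hab) ⟨t₂, ht₂ b ⟨le_rfl, hbR.2⟩⟩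
  obtain ⟨δ, hδ, h⟩ := Metric.mem_nhds_iff.1
    (((J.isOpen_z (s - J.d _ t₁)).preimage hc).mem_nhds ht₁)
  obtain ⟨c, hcG, hac, hc'⟩ := haG δ hδ
  rw [hG] at hcG
  obtain ⟨hcR, t₃, ht₃, ht₃R⟩ := hcG
  have h1 : ∀ r ∈ Ioc (a - δ) c, p + r • θ ∈ J.z (s - J.d _ t₁) := fun r hr => h (by
    rw [Metric.mem_ball, Real.dist_eq, abs_lt]
    constructor <;> linarith [hr.1, hr.2])
  obtain ⟨m, v, hm, hmv⟩ := hJ.extend _ (t₁ - t₃) _ (hRU c hcR) (by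
    have := mem_trans (mem_symm (h1 c ⟨by linarith, le_rfl⟩)) (ht₃ c ⟨le_rfl, hcR.2⟩)
    rwa [← map_sub] at this)
  refine ⟨δ, hδ, fun r hr hra hra' => ?_⟩
  rw [hG]
  have hrc : r ≤ c := hra'.trans hac
  refine ⟨⟨hr, hra'.trans ha.2⟩, ?_⟩
  have hcl : ∀ x y : ℝ, IsClosed ((fun r : ℝ => p + r • θ) '' Icc x y) := fun x y =>
    (isCompact_Icc.image hc).isClosed
  obtain ⟨t, hta, htb⟩ := glue_closed (t₁ - m - J.d _ v) t₃ (hcl r c) (hcl c R) (by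
    rw [← image_inter hγ.injective, Icc_inter_Icc_eq_singleton hrc hcR.2, image_singleton,
      singleton_subset_iff]
    convert hmv using 2
    abel)
  refine ⟨t, fun r' hr' => ?_, mem_of_mem_sub (htb ⟨R, ⟨hcR.2, le_rfl⟩, rfl⟩) ht₃R⟩
  rcases le_total r' c with h' | h'
  · refine mem_sub_d_of ?_ (hta ⟨r', ⟨hr'.1, h'⟩, rfl⟩)
    have := mem_add (h1 r' ⟨hra.trans_le hr'.1, h'⟩)
      (hm (ray_mem_segment (hr.trans hr'.1) h'))
    rw [map_sub, map_sub, J.d_d, sub_zero]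
    convert this using 2
    abel
  · exact mem_sub_d_of (ht₃ r' ⟨h', hr'.2⟩) (htb ⟨r', ⟨h', hr'.2⟩, rfl⟩)

lemma IsRadial.exact_ray (hJ : J.IsRadial U p) (hU : IsOpen U) (hpU : p ∈ U)
    (hsU : StarConvex ℝ p U) (hθ : ‖θ‖ = 1) {q} {s : J.M (q + 1 + 1)} (hcs : J.CS U s)
    (hs : ∀ r : ℝ, 0 ≤ r → p + r • θ ∈ J.z (J.d _ s)) :
    ∃ t, J.CS U t ∧ ∀ r : ℝ, 0 ≤ r → p + r • θ ∈ J.z (s - J.d _ t) := by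
  have hγ := isometry_ray (p := p) hθ
  have hc := hγ.continuous
  obtain ⟨K, hK, hKU, hKs⟩ := hcs
  obtain ⟨R, hR, hRU, hRK⟩ : ∃ R : ℝ, 0 ≤ R ∧ p + R • θ ∈ U ∧ ∀ r, R ≤ r → p + r • θ ∉ K := by
    have hT : IsCompact ({r : ℝ | 0 ≤ r} ∩ (fun r : ℝ => p + r • θ) ⁻¹' K) :=
      (hγ.isClosedEmbedding.isCompact_preimage hK).inter_left isClosed_Ici
    rcases ({r : ℝ | 0 ≤ r} ∩ (fun r : ℝ => p + r • θ) ⁻¹' K).eq_empty_or_nonempty with h | h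
    · refine ⟨0, le_rfl, by simpa using hpU, fun r hr hrK => ?_⟩
      exact eq_empty_iff_forall_notMem.1 h r ⟨hr, hrK⟩
    · obtain ⟨b, ⟨hb, hbK⟩, hbmax⟩ := hT.exists_isGreatest h
      obtain ⟨δ, hδ, h⟩ := Metric.mem_nhds_iff.1 ((hU.preimage hc).mem_nhds (hKU hbK))
      have hb : (0 : ℝ) ≤ b := hb
      refine ⟨b + δ / 2, by linarith, h ?_, fun r hr hrK => ?_⟩
      · rw [Metric.mem_ball, Real.dist_eq, abs_lt]
        constructor <;> linarith
      · have : r ≤ b := hbmax ⟨(by linarith : (0 : ℝ) ≤ r), hrK⟩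
        linarith
  have hRU' : ∀ r ∈ Icc 0 R, p + r • θ ∈ U := fun r hr =>
    hsU.segment_subset hRU (ray_mem_segment hr.1 hr.2)
  obtain ⟨G, hG⟩ : ∃ G, G = {r ∈ Icc 0 R | ∃ t, (∀ r' ∈ Icc r R, p + r' • θ ∈ J.z (s - J.d _ t)) ∧
      p + R • θ ∈ J.z t} := ⟨_, rfl⟩
  have hRG : R ∈ G := by
    rw [hG]
    refine ⟨⟨hR, le_rfl⟩, 0, fun r hr => ?_, J.mem_z_zero _⟩
    rw [map_zero, sub_zero]
    exact hKs (hRK r hr.1)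
  have hGb : BddBelow G := ⟨0, fun r hr => by rw [hG] at hr; exact hr.1.1⟩
  have hG0 : 0 ≤ sInf G := le_csInf ⟨R, hRG⟩ fun r hr => by rw [hG] at hr; exact hr.1.1
  obtain ⟨δ, hδ, h⟩ := hJ.exact_ray_step hθ hRU' (fun r hr => hs r hr.1) hG
    ⟨hG0, csInf_le hGb hRG⟩ (fun δ hδ => by
      obtain ⟨r, hr, hr'⟩ := exists_lt_of_csInf_lt ⟨R, hRG⟩ (lt_add_of_pos_right (sInf G) hδ)
      exact ⟨r, hr, csInf_le hGb hr, hr'⟩)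
  have h0 : sInf G = 0 := by
    by_contra hne
    have hpos : 0 < sInf G := lt_of_le_of_ne hG0 (Ne.symm hne)
    have hm := h (max 0 (sInf G - δ / 2)) (le_max_left _ _)
      (lt_max_of_lt_right (by linarith)) (max_le hG0 (by linarith))
    have := csInf_le hGb hm
    rcases max_choice 0 (sInf G - δ / 2) with h' | h' <;> rw [h'] at this <;> linarith
  have hmem := h 0 le_rfl (by linarith) h0.ge
  rw [hG] at hmem
  obtain ⟨-, t, ht, htR⟩ := hmem
  obtain ⟨t', h1, h2⟩ := glue_closed t 0 (C := (fun r : ℝ => p + r • θ) '' Icc 0 R)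
    (D := (fun r : ℝ => p + r • θ) '' Ici R) (isCompact_Icc.image hc).isClosed
    (hγ.isClosedEmbedding.isClosedMap _ isClosed_Ici) (by
      rintro _ ⟨⟨r, hr, rfl⟩, ⟨r', hr', h⟩⟩
      obtain rfl := hγ.injective h
      obtain rfl : r' = R := le_antisymm hr.2 hr'
      simpa using htR)
  obtain ⟨t'', hcs, h3⟩ := exists_cs_eq hU t' (C := (fun r : ℝ => p + r • θ) '' Ici 0)
    (K := (fun r : ℝ => p + r • θ) '' Icc 0 R) (hγ.isClosedEmbedding.isClosedMap _ isClosed_Ici)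
    (isCompact_Icc.image hc) (by rintro _ ⟨r, hr, rfl⟩; exact hRU' r hr) (by
      rintro _ ⟨⟨r, hr, rfl⟩, hr'⟩
      have hr : (0 : ℝ) ≤ r := hr
      rcases le_total r R with h | h
      · exact absurd ⟨r, ⟨hr, h⟩, rfl⟩ hr'
      · simpa using h2 ⟨r, h, rfl⟩)
  refine ⟨t'', hcs, fun r hr => mem_sub_d_of ?_ (h3 ⟨r, hr, rfl⟩)⟩
  rcases le_total r R with h | h
  · exact mem_sub_d_of (ht r ⟨hr, h⟩) (h1 ⟨r, ⟨hr, h⟩, rfl⟩)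
  · refine mem_sub (hKs (hRK r h)) (mem_d ?_)
    simpa using h2 ⟨r, h, rfl⟩

/-- The closed cone with apex `p` over a set of directions. -/
def coneOver (p : X) (A : Set X) : Set X := {x | x = p ∨ ‖x - p‖⁻¹ • (x - p) ∈ A}

lemma isClosed_coneOver (p : X) {A : Set X} (hA : IsClosed A) : IsClosed (coneOver p A) := by
  rw [← isOpen_compl_iff, isOpen_iff_mem_nhds]
  intro x hx
  simp only [coneOver, mem_compl_iff, mem_ofPred_eq, not_or] at hx
  have hc : ContinuousAt (fun x : X => ‖x - p‖⁻¹ • (x - p)) x := by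
    refine ContinuousAt.smul (ContinuousAt.inv₀ (by fun_prop) ?_) (by fun_prop)
    simpa [sub_eq_zero] using hx.1
  filter_upwards [isOpen_ne.mem_nhds hx.1, hc (hA.isOpen_compl.mem_nhds hx.2)] with y hy hy'
  simp only [coneOver, mem_compl_iff, mem_ofPred_eq, not_or]
  exact ⟨hy, hy'⟩

lemma coneOver_union (p : X) (A B : Set X) :
    coneOver p (A ∪ B) = coneOver p A ∪ coneOver p B := by
  ext x
  simp only [coneOver, mem_ofPred_eq, mem_union]
  tauto

lemma coneOver_homogeneous (p : X) (A : Set X) {x : X} (hx : x ∈ coneOver p A) {r : ℝ}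
    (hr : 0 ≤ r) : p + r • (x - p) ∈ coneOver p A := by
  rcases hx with rfl | hx
  · left; simp
  · rcases eq_or_lt_of_le hr with rfl | hr
    · left; simp
    · right
      rw [add_sub_cancel_left, norm_smul, Real.norm_of_nonneg hr.le, smul_smul, mul_inv,
        mul_right_comm, inv_mul_cancel₀ hr.ne', one_mul]
      exact hx

lemma IsRadial.exactNear_cone (hJ : J.IsRadial U p) (hU : IsOpen U) (hpU : p ∈ U)
    (hsU : StarConvex ℝ p U) (q : ℤ) (C : Set X) (hC : IsClosed C)
    (hC' : ∀ x ∈ C, ∀ r : ℝ, 0 ≤ r → p + r • (x - p) ∈ C) : J.ExactNear U C q := by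
  refine degree_induction (J := J) (P := fun q => ∀ C : Set X, IsClosed C →
    (∀ x ∈ C, ∀ r : ℝ, 0 ≤ r → p + r • (x - p) ∈ C) → J.ExactNear U C q)
    (fun q hq C _ _ => ExactNear.of_subsingleton hq) (fun q ih C hC hC' => ?_) q C hC hC'
  intro s hcs hs
  have hpoint : ∃ t, J.CS U t ∧ C ∩ {p} ⊆ J.z (s - J.d _ t) := by
    by_cases hpC : p ∈ C
    · obtain ⟨t, ht, h⟩ := exists_exact_point hU hpU (hs hpC) hJ.exactAt
      exact ⟨t, ht, fun x hx => by rw [hx.2]; exact h⟩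
    · exact ⟨0, CS.zero, fun x hx => absurd hx.1 (by rw [hx.2]; exact hpC)⟩
  have hcone : ∀ A : Set X, IsClosed (C ∩ coneOver p (closure A)) := fun A =>
    hC.inter (isClosed_coneOver p isClosed_closure)
  obtain ⟨t, ht, h⟩ : ∃ t, J.CS U t ∧
      C ∩ coneOver p (closure (Metric.sphere (0 : X) 1)) ⊆ J.z (s - J.d _ t) := by
    refine (isCompact_sphere (0 : X) 1).induction_on
      (p := fun A => ∃ t, J.CS U t ∧ C ∩ coneOver p (closure A) ⊆ J.z (s - J.d _ t)) ?_ ?_ ?_ ?_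
    · simpa [coneOver] using hpoint
    · rintro A B hAB ⟨t, ht, h⟩
      refine ⟨t, ht, fun x hx => h ⟨hx.1, ?_⟩⟩
      exact hx.2.imp_right fun hx => closure_mono hAB hx
    · intro A B hA hB
      rw [closure_union, coneOver_union, inter_union_distrib_left]
      refine exact_union hU (hcone A) (hcone B)
        (ih _ ((hcone A).inter (hcone B)) fun x hx r hr => ?_) hA hB
      exact ⟨⟨hC' x hx.1.1 r hr, coneOver_homogeneous _ _ hx.1.2 hr⟩,
        ⟨hC' x hx.2.1 r hr, coneOver_homogeneous _ _ hx.2.2 hr⟩⟩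
    · intro θ hθ
      have hθ : ‖θ‖ = 1 := by simpa using hθ
      obtain ⟨t, ht, h⟩ : ∃ t, J.CS U t ∧
          ∀ r : ℝ, 0 ≤ r → p + r • θ ∈ C → p + r • θ ∈ J.z (s - J.d _ t) := by
        by_cases hθC : p + θ ∈ C
        · obtain ⟨t, ht, h⟩ := hJ.exact_ray hU hpU hsU hθ hcs fun r hr => hs (by
            simpa using hC' _ hθC r hr)
          exact ⟨t, ht, fun r hr _ => h r hr⟩
        · obtain ⟨t, ht, h⟩ := hpoint
          refine ⟨t, ht, fun r hr hrC => h ⟨hrC, ?_⟩⟩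
          by_contra hne
          have hr0 : r ≠ 0 := by rintro rfl; simp at hne
          refine hθC ?_
          have := hC' _ hrC r⁻¹ (by positivity)
          rwa [add_sub_cancel_left, smul_smul, inv_mul_cancel₀ hr0, one_smul] at this
      obtain ⟨K, hK, -, hKs⟩ := hcs.sub ht.d
      obtain ⟨R, hR⟩ := hK.isBounded.subset_closedBall p
      have hO : IsOpen (J.z (s - J.d _ t) ∪ Cᶜ) := (J.isOpen_z _).union hC.isOpen_compl
      have hev : ∀ᶠ θ' in 𝓝 θ, ∀ r ∈ Icc (0 : ℝ) R, p + r • θ' ∈ J.z (s - J.d _ t) ∪ Cᶜ := by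
        refine isCompact_Icc.eventually_forall_of_forall_eventually fun r hr => ?_
        have hcont : Continuous fun x : X × ℝ => p + x.2 • x.1 := by fun_prop
        refine (hO.preimage hcont).mem_nhds ?_
        by_cases h' : p + r • θ ∈ C
        · exact Or.inl (h r hr.1 h')
        · exact Or.inr h'
      obtain ⟨A, hA, hAc, hAz⟩ := exists_mem_nhds_isClosed_subset hev
      refine ⟨A, mem_nhdsWithin_of_mem_nhds hA, t, ht, ?_⟩
      rw [hAc.closure_eq]
      rintro x ⟨hxC, hx⟩
      by_cases hxp : x = p
      · subst hxp
        simpa using h 0 le_rfl (by simpa using hxC)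
      have hx := hx.resolve_left hxp
      by_cases hxR : ‖x - p‖ ≤ R
      · have := hAz hx ‖x - p‖ ⟨norm_nonneg _, hxR⟩
        rw [smul_smul, mul_inv_cancel₀ (by simpa [sub_eq_zero] using hxp), one_smul,
          add_sub_cancel] at this
        exact this.resolve_right fun h => h hxC
      · refine hKs fun hxK => hxR ?_
        simpa [dist_eq_norm] using hR hxK
  refine ⟨t, ht, fun x hx => h ⟨hx, ?_⟩⟩
  rw [Metric.isClosed_sphere.closure_eq]
  by_cases hxp : x = p
  · exact Or.inl hxp
  · right
    simp [norm_smul, sub_eq_zero, hxp]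

lemma IsRadial.exists_eq_d (hJ : J.IsRadial U p) (hU : IsOpen U) (hpU : p ∈ U)
    (hsU : StarConvex ℝ p U) {q : ℤ} {s : J.M (q + 1)} (hcs : J.CS U s) (hs : J.d _ s = 0) :
    ∃ t, J.CS U t ∧ s = J.d q t := by
  obtain ⟨t, ht, h⟩ := hJ.exactNear_cone hU hpU hsU q univ isClosed_univ (fun _ _ _ _ => trivial)
    s hcs (by rw [hs, J.z_zero])
  exact ⟨t, ht, sub_eq_zero.1 (J.eq_zero _ (univ_subset_iff.1 h))⟩

end Radial


end FlabbyCx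

end Flabby

end Toric

end

noncomputable section

namespace Toric

/-! ### Mapping cones of flabby complexes -/

section FlabbyCone

open Set Topology

namespace FlabbyCx

variable {X : Type*} [TopologicalSpace X]

/-- A morphism of flabby complexes. -/
structure Hom (I J : FlabbyCx X) where
  f : ∀ q, I.M q →+ J.M q
  comm : ∀ q s, f (q + 1) (I.d q s) = J.d q (f q s)
  z_le : ∀ {q} (s : I.M q), I.z s ⊆ J.z (f q s)

/-- The mapping cone. -/
def cone {I J : FlabbyCx X} (f : Hom I J) : FlabbyCx X where
  M q := I.M (q + 1) × J.M q
  d q := AddMonoidHom.mk' (fun s => (-I.d _ s.1, f.f _ s.1 + J.d _ s.2)) (by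
    intro a b
    ext
    · simp [add_comm]
    · simp only [Prod.fst_add, Prod.snd_add, map_add]
      abel)
  d_d q s := by
    ext
    · simp [I.d_d]
    · simp [J.d_d, f.comm]
  z s := I.z s.1 ∩ J.z s.2
  isOpen_z s := (I.isOpen_z _).inter (J.isOpen_z _)
  z_zero := by simp [I.z_zero, J.z_zero]
  eq_zero s hs := by
    replace hs := univ_subset_iff.2 hs
    rw [subset_inter_iff, univ_subset_iff, univ_subset_iff] at hs
    exact Prod.ext (I.eq_zero _ hs.1) (J.eq_zero _ hs.2)
  z_neg s := inter_subset_inter (I.z_neg _) (J.z_neg _)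
  z_add s t := fun x hx => ⟨I.z_add _ _ ⟨hx.1.1, hx.2.1⟩, J.z_add _ _ ⟨hx.1.2, hx.2.2⟩⟩
  z_d s := fun x hx => ⟨mem_neg (mem_d hx.1), mem_add (f.z_le _ hx.1) (mem_d hx.2)⟩
  glue s t V W hV hW h := by
    obtain ⟨a, ha⟩ := I.glue s.1 t.1 V W hV hW fun x hx => (h hx).1
    obtain ⟨b, hb⟩ := J.glue s.2 t.2 V W hV hW fun x hx => (h hx).2
    exact ⟨(a, b), fun x hx => ⟨ha.1 hx, hb.1 hx⟩, fun x hx => ⟨ha.2 hx, hb.2 hx⟩⟩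
  bounded := by
    obtain ⟨n, hn⟩ := I.bounded
    obtain ⟨m, hm⟩ := J.bounded
    refine ⟨min (n - 1) m, fun q hq => ?_⟩
    have := hn (q + 1) (by have := min_le_left (n - 1) m; lia)
    have := hm q (hq.trans_le (min_le_right _ _))
    infer_instance

section Quasi

variable {I J : FlabbyCx X} {f : Hom I J} {U : Set X}

lemma cs_cone [T2Space X] {q : ℤ} {a : I.M (q + 1)} {b : J.M q} (ha : I.CS U a) (hb : J.CS U b) :
    (cone f).CS U (q := q) (a, b) := by
  obtain ⟨K, hK, hKU, h⟩ := ha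
  obtain ⟨L, hL, hLU, h'⟩ := hb
  exact ⟨K ∪ L, hK.union hL, union_subset hKU hLU, fun x hx =>
    ⟨h fun hx' => hx (.inl hx'), h' fun hx' => hx (.inr hx')⟩⟩

lemma CS.fst {q : ℤ} {s : (cone f).M q} (hs : (cone f).CS U s) : I.CS U s.1 := by
  obtain ⟨K, hK, hKU, h⟩ := hs
  exact ⟨K, hK, hKU, fun x hx => (h hx).1⟩

lemma CS.snd {q : ℤ} {s : (cone f).M q} (hs : (cone f).CS U s) : J.CS U s.2 := by
  obtain ⟨K, hK, hKU, h⟩ := hs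
  exact ⟨K, hK, hKU, fun x hx => (h hx).2⟩

variable (f U) in
/-- The mapping cone has no cohomology with compact supports in `U`. -/
def ConeAcyclic : Prop := ∀ (q : ℤ) (s : (cone f).M (q + 1)), (cone f).CS U s →
  (cone f).d _ s = 0 → ∃ t, (cone f).CS U t ∧ s = (cone f).d q t

lemma ConeAcyclic.injective [T2Space X] (h : ConeAcyclic f U) {q : ℤ} {a : I.M (q + 1)}
    (ha : I.CS U a) (hda : I.d _ a = 0) {b : J.M q} (hb : J.CS U b) (hab : f.f _ a = J.d _ b) :
    ∃ a' : I.M q, I.CS U a' ∧ a = I.d _ a' := by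
  obtain ⟨q, rfl⟩ : ∃ r, q = r + 1 := ⟨q - 1, by lia⟩
  obtain ⟨t, ht, h⟩ := h q (a, -b) (cs_cone ha hb.neg)
    (Prod.ext (neg_eq_zero.2 hda) (by
      change f.f _ a + J.d _ (-b) = 0
      rw [hab, map_neg, add_neg_cancel]))
  exact ⟨-t.1, ht.fst.neg, (congrArg Prod.fst h).trans (map_neg _ _).symm⟩

lemma ConeAcyclic.surjective [T2Space X] (h : ConeAcyclic f U) {q : ℤ} {b : J.M (q + 1)}
    (hb : J.CS U b) (hdb : J.d _ b = 0) :
    ∃ (a : I.M (q + 1)) (b' : J.M q), I.CS U a ∧ I.d _ a = 0 ∧ J.CS U b' ∧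
      b = f.f _ a + J.d _ b' := by
  obtain ⟨t, ht, h⟩ := h q (0, b) (cs_cone .zero hb) (Prod.ext
    (neg_eq_zero.2 (map_zero _)) (by
      change f.f _ 0 + J.d _ b = 0
      rw [hdb, map_zero, add_zero]))
  exact ⟨t.1, t.2, ht.fst, neg_eq_zero.1 (congrArg Prod.fst h).symm, ht.snd, congrArg Prod.snd h⟩

end Quasi

/-! ### Representing cohomology classes by locally constant sections -/

section Germ

variable (J : FlabbyCx X)

/-- The sections that vanish near `x`. -/
def vanishingAt (x : X) (q : ℤ) : AddSubgroup (J.M q) where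
  carrier := {s | x ∈ J.z s}
  zero_mem' := J.mem_z_zero x
  add_mem' := mem_add
  neg_mem' := mem_neg

/-- The germ of a section. -/
def germ (x : X) {q : ℤ} : J.M q →+ J.M q ⧸ J.vanishingAt x q := QuotientAddGroup.mk' _

variable {J} {x : X} {q : ℤ}

lemma germ_eq_zero {s : J.M q} : J.germ x s = 0 ↔ x ∈ J.z s :=
  QuotientAddGroup.eq_zero_iff s

lemma Hom.germ_congr {I : FlabbyCx X} (f : Hom I J) {s t : I.M q} (h : I.germ x s = I.germ x t) :
    J.germ x (f.f q s) = J.germ x (f.f q t) := by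
  rw [← sub_eq_zero, ← map_sub, germ_eq_zero] at h ⊢
  rw [← map_sub]
  exact f.z_le _ h

lemma germ_eq_iff {s t : J.M q} : J.germ x s = J.germ x t ↔ x ∈ J.z (s - t) := by
  rw [← sub_eq_zero, ← map_sub, germ_eq_zero]

end Germ

/-- A flabby complex whose stalk at `x` has the cohomology of the complex `A · x` of subgroups of
the complex `(W, D)`, the elements of `A q x` being germs of sections that do not depend on `x`. -/
structure Rep (J : FlabbyCx X) {W : ℤ → Type*} [∀ q, AddCommGroup (W q)]
    (D : ∀ q, W q →+ W (q + 1)) (A : ∀ q, X → AddSubgroup (W q)) where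
  ρ : ∀ q, W q → J.M q
  D_mem : ∀ {q x β}, β ∈ A q x → D q β ∈ A (q + 1) x
  D_D : ∀ {q} β, D (q + 1) (D q β) = 0
  add : ∀ {q x β γ}, β ∈ A q x → γ ∈ A q x →
    J.germ x (ρ q (β + γ)) = J.germ x (ρ q β) + J.germ x (ρ q γ)
  d : ∀ {q x β}, β ∈ A q x → J.germ x (J.d q (ρ q β)) = J.germ x (ρ (q + 1) (D q β))
  surj : ∀ {q x} {s : J.M (q + 1)}, J.germ x (J.d _ s) = 0 → ∃ β ∈ A (q + 1) x, D _ β = 0 ∧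
    ∃ t : J.M q, J.germ x s = J.germ x (ρ _ β) + J.germ x (J.d q t)
  inj : ∀ {q x} {β} {t : J.M q}, β ∈ A (q + 1) x → D _ β = 0 →
    J.germ x (ρ _ β) = J.germ x (J.d q t) → ∃ γ ∈ A q x, D q γ = β

namespace Rep

variable {J : FlabbyCx X} {W : ℤ → Type*} [∀ q, AddCommGroup (W q)]
  {D : ∀ q, W q →+ W (q + 1)} {A : ∀ q, X → AddSubgroup (W q)} (R : J.Rep D A)
  {q : ℤ} {x : X} {β γ : W q}

include R

lemma zero : J.germ x (R.ρ q 0) = 0 := by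
  have := R.add (zero_mem (A q x)) (zero_mem (A q x))
  rwa [add_zero, left_eq_add] at this

lemma neg (h : β ∈ A q x) : J.germ x (R.ρ q (-β)) = - J.germ x (R.ρ q β) := by
  have := R.add h (neg_mem h)
  rw [add_neg_cancel, R.zero] at this
  exact (neg_eq_of_add_eq_zero_right this.symm).symm

lemma sub (h : β ∈ A q x) (h' : γ ∈ A q x) :
    J.germ x (R.ρ q (β - γ)) = J.germ x (R.ρ q β) - J.germ x (R.ρ q γ) := by
  rw [sub_eq_add_neg, R.add h (neg_mem h'), R.neg h', sub_eq_add_neg]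

end Rep

section RepCone

variable {I J : FlabbyCx X} {f : Hom I J}

lemma germ_cone {x : X} {q : ℤ} {s t : (cone f).M q} :
    x ∈ (cone f).z (s - t) ↔ I.germ x s.1 = I.germ x t.1 ∧ J.germ x s.2 = J.germ x t.2 := by
  rw [germ_eq_iff, germ_eq_iff]
  rfl

lemma germ_cone_d {x : X} {q : ℤ} {a : I.M (q + 1)} {b : J.M q} :
    x ∈ (cone f).z ((cone f).d q (a, b)) ↔ I.germ x (I.d _ a) = 0 ∧
      J.germ x (f.f _ a) + J.germ x (J.d _ b) = 0 := by
  rw [← map_add, germ_eq_zero, germ_eq_zero]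
  change x ∈ I.z (-I.d _ a) ∧ _ ↔ _
  exact and_congr_left fun _ => ⟨fun h => by simpa using mem_neg h, mem_neg⟩

/-- If the map of representing complexes is a quasi-isomorphism at `x`, the mapping cone is exact
there. -/
lemma exactAt_cone {W W' : ℤ → Type*} [∀ q, AddCommGroup (W q)] [∀ q, AddCommGroup (W' q)]
    {D : ∀ q, W q →+ W (q + 1)} {A : ∀ q, X → AddSubgroup (W q)}
    {D' : ∀ q, W' q →+ W' (q + 1)} {A' : ∀ q, X → AddSubgroup (W' q)}
    (RI : I.Rep D A) (RJ : J.Rep D' A') (φ : ∀ q, W q →+ W' q) {x : X}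
    (hφ : ∀ q, ∀ β ∈ A q x, φ q β ∈ A' q x)
    (hf : ∀ q, ∀ β ∈ A q x, J.germ x (f.f q (RI.ρ q β)) = J.germ x (RJ.ρ q (φ q β)))
    (hinj : ∀ q, ∀ β ∈ A (q + 1) x, D _ β = 0 → ∀ γ ∈ A' q x, φ _ β = D' _ γ →
      ∃ δ ∈ A q x, β = D _ δ)
    (hsurj : ∀ q, ∀ β ∈ A' (q + 1) x, D' _ β = 0 → ∃ δ ∈ A (q + 1) x, D _ δ = 0 ∧
      ∃ γ ∈ A' q x, β = φ _ δ + D' _ γ)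
    (hφD : ∀ q, ∀ β ∈ A q x, φ _ (D q β) = D' q (φ q β)) :
    (cone f).ExactAt x := by
  rintro q ⟨a, b⟩ hab
  rw [germ_cone_d] at hab
  obtain ⟨ha, hb⟩ := hab
  obtain ⟨α, hα, hDα, s, hs⟩ := RI.surj ha
  have hfa : J.germ x (f.f _ a) = J.germ x (RJ.ρ _ (φ _ α)) + J.germ x (J.d _ (f.f _ s)) := by
    rw [← hf _ _ hα, ← f.comm, ← map_add, ← map_add]
    exact f.germ_congr (by rw [map_add, hs])
  obtain ⟨γ, hγ, hγα⟩ := RJ.inj (t := -b - f.f _ s) (hφ _ _ hα)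
    (by rw [← hφD _ _ hα, hDα, map_zero]) (by
      rw [map_sub, map_sub, map_neg, map_neg, ← eq_neg_of_add_eq_zero_left hb, hfa]
      abel)
  obtain ⟨δ, hδ, rfl⟩ := hinj _ α hα hDα γ hγ hγα.symm
  have hs' : I.germ x a = I.germ x (I.d _ (RI.ρ _ δ + s)) := by
    rw [hs, map_add, map_add, RI.d hδ]
  have hb' : J.germ x (J.d _ (b + f.f _ (RI.ρ _ δ + s))) = 0 := by
    have e := f.germ_congr hs'
    rw [f.comm] at e
    rw [← hb, map_add, map_add, e]
    exact add_comm _ _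
  obtain ⟨β, hβ, hDβ, u, hu⟩ := RJ.surj hb'
  obtain ⟨ε, hε, hDε, ζ, hζ, rfl⟩ := hsurj _ β hβ hDβ
  refine ⟨(RI.ρ _ ε - (RI.ρ _ δ + s), RJ.ρ _ ζ + u), germ_cone.2 ⟨?_, ?_⟩⟩
  · change I.germ x a = I.germ x (-I.d _ (RI.ρ _ ε - _))
    rw [map_neg, map_sub, map_sub, ← hs', RI.d hε, hDε, RI.zero]
    simp
  · change J.germ x b = J.germ x (f.f _ (RI.ρ _ ε - _) + J.d _ (RJ.ρ _ ζ + u))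
    rw [map_add, RJ.add (hφ _ _ hε) (RJ.D_mem hζ), ← hf _ _ hε, ← RJ.d hζ] at hu
    rw [eq_sub_of_add_eq hu, map_sub (f.f _), map_add (J.d _), map_add (J.germ x), map_sub (J.germ x),
      map_add (J.germ x)]
    abel

variable {W : ℤ → Type*} [∀ q, AddCommGroup (W q)] {D : ∀ q, W q →+ W (q + 1)}
  {A A' : ∀ q, X → AddSubgroup (W q)} (RI : I.Rep D A) (RJ : J.Rep D A')

/-- The element of the cone represented by `β`. -/
def coneRep (f : Hom I J) (RI : I.Rep D A) (RJ : J.Rep D A') {q : ℤ} (β : W q) : (cone f).M q :=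
  (RI.ρ _ (-D _ β), RJ.ρ _ β)

variable {x : X} {RI RJ}

lemma coneRep_sub_mem {q : ℤ} {β γ : W q} (hβ : β ∈ A' q x) (hγ : γ ∈ A' q x)
    (hD : D q β ∈ A (q + 1) x) (hD' : D q γ ∈ A (q + 1) x) :
    x ∈ (cone f).z (coneRep f RI RJ (β - γ) - (coneRep f RI RJ β - coneRep f RI RJ γ)) := by
  refine germ_cone.2 ⟨?_, ?_⟩
  · change I.germ x (RI.ρ _ _) = I.germ x (RI.ρ _ _ - RI.ρ _ _)
    rw [map_sub, map_sub, neg_sub, ← neg_sub_neg, RI.sub (neg_mem hD) (neg_mem hD')]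
  · change J.germ x (RJ.ρ _ _) = J.germ x (RJ.ρ _ _ - RJ.ρ _ _)
    rw [map_sub, RJ.sub hβ hγ]

variable (hf : ∀ q x, ∀ β ∈ A q x, J.germ x (f.f q (RI.ρ q β)) = J.germ x (RJ.ρ q β))

include hf

lemma exact_coneRep {q : ℤ} {β : W (q + 1)} (hβ : β ∈ A (q + 1) x) :
    ∃ t, x ∈ (cone f).z (coneRep f RI RJ β - (cone f).d q t) := by
  refine ⟨(RI.ρ _ β, 0), germ_cone.2 ⟨?_, ?_⟩⟩
  · change I.germ x (RI.ρ _ _) = I.germ x (-I.d _ _)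
    rw [map_neg, RI.d hβ, RI.neg (RI.D_mem hβ)]
  · change J.germ x (RJ.ρ _ _) = J.germ x (f.f _ _ + J.d _ 0)
    rw [map_zero, add_zero, hf _ _ _ hβ]

variable (hA : ∀ q x, A q x ≤ A' q x)

include hA

lemma mem_z_d_coneRep {q : ℤ} {β : W q} (hβ : β ∈ A' q x) (hD : D q β ∈ A (q + 1) x) :
    x ∈ (cone f).z ((cone f).d _ (coneRep f RI RJ β)) := by
  refine germ_cone_d.2 ⟨?_, ?_⟩
  · rw [RI.d (neg_mem hD), map_neg, RI.D_D, neg_zero, RI.zero]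
  · rw [hf _ _ _ (neg_mem hD), RJ.neg (hA _ _ hD), RJ.d hβ, neg_add_cancel]

lemma mem_of_exact_coneRep (hc : ∀ q, ∀ β ∈ A' q x, D q β ∈ A (q + 1) x) {q : ℤ} {β : W (q + 1)}
    (hβ : β ∈ A' (q + 1) x) {t} (ht : x ∈ (cone f).z (coneRep f RI RJ β - (cone f).d q t)) :
    β ∈ A (q + 1) x := by
  obtain ⟨h1, h2⟩ := germ_cone.1 ht
  obtain ⟨a, b⟩ := t
  replace h1 : I.germ x (RI.ρ _ (-D _ β)) = I.germ x (-I.d _ a) := h1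
  replace h2 : J.germ x (RJ.ρ _ β) = J.germ x (f.f _ a + J.d _ b) := h2
  obtain ⟨α, hα, hαβ⟩ := RI.inj (t := -a) (neg_mem (hc _ _ hβ)) (by rw [map_neg, RI.D_D, neg_zero])
    (by rw [h1, map_neg (I.d _)])
  have h3 : I.germ x (I.d _ (a + RI.ρ _ α)) = 0 := by
    rw [map_add, map_add, RI.d hα, hαβ, h1]
    simp
  obtain ⟨α', hα', hDα', s, hs⟩ := RI.surj h3
  have h4 : J.germ x (f.f _ a) = J.germ x (RJ.ρ _ (α' - α)) + J.germ x (J.d _ (f.f _ s)) := by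
    rw [RJ.sub (hA _ _ hα') (hA _ _ hα), ← hf _ _ _ hα, ← hf _ _ _ hα', ← f.comm, ← map_sub,
      ← map_add, ← map_sub, ← map_add]
    refine f.germ_congr ?_
    rw [map_add, map_sub]
    rw [map_add] at hs
    rw [eq_sub_of_add_eq hs]
    abel
  obtain ⟨γ, hγ, hγβ⟩ := RJ.inj (t := f.f _ s + b) (β := β - (α' - α))
    (sub_mem hβ (sub_mem (hA _ _ hα') (hA _ _ hα))) (by
      rw [map_sub, map_sub, hDα', hαβ]
      simp) (by
      rw [RJ.sub hβ (sub_mem (hA _ _ hα') (hA _ _ hα)), h2, map_add, h4, map_add, map_add]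
      abel)
  rw [eq_add_of_sub_eq hγβ.symm]
  exact add_mem (hc _ _ hγ) (sub_mem hα' hα)

lemma exists_coneRep {q : ℤ} {s : (cone f).M (q + 1)}
    (hs : x ∈ (cone f).z ((cone f).d _ s)) :
    ∃ β ∈ A' (q + 1) x, ∃ t, x ∈ (cone f).z (s - coneRep f RI RJ β - (cone f).d q t) := by
  obtain ⟨ha, hb⟩ := (germ_cone_d (a := s.1) (b := s.2)).1 hs
  set a := s.1 with ha_def
  set b := s.2 with hb_def
  obtain ⟨α, hα, hDα, r, hr⟩ := RI.surj ha
  have hfa : J.germ x (f.f _ a) = J.germ x (RJ.ρ _ α) + J.germ x (J.d _ (f.f _ r)) := by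
    rw [← hf _ _ _ hα, ← f.comm, ← map_add, ← map_add]
    exact f.germ_congr (by rw [map_add, hr])
  obtain ⟨γ, hγ, rfl⟩ := RJ.inj (t := -b - f.f _ r) (hA _ _ hα) hDα (by
    rw [map_sub, map_sub, map_neg, map_neg, ← eq_neg_of_add_eq_zero_left hb, hfa]
    abel)
  have hb' : J.germ x (J.d _ (b + f.f _ r + RJ.ρ _ γ)) = 0 := by
    rw [← hb, map_add, map_add, map_add, map_add, RJ.d hγ, hfa]
    abel
  obtain ⟨β, hβ, hDβ, u, hu⟩ := RJ.surj hb'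
  refine ⟨β - γ, sub_mem hβ hγ, (-r, u), ?_⟩
  rw [sub_sub]
  refine germ_cone.2 ⟨?_, ?_⟩
  · change I.germ x a = I.germ x (RI.ρ _ _ + -I.d _ (-r))
    rw [map_sub, hDβ, zero_sub, neg_neg, hr, map_neg, neg_neg, map_add]
  · change J.germ x b = J.germ x (RJ.ρ _ _ + (f.f _ (-r) + J.d _ u))
    rw [map_add, RJ.sub hβ hγ, map_neg, map_add, map_neg]
    rw [map_add, map_add] at hu
    have : J.germ x b = (J.germ x b + J.germ x (f.f _ r) + J.germ x (RJ.ρ _ γ)) -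
        J.germ x (f.f _ r) - J.germ x (RJ.ρ _ γ) := by abel
    rw [this, hu]
    abel

end RepCone

section Radial

variable {X : Type*} [NormedAddCommGroup X] [NormedSpace ℝ X]
  {I J : FlabbyCx X} {f : Hom I J} {W : ℤ → Type*} [∀ q, AddCommGroup (W q)]
  {D : ∀ q, W q →+ W (q + 1)} {A A' : ∀ q, X → AddSubgroup (W q)} {RI : I.Rep D A}
  {RJ : J.Rep D A'}

lemma isRadial_cone (hA : ∀ q x, A q x ≤ A' q x)
    (hf : ∀ q x, ∀ β ∈ A q x, J.germ x (f.f q (RI.ρ q β)) = J.germ x (RJ.ρ q β))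
    {U : Set X} {p : X} (hU : StarConvex ℝ p U)
    (hopen : ∀ q x, ∀ β ∈ A' q x, ∀ᶠ y in 𝓝 x, β ∈ A' q y)
    (hc : ∀ q, ∀ x ∈ U, ∀ β ∈ A' q x, D q β ∈ A (q + 1) x)
    (hext : ∀ q, ∀ y ∈ U, ∀ β ∈ A' q y, ∃ γ, β - γ ∈ A q y ∧ ∀ v ∈ segment ℝ p y, γ ∈ A' q v)
    (hdec : ∀ q, ∀ y ∈ U, ∀ x ∈ segment ℝ p y, ∀ β ∈ A' q x, β ∈ A q y → β ∈ A q x)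
    (he : ∀ q, A' q p ≤ A q p) : (cone f).IsRadial U p where
  extend q m y hy hm := by
    obtain ⟨β, hβ, t, ht⟩ := exists_coneRep (RI := RI) (RJ := RJ) hf hA hm
    obtain ⟨γ, hγ, hγ'⟩ := hext _ y hy β hβ
    have hγy := hγ' y (right_mem_segment _ _ _)
    obtain ⟨u, hu⟩ := exact_coneRep (f := f) (RI := RI) (RJ := RJ) hf hγ
    refine ⟨coneRep f RI RJ γ, t + u, fun v hv => ?_, ?_⟩
    · exact mem_z_d_coneRep hf hA (hγ' v hv) (hc _ _ (hU.segment_subset hy hv) _ (hγ' v hv))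
    · have := mem_sub (mem_add ht hu) (coneRep_sub_mem (f := f) (RI := RI) (RJ := RJ) hβ hγy
        (hc _ _ hy _ hβ) (hc _ _ hy _ hγy))
      convert this using 1
      rw [map_add]
      abel_nf
  exact_of_near q m x hx hm := by
    obtain ⟨β, hβ, t, ht⟩ := exists_coneRep (RI := RI) (RJ := RJ) hf hA hm
    filter_upwards [((cone f).isOpen_z _).mem_nhds ht, hopen _ _ _ hβ] with y hy hβy hyU hxy ⟨u, hu⟩
    have hβ' : β ∈ A (q + 1) y := by
      refine mem_of_exact_coneRep (f := f) (RI := RI) (RJ := RJ) hf hA (fun q => hc q y hyU) hβy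
        (t := u - t) ?_
      convert mem_sub hu hy using 1
      rw [map_sub]
      abel_nf
    obtain ⟨v, hv⟩ := exact_coneRep (f := f) (RI := RI) (RJ := RJ) hf
      (hdec _ y hyU x hxy β hβ hβ')
    refine ⟨t + v, ?_⟩
    convert mem_add ht hv using 1
    rw [map_add]
    abel_nf
  exactAt q s hs := by
    obtain ⟨β, hβ, t, ht⟩ := exists_coneRep (RI := RI) (RJ := RJ) hf hA hs
    obtain ⟨v, hv⟩ := exact_coneRep (f := f) (RI := RI) (RJ := RJ) hf (he _ hβ)
    refine ⟨t + v, ?_⟩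
    convert mem_add ht hv using 1
    rw [map_add]
    abel_nf

end Radial

end FlabbyCx

end FlabbyCone

end Toric

end

noncomputable section

namespace Toric

/-! ### Flasque sheaves -/

section Flasque

open Opposite

variable {k : Type u} [CommRing k] {X : TopCat.{u}}

/-- Sections of `F` over open sets extend to `X`. -/
def IsFlasque (F : Sh k X) : Prop := ∀ (U : Opens X) (s : F.presheaf.obj (op U)),
  ∃ t : F.presheaf.obj (op ⊤), F.presheaf.map (homOfLE le_top).op t = s

variable (k) in
/-- The free presheaf of `k`-modules generated by an open set. -/
def freePresheaf : Opens X ⥤ (Opens X)ᵒᵖ ⥤ ModuleCat.{u} k :=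
  yoneda ⋙ (Functor.whiskeringRight _ _ _).obj (ModuleCat.free k)

variable (k) in
/-- The sheaf of `k`-modules freely generated by an open set. -/
def freeSheaf : Opens X ⥤ CategoryTheory.Sheaf (Opens.grothendieckTopology X) (ModuleCat.{u} k) :=
  freePresheaf k ⋙ presheafToSheaf (Opens.grothendieckTopology X) (ModuleCat.{u} k)

/-- Morphisms from the free presheaf are sections. -/
def freePresheafEquiv (U : Opens X) (F : (Opens X)ᵒᵖ ⥤ ModuleCat.{u} k) :
    ((freePresheaf k).obj U ⟶ F) ≃ F.obj (op U) :=
  (((ModuleCat.adj k).whiskerRight _).homEquiv (yoneda.obj U) F).trans yonedaEquiv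

lemma freePresheafEquiv_naturality {U V : Opens X} (h : V ⟶ U) (F : (Opens X)ᵒᵖ ⥤ ModuleCat.{u} k)
    (f : (freePresheaf k).obj U ⟶ F) :
    freePresheafEquiv V F ((freePresheaf k).map h ≫ f) = F.map h.op (freePresheafEquiv U F f) := by
  refine (congrArg yonedaEquiv (Adjunction.homEquiv_naturality_left
    ((ModuleCat.adj k).whiskerRight _) (yoneda.map h) f)).trans ?_
  exact (yonedaEquiv_naturality _ h).symm

instance {U V : Opens X} (h : V ⟶ U) : Mono ((freePresheaf k).map h) := by
  have (W : (Opens X)ᵒᵖ) : Mono (((freePresheaf k).map h).app W) := by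
    rw [ModuleCat.mono_iff_injective]
    exact Finsupp.mapDomain_injective (fun a b _ => Subsingleton.elim (α := (W.unop ⟶ V)) a b)
  exact NatTrans.mono_of_mono_app _

instance {U V : Opens X} (h : V ⟶ U) : Mono ((freeSheaf k).map h) :=
  (presheafToSheaf (Opens.grothendieckTopology X) (ModuleCat.{u} k)).map_mono _

lemma isFlasque_of_injective' (F : CategoryTheory.Sheaf (Opens.grothendieckTopology X)
    (ModuleCat.{u} k)) [Injective F] {U V : Opens X} (h : V ⟶ U) (s : F.obj.obj (op V)) :
    ∃ t : F.obj.obj (op U), F.obj.map h.op t = s := by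
  let adj := sheafificationAdjunction (Opens.grothendieckTopology X) (ModuleCat.{u} k)
  obtain ⟨f, rfl⟩ := (freePresheafEquiv V F.obj).surjective s
  obtain ⟨f, rfl⟩ := (adj.homEquiv _ F).surjective f
  change (freeSheaf k).obj V ⟶ F at f
  let g : (freeSheaf k).obj U ⟶ F := Injective.factorThru f ((freeSheaf k).map h)
  have hg : (freeSheaf k).map h ≫ g = f := Injective.comp_factorThru _ _
  refine ⟨freePresheafEquiv U F.obj (adj.homEquiv _ F g), ?_⟩
  rw [← freePresheafEquiv_naturality]
  refine congrArg _ ?_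
  rw [← hg]
  exact (adj.homEquiv_naturality_left ((freePresheaf k).map h) g).symm

lemma isFlasque_of_injective (F : Sh k X) (hF : Injective F) : IsFlasque F := fun _ s =>
  have : Injective (C := CategoryTheory.Sheaf (Opens.grothendieckTopology X) (ModuleCat.{u} k)) F :=
    hF
  isFlasque_of_injective' F (homOfLE le_top) s

/-! ### The flabby complex of a complex of flasque sheaves -/

variable {F G : Sh k X}

/-- The germ of a global section. -/
abbrev gGerm (F : Sh k X) (x : X) : F.presheaf.obj (op ⊤) ⟶ F.presheaf.stalk x :=
  F.presheaf.germ ⊤ x trivial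

/-- The action of a morphism on stalks. -/
abbrev stalkMap (f : F ⟶ G) (x : X) : F.presheaf.stalk x ⟶ G.presheaf.stalk x :=
  (TopCat.Presheaf.stalkFunctor _ x).map f.hom

lemma stalkMap_germ (f : F ⟶ G) (x : X) {U : Opens X} (hx : x ∈ U) (s : F.presheaf.obj (op U)) :
    stalkMap f x (F.presheaf.germ U x hx s) = G.presheaf.germ U x hx (f.hom.app _ s) :=
  TopCat.Presheaf.stalkFunctor_map_germ_apply U x hx f.hom s

lemma isOpen_germ_eq_zero (s : F.presheaf.obj (op ⊤)) : IsOpen {x | gGerm F x s = 0} := by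
  rw [isOpen_iff_forall_mem_open]
  intro x hx
  obtain ⟨V, hxV, i, j, h⟩ := F.presheaf.germ_eq (U := ⊤) (V := ⊤) x trivial trivial s 0
    ((hx : gGerm F x s = 0).trans (map_zero _).symm)
  refine ⟨V, fun y hy => ?_, V.isOpen, hxV⟩
  have := congrArg (F.presheaf.germ V y hy) h
  rw [TopCat.Presheaf.germ_res_apply, TopCat.Presheaf.germ_res_apply, map_zero] at this
  exact this

lemma exists_glue (hF : IsFlasque F) (s t : F.presheaf.obj (op ⊤)) (V W : Opens X)
    (h : ∀ x ∈ V, x ∈ W → gGerm F x (s - t) = 0) :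
    ∃ r, (∀ x ∈ V, gGerm F x (r - s) = 0) ∧ ∀ x ∈ W, gGerm F x (r - t) = 0 := by
  let U : Bool → Opens X := fun b => cond b V W
  let sf : ∀ b, F.presheaf.obj (op (U b)) := fun b =>
    F.presheaf.map (homOfLE le_top).op (cond b s t)
  have h0 : ∀ a b, F.presheaf.map ((homOfLE le_top : U a ⊓ U b ⟶ ⊤)).op (cond a s t) =
      F.presheaf.map ((homOfLE le_top : U a ⊓ U b ⟶ ⊤)).op (cond b s t) := by
    intro a b
    refine TopCat.Presheaf.section_ext F _ _ _ fun x hx => ?_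
    rw [TopCat.Presheaf.germ_res_apply, TopCat.Presheaf.germ_res_apply, ← sub_eq_zero, ← map_sub]
    cases a <;> cases b
    · simp
    · have := h x hx.2 hx.1
      rw [← neg_sub, map_neg, neg_eq_zero]
      exact this
    · exact h x hx.1 hx.2
    · simp
  have hsf : TopCat.Presheaf.IsCompatible F.presheaf U sf := by
    intro a b
    refine Eq.trans ?_ ((h0 a b).trans ?_)
    · exact (ConcreteCategory.congr_hom (F.presheaf.map_comp (homOfLE le_top : U a ⟶ ⊤).op
        (Opens.infLELeft (U a) (U b)).op) (cond a s t)).symm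
    · exact (ConcreteCategory.congr_hom (F.presheaf.map_comp (homOfLE le_top : U b ⟶ ⊤).op
        (Opens.infLERight (U a) (U b)).op) (cond b s t))
  obtain ⟨r, hr, -⟩ := F.existsUnique_gluing U sf hsf
  obtain ⟨r, rfl⟩ := hF _ r
  have key : ∀ b x, x ∈ U b → gGerm F x (r - cond b s t) = 0 := by
    intro b x hx
    have := congrArg (F.presheaf.germ (U b) x hx) (hr b)
    rw [TopCat.Presheaf.germ_res_apply, TopCat.Presheaf.germ_res_apply] at this
    refine (map_sub _ _ _).trans (sub_eq_zero.2 (Eq.trans this ?_))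
    exact TopCat.Presheaf.germ_res_apply F.presheaf _ x _ _
  exact ⟨r, fun x hx => key true x hx, fun x hx => key false x hx⟩

/-- A complex of flasque sheaves that is bounded below. -/
structure IsFlasqueCx (K : CochainComplex (Sh k X) ℤ) : Prop where
  flasque : ∀ q, IsFlasque (K.X q)
  bounded : CochainComplex.plus _ K

lemma subsingleton_of_isZero (hF : Limits.IsZero F) (U) : Subsingleton (F.presheaf.obj U) := by
  have h : 𝟙 F = 0 := hF.eq_of_src _ _
  refine subsingleton_of_forall_eq 0 fun s => ?_
  exact congrArg (fun f : F ⟶ F => f.hom.app U s) h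

/-- The flabby complex of global sections. -/
def IsFlasqueCx.cx {K : CochainComplex (Sh k X) ℤ} (hK : IsFlasqueCx K) : FlabbyCx X where
  M q := (K.X q).presheaf.obj (op ⊤)
  d q := ((K.d q (q + 1)).hom.app (op ⊤)).hom.toAddMonoidHom
  d_d q s := congrArg (fun f : K.X q ⟶ K.X (q + 1 + 1) => f.hom.app (op ⊤) s)
    (K.d_comp_d q (q + 1) (q + 1 + 1))
  z {q} s := {x | gGerm (K.X q) x s = 0}
  isOpen_z s := isOpen_germ_eq_zero s
  z_zero := Set.eq_univ_of_forall fun x => map_zero _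
  eq_zero {q} s hs := TopCat.Presheaf.section_ext (K.X q) _ _ _ fun x _ =>
    (Set.eq_univ_iff_forall.1 hs x).trans (map_zero _).symm
  z_neg {q} s x hx := (map_neg (gGerm (K.X q) x).hom s).trans (neg_eq_zero.2 hx)
  z_add {q} s t x hx := (map_add (gGerm (K.X q) x).hom s t).trans
    ((congrArg₂ (· + ·) hx.1 hx.2).trans (add_zero _))
  z_d {q} s x hx := (stalkMap_germ (K.d q (q + 1)) x (U := ⊤) trivial s).symm.trans
    ((congrArg (stalkMap (K.d q (q + 1)) x) hx).trans (map_zero _))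
  glue {q} s t V W hV hW h := by
    obtain ⟨r, h1, h2⟩ := exists_glue (hK.flasque q) s t ⟨V, hV⟩ ⟨W, hW⟩
      fun x hx hx' => h ⟨hx, hx'⟩
    exact ⟨r, h1, h2⟩
  bounded := by
    obtain ⟨n, hn⟩ := hK.bounded
    exact ⟨n, fun q hq => subsingleton_of_isZero (K.isZero_of_isStrictlyGE n q hq) _⟩

/-- The morphism of flabby complexes induced by a morphism of complexes of sheaves. -/
def flabbyHom {K L : CochainComplex (Sh k X) ℤ} (hK : IsFlasqueCx K) (hL : IsFlasqueCx L)
    (f : K ⟶ L) : FlabbyCx.Hom hK.cx hL.cx where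
  f q := ((f.f q).hom.app (op ⊤)).hom.toAddMonoidHom
  comm q s := congrArg (fun f : K.X q ⟶ L.X (q + 1) => f.hom.app (op ⊤) s)
    (f.comm q (q + 1)).symm
  z_le {q} s x hx := (stalkMap_germ (f.f q) x (U := ⊤) trivial s).symm.trans
    ((congrArg (stalkMap (f.f q) x) hx).trans (map_zero _))

lemma IsFlasqueCx.germ_eq_iff {K : CochainComplex (Sh k X) ℤ} (hK : IsFlasqueCx K) {q : ℤ} {x : X}
    {s t : (K.X q).presheaf.obj (op ⊤)} :
    hK.cx.germ x (q := q) s = hK.cx.germ x (q := q) t ↔ gGerm (K.X q) x s = gGerm (K.X q) x t := by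
  refine (FlabbyCx.germ_eq_iff (J := hK.cx)).trans (Iff.trans ?_ sub_eq_zero)
  rw [← map_sub]
  rfl

lemma IsFlasqueCx.exists_germ {K : CochainComplex (Sh k X) ℤ} (hK : IsFlasqueCx K) {q : ℤ} {x : X}
    (s : (K.X q).presheaf.stalk x) : ∃ t, gGerm (K.X q) x t = s := by
  obtain ⟨U, hx, s, rfl⟩ := (K.X q).presheaf.exists_germ_eq s
  obtain ⟨t, rfl⟩ := hK.flasque q U s
  exact ⟨t, (TopCat.Presheaf.germ_res_apply (K.X q).presheaf _ x hx t).symm⟩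

end Flasque

end Toric

end

noncomputable section

namespace Toric

/-! ### Quasi-isomorphisms of complexes of modules -/

section ModuleHomology

variable {k : Type u} [CommRing k]

/-- The homology class of a cycle. -/
def homologyClass (S : ShortComplex (ModuleCat.{u} k)) (x : S.X₂) (hx : S.g x = 0) : S.homology :=
  S.homologyπ (S.moduleCatCyclesIso.inv ⟨x, hx⟩)

lemma iCycles_moduleCatCyclesIso_inv (S : ShortComplex (ModuleCat.{u} k)) (x : S.X₂)
    (hx : S.g x = 0) : S.iCycles (S.moduleCatCyclesIso.inv ⟨x, hx⟩) = x :=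
  ConcreteCategory.congr_hom S.moduleCatCyclesIso_inv_iCycles (⟨x, hx⟩ : LinearMap.ker S.g.hom)

lemma exists_homologyClass (S : ShortComplex (ModuleCat.{u} k)) (c : S.homology) :
    ∃ x hx, c = homologyClass S x hx := by
  obtain ⟨y, rfl⟩ := (ModuleCat.epi_iff_surjective S.homologyπ).1 inferInstance c
  have hy : S.g (S.iCycles y) = 0 := ConcreteCategory.congr_hom S.iCycles_g y
  refine ⟨S.iCycles y, hy, congrArg _ ?_⟩
  apply (ModuleCat.mono_iff_injective S.iCycles).1 inferInstance
  rw [iCycles_moduleCatCyclesIso_inv]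

lemma homologyClass_eq_zero_iff (S : ShortComplex (ModuleCat.{u} k)) (x : S.X₂) (hx : S.g x = 0) :
    homologyClass S x hx = 0 ↔ ∃ y, S.f y = x := by
  have hex : (ShortComplex.mk S.toCycles S.homologyπ (by simp)).Exact :=
    ShortComplex.exact_of_g_is_cokernel _ S.homologyIsCokernel
  rw [ShortComplex.moduleCat_exact_iff] at hex
  constructor
  · intro h
    obtain ⟨y, hy⟩ := hex _ h
    refine ⟨y, ?_⟩
    have := congrArg S.iCycles hy
    rw [iCycles_moduleCatCyclesIso_inv] at this
    rw [← this]
    exact (ConcreteCategory.congr_hom S.toCycles_i y).symm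
  · rintro ⟨y, rfl⟩
    have : S.moduleCatCyclesIso.inv ⟨S.f y, hx⟩ = S.toCycles y := by
      apply (ModuleCat.mono_iff_injective S.iCycles).1 inferInstance
      rw [iCycles_moduleCatCyclesIso_inv]
      exact (ConcreteCategory.congr_hom S.toCycles_i y).symm
    rw [homologyClass, this]
    exact ConcreteCategory.congr_hom S.toCycles_comp_homologyπ y

lemma homologyClass_sub (S : ShortComplex (ModuleCat.{u} k)) (x y : S.X₂) (hx : S.g x = 0)
    (hy : S.g y = 0) : homologyClass S (x - y) (by rw [map_sub, hx, hy, sub_zero]) =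
      homologyClass S x hx - homologyClass S y hy := by
  exact (congrArg S.homologyπ (map_sub S.moduleCatCyclesIso.inv.hom
    (⟨x, hx⟩ : LinearMap.ker S.g.hom) ⟨y, hy⟩)).trans (map_sub S.homologyπ.hom _ _)

lemma homologyMap_homologyClass {S T : ShortComplex (ModuleCat.{u} k)} (f : S ⟶ T) (x : S.X₂)
    (hx : S.g x = 0) : ShortComplex.homologyMap f (homologyClass S x hx) =
      homologyClass T (f.τ₂ x) (by
        rw [← ConcreteCategory.comp_apply, f.comm₂₃, ConcreteCategory.comp_apply, hx, map_zero]) := by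
  refine (ConcreteCategory.congr_hom (ShortComplex.homologyπ_naturality f) _).trans ?_
  refine congrArg T.homologyπ ?_
  apply (ModuleCat.mono_iff_injective T.iCycles).1 inferInstance
  rw [iCycles_moduleCatCyclesIso_inv]
  refine (ConcreteCategory.congr_hom (ShortComplex.cyclesMap_i f) _).trans ?_
  exact congrArg f.τ₂ (iCycles_moduleCatCyclesIso_inv S x hx)

lemma quasiIso_iff_of_moduleCat {S T : ShortComplex (ModuleCat.{u} k)} (f : S ⟶ T) :
    ShortComplex.QuasiIso f ↔
      (∀ x, S.g x = 0 → ∀ y, f.τ₂ x = T.f y → ∃ z, x = S.f z) ∧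
      (∀ y, T.g y = 0 → ∃ x, S.g x = 0 ∧ ∃ z, y = f.τ₂ x + T.f z) := by
  rw [ShortComplex.quasiIso_iff, ConcreteCategory.isIso_iff_bijective, Function.Bijective]
  refine and_congr ⟨fun h x hx y hy => ?_, fun h => ?_⟩ ⟨fun h y hy => ?_, fun h c => ?_⟩
  · have h0 : ShortComplex.homologyMap f (homologyClass S x hx) = 0 := by
      rw [homologyMap_homologyClass, homologyClass_eq_zero_iff]
      exact ⟨y, hy.symm⟩
    obtain ⟨z, hz⟩ := (homologyClass_eq_zero_iff S x hx).1 (h (h0.trans (map_zero _).symm))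
    exact ⟨z, hz.symm⟩
  · refine (injective_iff_map_eq_zero (ShortComplex.homologyMap f).hom).2 fun c hc => ?_
    obtain ⟨x, hx, rfl⟩ := exists_homologyClass S c
    replace hc := (homologyMap_homologyClass f x hx).symm.trans hc
    obtain ⟨y, hy⟩ := (homologyClass_eq_zero_iff _ _ _).1 hc
    obtain ⟨z, hz⟩ := h x hx y hy.symm
    exact (homologyClass_eq_zero_iff _ _ _).2 ⟨z, hz.symm⟩
  · obtain ⟨c, hc⟩ := h (homologyClass T y hy)
    obtain ⟨x, hx, rfl⟩ := exists_homologyClass S c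
    rw [homologyMap_homologyClass, eq_comm, ← sub_eq_zero, ← homologyClass_sub,
      homologyClass_eq_zero_iff] at hc
    obtain ⟨z, hz⟩ := hc
    exact ⟨x, hx, z, by rw [hz]; abel⟩
  · obtain ⟨y, hy, rfl⟩ := exists_homologyClass T c
    obtain ⟨x, hx, z, rfl⟩ := h y hy
    refine ⟨homologyClass S x hx, ?_⟩
    rw [homologyMap_homologyClass, eq_comm, ← sub_eq_zero, ← homologyClass_sub,
      homologyClass_eq_zero_iff]
    exact ⟨z, by abel⟩

lemma quasiIsoAt_iff_of_moduleCat {K L : CochainComplex (ModuleCat.{u} k) ℤ} (f : K ⟶ L) (q : ℤ) :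
    QuasiIsoAt f (q + 1) ↔
      (∀ x, K.d (q + 1) (q + 1 + 1) x = 0 → ∀ y, f.f (q + 1) x = L.d q (q + 1) y →
        ∃ z, x = K.d q (q + 1) z) ∧
      (∀ y, L.d (q + 1) (q + 1 + 1) y = 0 → ∃ x, K.d (q + 1) (q + 1 + 1) x = 0 ∧
        ∃ z, y = f.f (q + 1) x + L.d q (q + 1) z) := by
  rw [quasiIsoAt_iff' f q (q + 1) (q + 1 + 1) (by simp) (by simp)]
  exact quasiIso_iff_of_moduleCat _

lemma quasiIso_iff_elementwise {K L : CochainComplex (ModuleCat.{u} k) ℤ} (f : K ⟶ L) :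
    QuasiIso f ↔ ∀ q : ℤ,
      (∀ x, K.d (q + 1) (q + 1 + 1) x = 0 → ∀ y, f.f (q + 1) x = L.d q (q + 1) y →
        ∃ z, x = K.d q (q + 1) z) ∧
      (∀ y, L.d (q + 1) (q + 1 + 1) y = 0 → ∃ x, K.d (q + 1) (q + 1 + 1) x = 0 ∧
        ∃ z, y = f.f (q + 1) x + L.d q (q + 1) z) := by
  rw [quasiIso_iff]
  refine ⟨fun h q => (quasiIsoAt_iff_of_moduleCat f q).1 (h _), fun h q => ?_⟩
  obtain ⟨q, rfl⟩ : ∃ r, q = r + 1 := ⟨q - 1, by lia⟩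
  exact (quasiIsoAt_iff_of_moduleCat f q).2 (h q)

end ModuleHomology

/-! ### Presentations of complexes of sheaves by locally constant sections -/

section Presentation

open Opposite

variable {k : Type u} [CommRing k] {X : TopCat.{u}}

/-- The stalk functor on sheaves. -/
abbrev stalkAt (k : Type u) [CommRing k] {X : TopCat.{u}} (x : X) : Sh k X ⥤ ModuleCat.{u} k :=
  TopCat.Sheaf.forget (ModuleCat.{u} k) X ⋙ TopCat.Presheaf.stalkFunctor _ x

/-- The complex of stalks. -/
abbrev stalkCx (K : CochainComplex (Sh k X) ℤ) (x : X) : CochainComplex (ModuleCat.{u} k) ℤ :=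
  ((stalkAt k x).mapHomologicalComplex (ComplexShape.up ℤ)).obj K

/-- The map of complexes of stalks. -/
abbrev stalkCxMap {K L : CochainComplex (Sh k X) ℤ} (f : K ⟶ L) (x : X) :
    stalkCx K x ⟶ stalkCx L x :=
  ((stalkAt k x).mapHomologicalComplex (ComplexShape.up ℤ)).map f

lemma quasiIso_stalk {K L : CochainComplex (Sh k X) ℤ} (f : K ⟶ L) [QuasiIso f] (x : X) :
    QuasiIso (stalkCxMap f x) := by
  infer_instance

/-- A presentation of the stalks of a complex of sheaves `K` as subcomplexes `A · x` of a complex of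
modules `W`, such that the elements of `W` extend to sections. -/
structure Presentation {J : Type*} {c : ComplexShape J} (K : HomologicalComplex (Sh k X) c)
    (W : HomologicalComplex (ModuleCat.{u} k) c) (A : ∀ q, X → Submodule k (W.X q)) where
  D_mem : ∀ {i j x β}, β ∈ A i x → W.d i j β ∈ A j x
  γ : ∀ q x, A q x →ₗ[k] (K.X q).presheaf.stalk x
  γ_bijective : ∀ q x, Function.Bijective (γ q x)
  γ_d : ∀ {i j x β} (hβ : β ∈ A i x), stalkMap (K.d i j) x (γ i x ⟨β, hβ⟩) =
    γ j x ⟨W.d i j β, D_mem hβ⟩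
  spread : ∀ q (β : W.X q), ∃ (V : Opens X) (s : (K.X q).presheaf.obj (op V)),
    ∀ x (hβ : β ∈ A q x), ∃ hx : x ∈ V, (K.X q).presheaf.germ V x hx s = γ q x ⟨β, hβ⟩

namespace Presentation

variable {K I : CochainComplex (Sh k X) ℤ} {W : CochainComplex (ModuleCat.{u} k) ℤ}
  {A : ∀ q, X → Submodule k (W.X q)} (P : Presentation K W A) (hI : IsFlasqueCx I) (w : K ⟶ I)

include P hI in
lemma exists_section {q : ℤ} (β : W.X q) : ∃ t : (I.X q).presheaf.obj (op ⊤),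
    ∀ x (hβ : β ∈ A q x), gGerm (I.X q) x t = stalkMap (w.f q) x (P.γ q x ⟨β, hβ⟩) := by
  obtain ⟨V, s, hs⟩ := P.spread q β
  obtain ⟨t, ht⟩ := hI.flasque q V ((w.f q).hom.app _ s)
  refine ⟨t, fun x hβ => ?_⟩
  obtain ⟨hx, h⟩ := hs x hβ
  rw [← h, stalkMap_germ, ← ht]
  exact (TopCat.Presheaf.germ_res_apply (I.X q).presheaf _ x hx t).symm

/-- A global section that represents `β`. -/
def sect {q : ℤ} (β : W.X q) : (I.X q).presheaf.obj (op ⊤) := (P.exists_section hI w β).choose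

lemma gGerm_sect {q : ℤ} {β : W.X q} {x : X} (hβ : β ∈ A q x) :
    gGerm (I.X q) x (P.sect hI w β) = stalkMap (w.f q) x (P.γ q x ⟨β, hβ⟩) :=
  (P.exists_section hI w β).choose_spec x hβ

/-- A flasque resolution of a presented complex is represented by the presentation. -/
def rep [QuasiIso w] : hI.cx.Rep (W := fun q => W.X q)
    (fun q => (W.d q (q + 1)).hom.toAddMonoidHom) (fun q x => (A q x).toAddSubgroup) where
  ρ q β := P.sect hI w β
  D_mem h := P.D_mem h
  D_D {q} β := ConcreteCategory.congr_hom (W.d_comp_d q (q + 1) (q + 1 + 1)) β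
  add {q x β γ} hβ hγ := by
    refine Eq.trans ?_ (map_add (hI.cx.germ x (q := q)) _ _)
    refine hI.germ_eq_iff.2 ((P.gGerm_sect hI w (add_mem hβ hγ)).trans ?_)
    refine Eq.trans ?_ (map_add (gGerm (I.X q) x).hom _ _).symm
    refine Eq.trans ?_ (congrArg₂ (· + ·) (P.gGerm_sect hI w hβ) (P.gGerm_sect hI w hγ)).symm
    refine Eq.trans ?_ (map_add (stalkMap (w.f q) x).hom _ _)
    exact congrArg _ (map_add (P.γ q x) ⟨β, hβ⟩ ⟨γ, hγ⟩)
  d {q x β} hβ := by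
    refine hI.germ_eq_iff.2 ?_
    refine Eq.trans ?_ (P.gGerm_sect hI w (P.D_mem hβ)).symm
    refine (stalkMap_germ (I.d q (q + 1)) x (U := ⊤) trivial _).symm.trans ?_
    refine (congrArg (stalkMap (I.d q (q + 1)) x) (P.gGerm_sect hI w hβ)).trans ?_
    refine Eq.trans ?_ (congrArg _ (P.γ_d hβ))
    exact ConcreteCategory.congr_hom ((stalkCxMap w x).comm q (q + 1)) (P.γ q x ⟨β, hβ⟩)
  surj {q x s} hs := by
    have hs' : stalkMap (I.d (q + 1) (q + 1 + 1)) x (gGerm (I.X (q + 1)) x s) = 0 :=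
      (stalkMap_germ (I.d (q + 1) (q + 1 + 1)) x (U := ⊤) trivial s).trans
        (FlabbyCx.germ_eq_zero.1 hs)
    obtain ⟨a, ha, b, hb⟩ := ((quasiIso_iff_elementwise (stalkCxMap w x)).1
      (quasiIso_stalk w x) q).2 _ hs'
    obtain ⟨⟨β, hβ⟩, rfl⟩ := (P.γ_bijective (q + 1) x).2 a
    obtain ⟨t, rfl⟩ := hI.exists_germ b
    refine ⟨β, hβ, ?_, t, ?_⟩
    · have h := (P.γ_d hβ).symm.trans ha
      have := (P.γ_bijective (q + 1 + 1) x).1 (h.trans (map_zero _).symm)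
      exact congrArg Subtype.val this
    · refine Eq.trans ?_ (map_add (hI.cx.germ x (q := q + 1)) _ _)
      refine hI.germ_eq_iff.2 (hb.trans ?_)
      refine Eq.trans ?_ (map_add (gGerm (I.X (q + 1)) x).hom _ _).symm
      refine congrArg₂ (· + ·) (P.gGerm_sect hI w hβ).symm ?_
      exact stalkMap_germ (I.d q (q + 1)) x (U := ⊤) trivial t
  inj {q x β t} hβ hDβ h := by
    have h' : stalkMap (w.f (q + 1)) x (P.γ (q + 1) x ⟨β, hβ⟩) =
        stalkMap (I.d q (q + 1)) x (gGerm (I.X q) x t) :=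
      (P.gGerm_sect hI w hβ).symm.trans ((hI.germ_eq_iff.1 h).trans
        (stalkMap_germ (I.d q (q + 1)) x (U := ⊤) trivial t).symm)
    obtain ⟨a, ha⟩ := ((quasiIso_iff_elementwise (stalkCxMap w x)).1
      (quasiIso_stalk w x) q).1 (P.γ (q + 1) x ⟨β, hβ⟩) (by
        refine (P.γ_d hβ).trans ((congrArg _ ?_).trans (map_zero (P.γ (q + 1 + 1) x)))
        exact Subtype.ext hDβ) _ h'
    obtain ⟨⟨γ, hγ⟩, rfl⟩ := (P.γ_bijective q x).2 a
    refine ⟨γ, hγ, ?_⟩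
    have := (P.γ_bijective (q + 1) x).1 (ha.trans (P.γ_d hγ))
    exact (congrArg Subtype.val this).symm

include P w in
lemma exactAt_of_eq_bot [QuasiIso w] {x : X} (hx : ∀ q, A q x = ⊥) : hI.cx.ExactAt x := by
  intro q s hs
  obtain ⟨β, hβ, -, t, ht⟩ := (P.rep hI w).surj (FlabbyCx.germ_eq_zero.2 hs)
  have h0 : β = 0 := by
    have : β ∈ A (q + 1) x := hβ
    rwa [hx, Submodule.mem_bot] at this
  subst h0
  refine ⟨t, FlabbyCx.germ_eq_iff.1 ?_⟩
  rw [ht, (P.rep hI w).zero, zero_add]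

end Presentation

/-- A morphism of presentations. -/
structure Presentation.Compat {J : Type*} {c : ComplexShape J} {K L : HomologicalComplex (Sh k X) c}
    {W W' : HomologicalComplex (ModuleCat.{u} k) c} {A : ∀ q, X → Submodule k (W.X q)}
    {A' : ∀ q, X → Submodule k (W'.X q)} (P : Presentation K W A) (P' : Presentation L W' A')
    (f : K ⟶ L) (φ : W ⟶ W') : Prop where
  mem : ∀ {q x β}, β ∈ A q x → φ.f q β ∈ A' q x
  eq : ∀ {q x β} (hβ : β ∈ A q x), stalkMap (f.f q) x (P.γ q x ⟨β, hβ⟩) =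
    P'.γ q x ⟨φ.f q β, mem hβ⟩

/-- The map of subcomplexes induced by `φ` at the point `x` is a quasi-isomorphism (in the degrees
that have a predecessor and a successor). -/
structure QuasiAt {J : Type*} {c : ComplexShape J} {W W' : HomologicalComplex (ModuleCat.{u} k) c}
    (A : ∀ q, X → Submodule k (W.X q)) (A' : ∀ q, X → Submodule k (W'.X q)) (φ : W ⟶ W') (x : X) :
    Prop where
  inj : ∀ i j l, c.Rel i j → c.Rel j l → ∀ β ∈ A j x, W.d j l β = 0 → ∀ γ ∈ A' i x,
    φ.f _ β = W'.d i j γ → ∃ δ ∈ A i x, β = W.d i j δ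
  surj : ∀ i j l, c.Rel i j → c.Rel j l → ∀ β ∈ A' j x, W'.d j l β = 0 → ∃ δ ∈ A j x,
    W.d j l δ = 0 ∧ ∃ γ ∈ A' i x, β = φ.f _ δ + W'.d i j γ

section Compat

variable {K L I J : CochainComplex (Sh k X) ℤ}
    {W W' : CochainComplex (ModuleCat.{u} k) ℤ} {A : ∀ q, X → Submodule k (W.X q)}
    {A' : ∀ q, X → Submodule k (W'.X q)} {P : Presentation K W A} {P' : Presentation L W' A'}
    {f : K ⟶ L} {φ : W ⟶ W'} (hI : IsFlasqueCx I) (hJ : IsFlasqueCx J) {w : K ⟶ I} {w' : L ⟶ J}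
    [QuasiIso w] [QuasiIso w'] {g : I ⟶ J}

lemma Presentation.Compat.germ_eq (h : P.Compat P' f φ) (hg : f ≫ w' = w ≫ g) {q : ℤ} {x : X}
    {β : W.X q} (hβ : β ∈ A q x) :
    hJ.cx.germ x ((flabbyHom hI hJ g).f q ((P.rep hI w).ρ q β)) =
      hJ.cx.germ x ((P'.rep hJ w').ρ q (φ.f q β)) := by
  refine hJ.germ_eq_iff.2 ?_
  refine (stalkMap_germ (g.f q) x (U := ⊤) trivial _).symm.trans ?_
  refine (congrArg (stalkMap (g.f q) x) (P.gGerm_sect hI w hβ)).trans ?_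
  refine Eq.trans ?_ (P'.gGerm_sect hJ w' (h.mem hβ)).symm
  refine Eq.trans ?_ (congrArg (stalkMap (w'.f q) x) (h.eq hβ))
  have e : stalkCxMap w x ≫ stalkCxMap g x = stalkCxMap f x ≫ stalkCxMap w' x := by
    rw [← Functor.map_comp, ← Functor.map_comp, hg]
  exact ConcreteCategory.congr_hom (HomologicalComplex.congr_hom e q) (P.γ q x ⟨β, hβ⟩)

/-- If the presentations are quasi-isomorphic at `x`, the mapping cone of a morphism of flasque
resolutions is exact there. -/
lemma Presentation.Compat.exactAt_cone (h : P.Compat P' f φ) (hg : f ≫ w' = w ≫ g) {x : X}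
    (hx : QuasiAt A A' φ x) :
    (FlabbyCx.cone (flabbyHom hI hJ g)).ExactAt x :=
  FlabbyCx.exactAt_cone (P.rep hI w) (P'.rep hJ w') (fun q => (φ.f q).hom.toAddMonoidHom)
    (fun _ _ hβ => h.mem hβ) (fun _ _ hβ => h.germ_eq hI hJ hg hβ)
    (fun q => hx.inj q (q + 1) (q + 1 + 1) rfl rfl) (fun q => hx.surj q (q + 1) (q + 1 + 1) rfl rfl)
    (fun q β _ => ConcreteCategory.congr_hom (φ.comm q (q + 1)).symm β)

end Compat

/-! ### Compactly supported sections -/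

section CompactSections

variable [T2Space X]

lemma mem_compactSections_iff {U : Opens X} {F : Sh k X} {s : F.presheaf.obj (op ⊤)} :
    s ∈ compactSections U F ↔ ∃ K, IsCompact K ∧ K ⊆ (U : Set X) ∧ Kᶜ ⊆ {x | gGerm F x s = 0} := by
  constructor
  · rintro ⟨K, hK, hKU, h⟩
    refine ⟨K, hK, hKU, fun x hx => ?_⟩
    have := congrArg (F.presheaf.germ ⟨Kᶜ, hK.isClosed.isOpen_compl⟩ x hx) h
    rw [TopCat.Presheaf.germ_res_apply, map_zero] at this
    exact this
  · rintro ⟨K, hK, hKU, h⟩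
    refine ⟨K, hK, hKU, TopCat.Presheaf.section_ext F _ _ _ fun x hx => ?_⟩
    rw [TopCat.Presheaf.germ_res_apply, map_zero]
    exact h hx

lemma IsFlasqueCx.cs_iff {I : CochainComplex (Sh k X) ℤ} (hI : IsFlasqueCx I) {U : Opens X} {q : ℤ}
    {s : (I.X q).presheaf.obj (op ⊤)} :
    s ∈ compactSections U (I.X q) ↔ hI.cx.CS U (q := q) s :=
  mem_compactSections_iff

lemma quasiIso_gammaC {I J : CochainComplex (Sh k X) ℤ} (hI : IsFlasqueCx I) (hJ : IsFlasqueCx J)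
    (g : I ⟶ J) (U : Opens X) (h : FlabbyCx.ConeAcyclic (flabbyHom hI hJ g) (U : Set X)) :
    QuasiIso (((gammaC U).mapHomologicalComplex (ComplexShape.up ℤ)).map g) := by
  rw [quasiIso_iff_elementwise]
  refine fun q => ⟨?_, ?_⟩
  · rintro ⟨a, ha⟩ hda ⟨b, hb⟩ hab
    obtain ⟨c, hc, hac⟩ := h.injective (hI.cs_iff.1 ha) (congrArg Subtype.val hda) (hJ.cs_iff.1 hb)
      (congrArg Subtype.val hab)
    exact ⟨⟨c, hI.cs_iff.2 hc⟩, Subtype.ext hac⟩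
  · rintro ⟨b, hb⟩ hdb
    obtain ⟨a, c, ha, hda, hc, hbc⟩ := h.surjective (hJ.cs_iff.1 hb) (congrArg Subtype.val hdb)
    exact ⟨⟨a, hI.cs_iff.2 ha⟩, Subtype.ext hda, ⟨c, hJ.cs_iff.2 hc⟩, Subtype.ext hbc⟩

lemma coneAcyclic_of_exactAt [LocallyCompactSpace X] [NormalSpace X] {I J : FlabbyCx X}
    (g : FlabbyCx.Hom I J) {U : Set X} (hU : IsOpen U)
    (h : ∀ x ∈ U, (FlabbyCx.cone g).ExactAt x) : FlabbyCx.ConeAcyclic g U := by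
  intro q s hs hds
  obtain ⟨t, ht, hst⟩ := FlabbyCx.exactNear_of_exactAt hU isClosed_univ
    (fun x _ hx => h x hx) q s hs (by rw [hds, (FlabbyCx.cone g).z_zero])
  exact ⟨t, ht, sub_eq_zero.1 ((FlabbyCx.cone g).eq_zero _ (Set.univ_subset_iff.1 hst))⟩

lemma quasiIso_gammaCExt [LocallyCompactSpace X] [NormalSpace X] {I : CochainComplex (Sh k X) ℤ}
    (hI : IsFlasqueCx I) (U : Opens X) (h : ∀ x ∉ U, hI.cx.ExactAt x) :
    QuasiIso ((NatTrans.mapHomologicalComplex (gammaCExt (k := k) (le_top : U ≤ ⊤))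
      (ComplexShape.up ℤ)).app I) := by
  have key : ∀ q (s : hI.cx.M (q + 1)), hI.cx.CS Set.univ s → (U : Set X)ᶜ ⊆ hI.cx.z (hI.cx.d _ s) →
      ∃ (t : hI.cx.M q) (r : hI.cx.M (q + 1)), hI.cx.CS Set.univ t ∧ hI.cx.CS U r ∧
        s = r + hI.cx.d q t ∧ hI.cx.d _ r = hI.cx.d _ s := by
    intro q s hs hsU
    obtain ⟨t, ht, hst⟩ := FlabbyCx.exactNear_of_exactAt isOpen_univ U.isOpen.isClosed_compl
      (fun x hx _ => h x hx) q s hs hsU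
    refine ⟨t, s - hI.cx.d q t, ht, ?_, (sub_add_cancel _ _).symm, by
      rw [map_sub, hI.cx.d_d, sub_zero]⟩
    obtain ⟨K, hK, -, hKz⟩ := hs.sub ht.d
    refine ⟨(hI.cx.z (s - hI.cx.d q t))ᶜ, ?_, Set.compl_subset_comm.1 hst, by simp⟩
    exact hK.of_isClosed_subset (hI.cx.isOpen_z _).isClosed_compl (Set.compl_subset_comm.1 hKz)
  rw [quasiIso_iff_elementwise]
  refine fun q => ⟨?_, ?_⟩
  · rintro ⟨a, ha⟩ hda ⟨b, hb⟩ hab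
    obtain ⟨q, rfl⟩ : ∃ r, q = r + 1 := ⟨q - 1, by lia⟩
    replace hab : a = hI.cx.d (q + 1) b := congrArg Subtype.val hab
    have ha' := hI.cs_iff.1 ha
    obtain ⟨t, r, -, hr, -, hbr⟩ := key q b (hI.cs_iff.1 hb) (by
      rw [← hab]
      obtain ⟨K, -, hKU, hKz⟩ := ha'
      exact (Set.compl_subset_compl.2 hKU).trans hKz)
    exact ⟨⟨r, hI.cs_iff.2 hr⟩, Subtype.ext (hab.trans hbr.symm)⟩
  · rintro ⟨b, hb⟩ hdb
    replace hdb : hI.cx.d (q + 1) b = 0 := congrArg Subtype.val hdb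
    obtain ⟨t, r, ht, hr, hbr, hr'⟩ := key q b (hI.cs_iff.1 hb) (by rw [hdb, hI.cx.z_zero]; simp)
    exact ⟨⟨r, hI.cs_iff.2 hr⟩, Subtype.ext (hr'.trans hdb), ⟨t, hI.cs_iff.2 ht⟩, Subtype.ext hbr⟩

end CompactSections

end Presentation

end Toric

end

noncomputable section

namespace Toric

/-! ### Computing the derived functors of compactly supported sections -/

section Derived

variable {k : Type u} [CommRing k] {X : TopCat.{u}}

lemma isFlasqueCx_of_injective {I : CochainComplex.Plus (Sh k X)}
    (hI : ∀ n, Injective (I.obj.X n)) : IsFlasqueCx I.obj :=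
  ⟨fun q => isFlasque_of_injective _ (hI q), I.property⟩

lemma exists_injective_resolution_hom {K L : CochainComplex.Plus (Sh k X)} (f : K ⟶ L) :
    ∃ (I J : CochainComplex.Plus (Sh k X)) (_ : ∀ n, Injective (I.obj.X n))
      (_ : ∀ n, Injective (J.obj.X n)) (w : K ⟶ I) (w' : L ⟶ J) (g : I ⟶ J),
      QuasiIso w.hom ∧ QuasiIso w'.hom ∧ f ≫ w' = w ≫ g := by
  let r : (CochainComplex.Plus.localizerMorphism (Sh k X)).arrow.RightResolution (Arrow.mk f) :=
    Classical.arbitrary _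
  refine ⟨_, _, fun n => ?_, fun n => ?_, r.w.left, r.w.right, _, r.hw.1, r.hw.2, r.w.w.symm⟩
  · exact (r.X₁.left.obj.X n).property
  · exact (r.X₁.right.obj.X n).property

lemma isIso_rightDerivedFunctorPlusUnit {C D : Type*} [Category* C] [Category* D] [Abelian C]
    [Abelian D] [HasDerivedCategory C] [HasDerivedCategory D] (F : C ⥤ D) [F.Additive]
    [EnoughInjectives C] (I : CochainComplex.Plus C) (hI : ∀ n, Injective (I.obj.X n)) :
    IsIso (F.rightDerivedFunctorPlusUnit.app ((HomotopyCategory.Plus.quotient C).obj I)) := by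
  have : ∀ n, Injective (((HomotopyCategory.Plus.quotient C).obj I).obj.as.X n) := hI
  infer_instance

open DerivedCategory.Plus (Q Qh)

variable [T2Space X] [HasDerivedCategory.{w₂} (ModuleCat.{u} k)]

lemma isIso_Qh_gammaC_map (U : Opens X) {I J : CochainComplex.Plus (Sh k X)} (g : I ⟶ J)
    (h : QuasiIso (((gammaC U).mapHomologicalComplex (ComplexShape.up ℤ)).map g.hom)) :
    IsIso ((Qh : _ ⥤ DerivedCategory.Plus (ModuleCat.{u} k)).map
      ((gammaC U).mapHomotopyCategoryPlus.map ((HomotopyCategory.Plus.quotient (Sh k X)).map g))) :=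
  Localization.inverts Qh (HomotopyCategory.Plus.quasiIso (ModuleCat.{u} k)) _
    ((HomotopyCategory.quotient_map_mem_quasiIso_iff
      (((gammaC U).mapHomologicalComplex (ComplexShape.up ℤ)).map g.hom)).2 h)

variable [HasDerivedCategory.{w₁} (Sh k X)]

instance isIso_Q_map {K L : CochainComplex.Plus (Sh k X)} (f : K ⟶ L) [hf : QuasiIso f.hom] :
    IsIso ((Q : _ ⥤ DerivedCategory.Plus (Sh k X)).map f) :=
  Localization.inverts Qh (HomotopyCategory.Plus.quasiIso (Sh k X))
    ((HomotopyCategory.Plus.quotient (Sh k X)).map f)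
    ((HomotopyCategory.quotient_map_mem_quasiIso_iff f.hom).2 hf)

/-- The unit of the derived functor at a complex. -/
abbrev gammaCUnit (U : Opens X) (K : CochainComplex.Plus (Sh k X)) :
    (Qh : _ ⥤ DerivedCategory.Plus (ModuleCat.{u} k)).obj
      ((gammaC U).mapHomotopyCategoryPlus.obj ((HomotopyCategory.Plus.quotient (Sh k X)).obj K)) ⟶
    (gammaC U).rightDerivedFunctorPlus.obj (Q.obj K) :=
  (gammaC U).rightDerivedFunctorPlusUnit.app ((HomotopyCategory.Plus.quotient (Sh k X)).obj K)

lemma gammaCUnit_naturality (U : Opens X) {K L : CochainComplex.Plus (Sh k X)} (f : K ⟶ L) :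
    (Qh : _ ⥤ DerivedCategory.Plus (ModuleCat.{u} k)).map ((gammaC U).mapHomotopyCategoryPlus.map
      ((HomotopyCategory.Plus.quotient (Sh k X)).map f)) ≫ gammaCUnit U L =
    gammaCUnit U K ≫ (gammaC U).rightDerivedFunctorPlus.map (Q.map f) :=
  (gammaC U).rightDerivedFunctorPlusUnit.naturality ((HomotopyCategory.Plus.quotient (Sh k X)).map f)

lemma isIso_gammaCUnit_of_injective (U : Opens X) (I : CochainComplex.Plus (Sh k X))
    (hI : ∀ n, Injective (I.obj.X n)) : IsIso (gammaCUnit U I) :=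
  isIso_rightDerivedFunctorPlusUnit (gammaC U) I hI

/-- `RΓ_c(U; -)` inverts `f` if it inverts morphisms of flasque resolutions. -/
lemma isIso_rightDerived_map (U : Opens X) {K L : CochainComplex.Plus (Sh k X)} (f : K ⟶ L)
    (h : ∀ (I J : CochainComplex (Sh k X) ℤ) (hI : IsFlasqueCx I) (hJ : IsFlasqueCx J)
      (w : K.obj ⟶ I) (w' : L.obj ⟶ J) (g : I ⟶ J), QuasiIso w → QuasiIso w' →
      f.hom ≫ w' = w ≫ g → FlabbyCx.ConeAcyclic (flabbyHom hI hJ g) (U : Set X)) :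
    IsIso ((gammaC (k := k) U).rightDerivedFunctorPlus.map (Q.map f)) := by
  obtain ⟨I, J, hI, hJ, w, w', g, hw, hw', hg⟩ := exists_injective_resolution_hom f
  have h1 := isIso_gammaCUnit_of_injective U I hI
  have h2 := isIso_gammaCUnit_of_injective U J hJ
  have h3 := isIso_Qh_gammaC_map U g (quasiIso_gammaC (isFlasqueCx_of_injective hI)
    (isFlasqueCx_of_injective hJ) g.hom U (h _ _ _ _ w.hom w'.hom g.hom hw hw'
      (congrArg (fun f => f.hom) hg)))
  have h4 : IsIso ((gammaC (k := k) U).rightDerivedFunctorPlus.map (Q.map g)) := by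
    have := gammaCUnit_naturality U g
    rw [← IsIso.inv_comp_eq] at this
    rw [← this]
    infer_instance
  have h5 : (gammaC (k := k) U).rightDerivedFunctorPlus.map (Q.map f) ≫
      (gammaC (k := k) U).rightDerivedFunctorPlus.map (Q.map w') =
      (gammaC (k := k) U).rightDerivedFunctorPlus.map (Q.map w) ≫
      (gammaC (k := k) U).rightDerivedFunctorPlus.map (Q.map g) := by
    rw [← Functor.map_comp, ← Functor.map_comp, ← Functor.map_comp, ← Functor.map_comp, hg]
  have := isIso_Q_map w
  have := isIso_Q_map w'
  rw [← IsIso.eq_comp_inv] at h5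
  rw [h5]
  infer_instance

lemma isIso_gammaCUnit (U : Opens X) (K : CochainComplex.Plus (Sh k X)) (hK : IsFlasqueCx K.obj)
    (h : ∀ (J : CochainComplex (Sh k X) ℤ) (hJ : IsFlasqueCx J) (w : K.obj ⟶ J), QuasiIso w →
      FlabbyCx.ConeAcyclic (flabbyHom hK hJ w) (U : Set X)) :
    IsIso (gammaCUnit (k := k) U K) := by
  obtain ⟨I, J, hI, hJ, w, w', g, hw, hw', hg⟩ := exists_injective_resolution_hom (𝟙 K)
  have h2 := isIso_gammaCUnit_of_injective U J hJ
  have h3 := isIso_Qh_gammaC_map U w' (quasiIso_gammaC hK (isFlasqueCx_of_injective hJ) w'.hom U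
    (h _ _ w'.hom hw'))
  have := isIso_Q_map w'
  have h4 := gammaCUnit_naturality U w'
  rw [← IsIso.comp_inv_eq] at h4
  rw [← h4]
  infer_instance

/-- The morphism `RΓ_c(U; -) → RΓ_c(V; -)`. -/
abbrev rightDerivedExt {U V : Opens X} (h : U ≤ V) :
    (gammaC (k := k) U).rightDerivedFunctorPlus ⟶ (gammaC V).rightDerivedFunctorPlus :=
  Functor.rightDerivedNatTrans _ _
    (gammaC (k := k) U).rightDerivedFunctorPlusUnit (gammaC V).rightDerivedFunctorPlusUnit
    (HomotopyCategory.Plus.quasiIso _)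
    (Functor.whiskerRight (gammaCExtPlus h) DerivedCategory.Plus.Qh)

lemma isIso_rightDerivedExt [LocallyCompactSpace X] [NormalSpace X] (U : Opens X)
    (K : CochainComplex.Plus (Sh k X))
    (h : ∀ (I : CochainComplex (Sh k X) ℤ) (hI : IsFlasqueCx I) (w : K.obj ⟶ I), QuasiIso w →
      ∀ x ∉ U, hI.cx.ExactAt x) :
    IsIso ((rightDerivedExt (k := k) (le_top : U ≤ ⊤)).app (Q.obj K)) := by
  obtain ⟨J, I, -, hI, -, w, -, -, hw, -⟩ := exists_injective_resolution_hom (𝟙 K)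
  have h1 := isIso_gammaCUnit_of_injective U I hI
  have h2 := isIso_gammaCUnit_of_injective ⊤ I hI
  have h3 : IsIso ((Qh : _ ⥤ DerivedCategory.Plus (ModuleCat.{u} k)).map
      ((gammaCExtPlus (k := k) (le_top : U ≤ ⊤)).app
        ((HomotopyCategory.Plus.quotient (Sh k X)).obj I))) :=
    Localization.inverts Qh (HomotopyCategory.Plus.quasiIso (ModuleCat.{u} k)) _
      ((HomotopyCategory.quotient_map_mem_quasiIso_iff _).2
        (quasiIso_gammaCExt (isFlasqueCx_of_injective hI) U (h _ _ w.hom hw)))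
  have h4 : gammaCUnit U I ≫ (rightDerivedExt (k := k) (le_top : U ≤ ⊤)).app (Q.obj I) =
      (Qh : _ ⥤ DerivedCategory.Plus (ModuleCat.{u} k)).map
      ((gammaCExtPlus (k := k) (le_top : U ≤ ⊤)).app
        ((HomotopyCategory.Plus.quotient (Sh k X)).obj I)) ≫ gammaCUnit ⊤ I :=
    Functor.rightDerivedNatTrans_app _ _ _ _ _ _ _
  have h5 : IsIso ((rightDerivedExt (k := k) (le_top : U ≤ ⊤)).app (Q.obj I)) := by
    rw [← IsIso.eq_inv_comp] at h4
    rw [h4]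
    infer_instance
  have := isIso_Q_map w
  have h6 := (rightDerivedExt (k := k) (le_top : U ≤ ⊤)).naturality (Q.map w)
  rw [← IsIso.comp_inv_eq] at h6
  rw [← h6]
  infer_instance

end Derived

end Toric

end

noncomputable section

namespace Toric

/-! ### Complexes of sheaves of locally constant sections -/

section LcComplex

open Opposite

variable {k : Type u} [CommRing k] {X : TopCat.{u}}

section Germ

variable {W W' : Type u} [AddCommGroup W] [Module k W] [AddCommGroup W'] [Module k W']

/-- The constant section with value `β` on an open set on which it is allowed. -/
def lcConst (A : X → Submodule k W) (β : W) (U : Opens X) (h : ∀ x ∈ U, β ∈ A x) :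
    (lcSheaf A).presheaf.obj (op U) :=
  (⟨fun _ => β, IsLocallyConstant.const β, fun x => h x x.2⟩ : lcSections A U)

lemma lcGerm_eq_iff (A : X → Submodule k W) {U V : Opens X} {x : X} (hU : x ∈ U) (hV : x ∈ V)
    (s : (lcSheaf A).presheaf.obj (op U)) (t : (lcSheaf A).presheaf.obj (op V)) :
    (lcSheaf A).presheaf.germ U x hU s = (lcSheaf A).presheaf.germ V x hV t ↔
      (show lcSections A U from s).1 ⟨x, hU⟩ = (show lcSections A V from t).1 ⟨x, hV⟩ := by
  constructor
  · intro h
    obtain ⟨O, hO, i, j, e⟩ := (lcSheaf A).presheaf.germ_eq x hU hV s t h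
    exact congrArg (fun s : lcSections A O => s.1 ⟨x, hO⟩) e
  · intro h
    have h1 := (IsLocallyConstant.iff_exists_open _).1 (show lcSections A U from s).2.1 ⟨x, hU⟩
    have h2 := (IsLocallyConstant.iff_exists_open _).1 (show lcSections A V from t).2.1 ⟨x, hV⟩
    obtain ⟨O1, hO1, hx1, e1⟩ := h1
    obtain ⟨O2, hO2, hx2, e2⟩ := h2
    let O : Opens X := ⟨Subtype.val '' O1 ∩ Subtype.val '' O2,
      (U.isOpen.isOpenMap_subtype_val _ hO1).inter (V.isOpen.isOpenMap_subtype_val _ hO2)⟩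
    have hOU : O ≤ U := by rintro y ⟨⟨z, -, rfl⟩, -⟩; exact z.2
    have hOV : O ≤ V := by rintro y ⟨-, ⟨z, -, rfl⟩⟩; exact z.2
    refine TopCat.Presheaf.germ_ext (lcSheaf A).presheaf O ⟨⟨_, hx1, rfl⟩, ⟨_, hx2, rfl⟩⟩
      (homOfLE hOU) (homOfLE hOV) ?_
    refine Subtype.ext (funext fun y => ?_)
    obtain ⟨y, ⟨y1, hy1, rfl⟩, ⟨y2, hy2, hy⟩⟩ := y
    have e3 : (⟨y1.1, hOV ⟨⟨y1, hy1, rfl⟩, ⟨y2, hy2, hy⟩⟩⟩ : V) = y2 := Subtype.ext hy.symm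
    exact (e1 y1 hy1).trans (h.trans (e2 _ ((congrArg (· ∈ O2) e3).mpr hy2)).symm)

variable (A : X → Submodule k W) (hA : ∀ β, IsOpen {x | β ∈ A x})

/-- The germ at `x` of the constant section with value `β`. -/
def lcGerm (x : X) : A x →ₗ[k] (lcSheaf A).presheaf.stalk x where
  toFun β := (lcSheaf A).presheaf.germ ⟨_, hA β.1⟩ x β.2 (lcConst A β.1 _ fun _ h => h)
  map_add' β γ := by
    let O : Opens X := ⟨{x | β.1 ∈ A x} ∩ {x | γ.1 ∈ A x}, (hA _).inter (hA _)⟩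
    have h1 : (lcSheaf A).presheaf.germ ⟨_, hA β.1⟩ x β.2 (lcConst A β.1 _ fun _ h => h) =
        (lcSheaf A).presheaf.germ O x ⟨β.2, γ.2⟩ (lcConst A β.1 _ fun _ h => h.1) :=
      (lcGerm_eq_iff A _ _ _ _).2 rfl
    have h2 : (lcSheaf A).presheaf.germ ⟨_, hA γ.1⟩ x γ.2 (lcConst A γ.1 _ fun _ h => h) =
        (lcSheaf A).presheaf.germ O x ⟨β.2, γ.2⟩ (lcConst A γ.1 _ fun _ h => h.2) :=
      (lcGerm_eq_iff A _ _ _ _).2 rfl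
    rw [h1, h2, ← map_add]
    exact (lcGerm_eq_iff A _ _ _ _).2 rfl
  map_smul' c β := by
    rw [RingHom.id_apply, ← map_smul]
    exact (lcGerm_eq_iff A _ _ _ _).2 rfl

lemma lcGerm_bijective (x : X) : Function.Bijective (lcGerm A hA x) := by
  constructor
  · intro β γ h
    exact Subtype.ext ((lcGerm_eq_iff A _ _ _ _).1 h)
  · intro s
    obtain ⟨U, hx, s, rfl⟩ := (lcSheaf A).presheaf.exists_germ_eq s
    exact ⟨⟨(show lcSections A U from s).1 ⟨x, hx⟩, (show lcSections A U from s).2.2 ⟨x, hx⟩⟩,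
      (lcGerm_eq_iff A _ _ _ _).2 rfl⟩

lemma stalkMap_lcMap (A' : X → Submodule k W') (hA' : ∀ β, IsOpen {x | β ∈ A' x})
    (g : W →ₗ[k] W') (hg) (x : X) (β : A x) :
    stalkMap (lcMap A A' g hg) x (lcGerm A hA x β) = lcGerm A' hA' x ⟨g β.1, hg x _ β.2⟩ := by
  refine (stalkMap_germ _ _ _ _).trans ?_
  exact (lcGerm_eq_iff A' _ _ _ _).2 rfl

end Germ

variable (k X) in
/-- A complex of `k`-modules with a family of subcomplexes indexed by the points of `X` that can
only increase locally. -/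
structure LcCx where
  W : ℕ → Type u
  [grp : ∀ p, AddCommGroup (W p)]
  [mod : ∀ p, Module k (W p)]
  D : ∀ p, W p →ₗ[k] W (p + 1)
  D_D : ∀ p w, D (p + 1) (D p w) = 0
  A : ∀ p, X → Submodule k (W p)
  D_mem : ∀ p x, ∀ w ∈ A p x, D p w ∈ A (p + 1) x
  isOpen : ∀ p w, IsOpen {x | w ∈ A p x}

attribute [instance] LcCx.grp LcCx.mod

namespace LcCx

/-- The complex of sheaves of locally constant sections. -/
def sheafCx (C : LcCx k X) : CochainComplex (Sh k X) ℕ :=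
  CochainComplex.of (fun p => lcSheaf (C.A p)) (fun p => lcMap _ _ (C.D p) (C.D_mem p)) fun p => by
    refine (lcMap_comp (C.A p) (C.A (p + 1)) (C.A (p + 2)) _ _ _ _).trans ?_
    exact (lcMap_congr (LinearMap.ext (C.D_D p)) _ (by simp)).trans (lcMap_zero _ _ _)

/-- The ambient complex of modules. -/
def modCx (C : LcCx k X) : CochainComplex (ModuleCat.{u} k) ℕ :=
  CochainComplex.of (fun p => ModuleCat.of k (C.W p)) (fun p => ModuleCat.ofHom (C.D p)) fun p => by
    ext w
    exact C.D_D p w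

/-- A morphism of families of complexes. -/
structure Hom (C C' : LcCx k X) where
  f : ∀ p, C.W p →ₗ[k] C'.W p
  comm : ∀ p w, f (p + 1) (C.D p w) = C'.D p (f p w)
  mem : ∀ p x, ∀ w ∈ C.A p x, f p w ∈ C'.A p x

variable {C C' : LcCx k X}

/-- The induced morphism of complexes of sheaves. -/
def Hom.sheafMap (f : C.Hom C') : C.sheafCx ⟶ C'.sheafCx :=
  CochainComplex.ofHom (X := C.sheafCx) (Y := C'.sheafCx)
    (fun p => lcMap (C.A p) (C'.A p) (f.f p) (f.mem p)) (fun p => by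
      have : lcMap (C.A p) (C'.A p) (f.f p) (f.mem p) ≫
          lcMap (C'.A p) (C'.A (p + 1)) (C'.D p) (C'.D_mem p) =
          lcMap (C.A p) (C.A (p + 1)) (C.D p) (C.D_mem p) ≫
          lcMap (C.A (p + 1)) (C'.A (p + 1)) (f.f (p + 1)) (f.mem (p + 1)) := by
        refine (lcMap_comp (C.A p) (C'.A p) (C'.A (p + 1)) _ _ _ _).trans ?_
        refine Eq.trans ?_ (lcMap_comp (C.A p) (C.A (p + 1)) (C'.A (p + 1)) _ _ _ _).symm
        exact lcMap_congr (LinearMap.ext fun w => (f.comm p w).symm) _ _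
      simpa [sheafCx] using this)

/-- The induced morphism of complexes of modules. -/
def Hom.modMap (f : C.Hom C') : C.modCx ⟶ C'.modCx :=
  CochainComplex.ofHom (X := C.modCx) (Y := C'.modCx)
    (fun p => ModuleCat.ofHom (f.f p)) (fun p => by
      simp only [modCx, CochainComplex.of_d]
      ext w
      exact (f.comm p w).symm)

lemma modCx_d (C : LcCx k X) (p : ℕ) (w : C.W p) : C.modCx.d p (p + 1) w = C.D p w := by
  have : C.modCx.d p (p + 1) = ModuleCat.ofHom (C.D p) :=
    CochainComplex.of_d (fun p => ModuleCat.of k (C.W p)) (fun p => ModuleCat.ofHom (C.D p)) p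
  exact ConcreteCategory.congr_hom this w

lemma sheafCx_d (C : LcCx k X) (p : ℕ) :
    C.sheafCx.d p (p + 1) = lcMap (C.A p) (C.A (p + 1)) (C.D p) (C.D_mem p) :=
  CochainComplex.of_d (fun p => lcSheaf (C.A p)) (fun p => lcMap _ _ (C.D p) (C.D_mem p)) p

lemma modCx_d_mem (C : LcCx k X) {i j : ℕ} {x : X} {β : C.modCx.X i} (hβ : β ∈ C.A i x) :
    C.modCx.d i j β ∈ C.A j x := by
  by_cases h : i + 1 = j
  · subst h
    refine (congrArg (· ∈ C.A (i + 1) x) (C.modCx_d i β)).mpr ?_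
    exact C.D_mem i x _ hβ
  · rw [C.modCx.shape i j h]
    exact zero_mem (C.A j x)

/-- The stalks of the complex of sheaves. -/
def presentation (C : LcCx k X) : Presentation C.sheafCx C.modCx C.A where
  D_mem h := C.modCx_d_mem h
  γ p x := lcGerm (C.A p) (C.isOpen p) x
  γ_bijective p x := lcGerm_bijective (C.A p) (C.isOpen p) x
  γ_d {i j x β} hβ := by
    by_cases h : i + 1 = j
    · subst h
      rw [C.sheafCx_d]
      refine (stalkMap_lcMap (C.A i) (C.isOpen i) (C.A (i + 1)) (C.isOpen (i + 1)) (C.D i)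
        (C.D_mem i) x ⟨β, hβ⟩).trans ?_
      exact congrArg _ (Subtype.ext (C.modCx_d i β).symm)
    · have e : (⟨C.modCx.d i j β, C.modCx_d_mem hβ⟩ : C.A j x) = 0 := by
        refine Subtype.ext ?_
        exact congrArg (fun f : C.modCx.X i ⟶ C.modCx.X j => f β) (C.modCx.shape i j h)
      refine Eq.trans ?_ ((congrArg (lcGerm (C.A j) (C.isOpen j) x) e).trans (map_zero _)).symm
      exact congrArg (fun f : C.sheafCx.X i ⟶ C.sheafCx.X j => stalkMap f x
        (lcGerm (C.A i) (C.isOpen i) x ⟨β, hβ⟩)) (C.sheafCx.shape i j h) |>.trans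
          (ConcreteCategory.congr_hom ((stalkAt k x).map_zero (C.sheafCx.X i) (C.sheafCx.X j)) _)
  spread p β := ⟨⟨_, C.isOpen p β⟩, lcConst (C.A p) β _ fun _ h => h, fun _ hβ => ⟨hβ, rfl⟩⟩

lemma Hom.compat (f : C.Hom C') :
    C.presentation.Compat C'.presentation f.sheafMap f.modMap where
  mem h := f.mem _ _ _ h
  eq {p x β} hβ := stalkMap_lcMap (C.A p) (C.isOpen p) (C'.A p) (C'.isOpen p) (f.f p) (f.mem p) x
    ⟨β, hβ⟩

end LcCx

end LcComplex

end Toric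

end

noncomputable section

namespace Toric

/-! ### Extension and shift of presentations -/

section ExtendShift

open Opposite

variable {k : Type u} [CommRing k] {X : TopCat.{u}}

section Extend

variable {J J' : Type*} {c : ComplexShape J} {c' : ComplexShape J'}
  {K L : HomologicalComplex (Sh k X) c} {W W' : HomologicalComplex (ModuleCat.{u} k) c}
  {A : ∀ q, X → Submodule k (W.X q)} {A' : ∀ q, X → Submodule k (W'.X q)}

/-- The terms of an extended complex of modules. -/
abbrev optMod (W : HomologicalComplex (ModuleCat.{u} k) c) (o : Option J) : ModuleCat.{u} k :=
  HomologicalComplex.extend.X W o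

/-- The terms of an extended complex of sheaves. -/
abbrev optSh (K : HomologicalComplex (Sh k X) c) (o : Option J) : Sh k X :=
  HomologicalComplex.extend.X K o

/-- The family of submodules of the terms of an extended complex. -/
def optionA (A : ∀ q, X → Submodule k (W.X q)) :
    ∀ o : Option J, X → Submodule k (optMod W o)
  | some i => A i
  | none => fun _ => ⊤

/-- The family of subcomplexes of an extended complex. -/
def extendA (e : c.Embedding c') (A : ∀ q, X → Submodule k (W.X q)) :
    ∀ q, X → Submodule k ((W.extend e).X q) :=
  fun q => optionA A (e.r q)

lemma eq_zero_of_none (β : optMod W none) : β = 0 := by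
  have := ModuleCat.subsingleton_of_isZero (HomologicalComplex.extend.isZero_X W rfl)
  exact Subsingleton.elim _ _

lemma optionA_d_mem (h : ∀ i j x β, β ∈ A i x → W.d i j β ∈ A j x) {o o' : Option J} {x : X} {β}
    (hβ : β ∈ optionA A o x) : HomologicalComplex.extend.d W o o' β ∈ optionA A o' x := by
  cases o with
  | none => rw [eq_zero_of_none β, map_zero]; exact zero_mem _
  | some i => cases o' with
    | none => trivial
    | some j => exact h _ _ _ _ hβ

/-- The germs of an extended complex. -/
def optionγ (γ : ∀ q x, A q x →ₗ[k] (K.X q).presheaf.stalk x) : ∀ (o : Option J) (x : X),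
    optionA A o x →ₗ[k] (optSh K o).presheaf.stalk x
  | some i => γ i
  | none => fun _ => 0

lemma subsingleton_stalk_none (x : X) :
    Subsingleton ((optSh K none).presheaf.stalk x) :=
  ModuleCat.subsingleton_of_isZero ((stalkAt k x).map_isZero
    (HomologicalComplex.extend.isZero_X K rfl))

/-- The presentation of an extended complex. -/
def Presentation.extend (P : Presentation K W A) (e : c.Embedding c') :
    Presentation (K.extend e) (W.extend e) (extendA e A) where
  D_mem {i j x β} hβ :=
    optionA_d_mem (A := A) (o := e.r i) (o' := e.r j) (fun _ _ _ _ h => P.D_mem h) hβ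
  γ q x := optionγ P.γ (e.r q) x
  γ_bijective q x := by
    have key : ∀ o, Function.Bijective (optionγ P.γ o x) := by
     intro o
     cases o with
     | none =>
      have := subsingleton_stalk_none (K := K) x
      exact ⟨fun a b _ => Subtype.ext ((eq_zero_of_none a.1).trans (eq_zero_of_none b.1).symm),
        fun b => ⟨0, Subsingleton.elim _ _⟩⟩
     | some i => exact P.γ_bijective i x
    exact key (e.r q)
  γ_d {i j x β} hβ := by
    have key : ∀ (o o' : Option J) (β) (hβ : β ∈ optionA A o x),
        stalkMap (HomologicalComplex.extend.d K o o') x (optionγ P.γ o x ⟨β, hβ⟩) =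
          optionγ P.γ o' x ⟨HomologicalComplex.extend.d W o o' β,
            optionA_d_mem (A := A) (fun _ _ _ _ h => P.D_mem h) hβ⟩ := by
      intro o o' β hβ
      cases o' with
      | none =>
        have := subsingleton_stalk_none (K := K) x
        exact Subsingleton.elim _ _
      | some j => cases o with
        | none =>
          have h0 : (⟨β, hβ⟩ : optionA A none x) = 0 := Subtype.ext (eq_zero_of_none β)
          refine Eq.trans (b := 0) ?_ (Eq.symm ?_)
          · rw [h0, map_zero, map_zero]
          · refine (congrArg _ (Subtype.ext ?_)).trans (map_zero _)
            exact (congrArg _ (eq_zero_of_none β)).trans (map_zero _)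
        | some i => exact P.γ_d hβ
    exact key (e.r i) (e.r j) β hβ
  spread q := by
    change ∀ β : optMod W (e.r q), ∃ (V : Opens X)
      (s : (optSh K (e.r q)).presheaf.obj (op V)),
      ∀ x (hβ : β ∈ optionA A (e.r q) x), ∃ hx : x ∈ V,
        (optSh K (e.r q)).presheaf.germ V x hx s =
          optionγ P.γ (e.r q) x ⟨β, hβ⟩
    generalize e.r q = o
    intro β
    cases o with
    | none =>
      refine ⟨⊤, 0, fun x hβ => ⟨trivial, ?_⟩⟩
      have := subsingleton_stalk_none (K := K) x
      exact Subsingleton.elim _ _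
    | some i => exact P.spread i β

lemma Presentation.Compat.extend {P : Presentation K W A} {P' : Presentation L W' A'} {f : K ⟶ L}
    {φ : W ⟶ W'} (h : P.Compat P' f φ) (e : c.Embedding c') :
    (P.extend e).Compat (P'.extend e) (HomologicalComplex.extendMap f e)
      (HomologicalComplex.extendMap φ e) := by
  have hm : ∀ (o : Option J) (x : X) (β), β ∈ optionA A o x →
      HomologicalComplex.extend.mapX φ o β ∈ optionA A' o x := by
    intro o x β hβ
    cases o with
    | none => trivial
    | some i => exact h.mem hβ
  refine ⟨fun {q x β} hβ => hm (e.r q) x β hβ, fun {q x β} hβ => ?_⟩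
  have key : ∀ (o : Option J) (β) (hβ : β ∈ optionA A o x),
      stalkMap (HomologicalComplex.extend.mapX f o) x (optionγ P.γ o x ⟨β, hβ⟩) =
        optionγ P'.γ o x ⟨HomologicalComplex.extend.mapX φ o β, hm o x β hβ⟩ := by
    intro o β hβ
    cases o with
    | none =>
      have := subsingleton_stalk_none (K := L) x
      exact Subsingleton.elim _ _
    | some i => exact h.eq hβ
  exact key (e.r q) β hβ

lemma QuasiAt.extend_embeddingUpNat {W W' : CochainComplex (ModuleCat.{u} k) ℕ}
    {A : ∀ q, X → Submodule k (W.X q)} {A' : ∀ q, X → Submodule k (W'.X q)} {φ : W ⟶ W'} {x : X}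
    (h : QuasiAt A A' φ x)
    (h0 : ∀ β ∈ A 0 x, W.d 0 1 β = 0 → φ.f 0 β = 0 → β = 0)
    (h0' : ∀ β ∈ A' 0 x, W'.d 0 1 β = 0 → ∃ δ ∈ A 0 x, W.d 0 1 δ = 0 ∧ β = φ.f 0 δ) :
    QuasiAt (extendA ComplexShape.embeddingUpNat A) (extendA ComplexShape.embeddingUpNat A')
      (HomologicalComplex.extendMap φ ComplexShape.embeddingUpNat) x := by
  have r1 : ∀ p : ℕ, ComplexShape.embeddingUpNat.r (p : ℤ) = some p :=
    fun p => ComplexShape.embeddingUpNat.r_eq_some rfl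
  have r2 : ∀ q : ℤ, q < 0 → ComplexShape.embeddingUpNat.r q = none :=
    fun q hq => ComplexShape.embeddingUpNat.r_eq_none q fun i hi => by
      have : (i : ℤ) = q := hi
      lia
  have hr : ∀ i j l : ℤ, (ComplexShape.up ℤ).Rel i j → (ComplexShape.up ℤ).Rel j l →
      ComplexShape.embeddingUpNat.r j = none ∨
      (ComplexShape.embeddingUpNat.r i = none ∧ ComplexShape.embeddingUpNat.r j = some 0 ∧
        ComplexShape.embeddingUpNat.r l = some 1) ∨
      ∃ p : ℕ, ComplexShape.embeddingUpNat.r i = some p ∧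
        ComplexShape.embeddingUpNat.r j = some (p + 1) ∧
        ComplexShape.embeddingUpNat.r l = some (p + 1 + 1) := by
    rintro i _ _ rfl rfl
    rcases lt_or_ge (i + 1) 0 with hi | hi
    · exact .inl (r2 _ hi)
    · rcases eq_or_lt_of_le hi with hi | hi
      · obtain rfl : i = -1 := by lia
        exact .inr (.inl ⟨r2 _ (by simp), r1 0, r1 1⟩)
      · obtain ⟨p, rfl⟩ := Int.eq_ofNat_of_zero_le (a := i) (by lia)
        exact .inr (.inr ⟨p, r1 p, by exact_mod_cast r1 (p + 1), by exact_mod_cast r1 (p + 1 + 1)⟩)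
  constructor
  · intro i j l hij hjl
    have key : ∀ o o' o'' : Option ℕ, (o' = none ∨ (o = none ∧ o' = some 0 ∧ o'' = some 1) ∨
        ∃ p : ℕ, o = some p ∧ o' = some (p + 1) ∧ o'' = some (p + 1 + 1)) →
        ∀ β ∈ optionA A o' x, HomologicalComplex.extend.d W o' o'' β = 0 → ∀ γ ∈ optionA A' o x,
        HomologicalComplex.extend.mapX φ o' β = HomologicalComplex.extend.d W' o o' γ →
        ∃ δ ∈ optionA A o x, β = HomologicalComplex.extend.d W o o' δ := by
      rintro o o' o'' (rfl | ⟨rfl, rfl, rfl⟩ | ⟨p, rfl, rfl, rfl⟩) β hβ hD γ hγ hφ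
      · exact ⟨0, zero_mem _, (eq_zero_of_none β).trans (map_zero _).symm⟩
      · refine ⟨0, zero_mem _, ?_⟩
        rw [map_zero]
        refine h0 β hβ hD (hφ.trans ?_)
        exact (congrArg _ (eq_zero_of_none γ)).trans (map_zero _)
      · exact h.inj p (p + 1) (p + 1 + 1) rfl rfl β hβ hD γ hγ hφ
    exact key _ _ _ (hr i j l hij hjl)
  · intro i j l hij hjl
    have key : ∀ o o' o'' : Option ℕ, (o' = none ∨ (o = none ∧ o' = some 0 ∧ o'' = some 1) ∨
        ∃ p : ℕ, o = some p ∧ o' = some (p + 1) ∧ o'' = some (p + 1 + 1)) →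
        ∀ β ∈ optionA A' o' x, HomologicalComplex.extend.d W' o' o'' β = 0 → ∃ δ ∈ optionA A o' x,
        HomologicalComplex.extend.d W o' o'' δ = 0 ∧ ∃ γ ∈ optionA A' o x,
        β = HomologicalComplex.extend.mapX φ o' δ + HomologicalComplex.extend.d W' o o' γ := by
      rintro o o' o'' (rfl | ⟨rfl, rfl, rfl⟩ | ⟨p, rfl, rfl, rfl⟩) β hβ hD
      · exact ⟨0, zero_mem _, map_zero _, 0, zero_mem _, by
          rw [map_zero, map_zero, add_zero]; exact eq_zero_of_none β⟩
      · obtain ⟨δ, hδ, hδ0, rfl⟩ := h0' β hβ hD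
        exact ⟨δ, hδ, hδ0, 0, zero_mem _, by rw [map_zero, add_zero]; rfl⟩
      · exact h.surj p (p + 1) (p + 1 + 1) rfl rfl β hβ hD
    exact key _ _ _ (hr i j l hij hjl)

end Extend

section Shift

variable {K L : CochainComplex (Sh k X) ℤ} {W W' : CochainComplex (ModuleCat.{u} k) ℤ}
  {A : ∀ q, X → Submodule k (W.X q)} {A' : ∀ q, X → Submodule k (W'.X q)}

/-- The family of subcomplexes of a shifted complex. -/
def shiftA (n : ℤ) (A : ∀ q, X → Submodule k (W.X q)) :
    ∀ q, X → Submodule k (((shiftFunctor (CochainComplex (ModuleCat.{u} k) ℤ) n).obj W).X q) :=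
  fun q => A (q + n)

lemma shift_d_apply (n i j : ℤ) (β : W.X (i + n)) :
    ((shiftFunctor (CochainComplex (ModuleCat.{u} k) ℤ) n).obj W).d i j β =
      (n.negOnePow : ℤ) • W.d (i + n) (j + n) β :=
  rfl

lemma stalkMap_shift_d (n i j : ℤ) (x : X) (s : (K.X (i + n)).presheaf.stalk x) :
    stalkMap (((shiftFunctor (CochainComplex (Sh k X) ℤ) n).obj K).d i j) x s =
      (n.negOnePow : ℤ) • stalkMap (K.d (i + n) (j + n)) x s := by
  have : (stalkAt k x).map (((n.negOnePow : ℤ) • K.d (i + n) (j + n))) =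
      (n.negOnePow : ℤ) • (stalkAt k x).map (K.d (i + n) (j + n)) := (stalkAt k x).map_zsmul
  exact ConcreteCategory.congr_hom this s

/-- The presentation of a shifted complex. -/
def Presentation.shift (P : Presentation K W A) (n : ℤ) :
    Presentation ((shiftFunctor (CochainComplex (Sh k X) ℤ) n).obj K)
      ((shiftFunctor (CochainComplex (ModuleCat.{u} k) ℤ) n).obj W) (shiftA n A) where
  D_mem {i j x β} hβ := zsmul_mem (P.D_mem (j := j + n) hβ) _
  γ q x := P.γ (q + n) x
  γ_bijective q x := P.γ_bijective (q + n) x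
  γ_d {i j x β} hβ := by
    refine (stalkMap_shift_d n i j x _).trans ?_
    refine (congrArg ((n.negOnePow : ℤ) • ·) (P.γ_d hβ)).trans ?_
    exact (map_zsmul (P.γ (j + n) x) _ _).symm
  spread q β := P.spread (q + n) β

lemma Presentation.Compat.shift {P : Presentation K W A} {P' : Presentation L W' A'} {f : K ⟶ L}
    {φ : W ⟶ W'} (h : P.Compat P' f φ) (n : ℤ) :
    (P.shift n).Compat (P'.shift n) ((shiftFunctor (CochainComplex (Sh k X) ℤ) n).map f)
      ((shiftFunctor (CochainComplex (ModuleCat.{u} k) ℤ) n).map φ) :=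
  ⟨fun hβ => h.mem hβ, fun hβ => h.eq hβ⟩

lemma negOnePow_smul_smul {M : Type*} [AddCommGroup M] (n : ℤ) (m : M) :
    (n.negOnePow : ℤ) • (n.negOnePow : ℤ) • m = m := by
  rw [smul_smul, ← Units.val_mul, Int.units_mul_self, Units.val_one, one_smul]

lemma QuasiAt.shift {φ : W ⟶ W'} {x : X} (h : QuasiAt A A' φ x) (n : ℤ) :
    QuasiAt (shiftA n A) (shiftA n A')
      ((shiftFunctor (CochainComplex (ModuleCat.{u} k) ℤ) n).map φ) x := by
  have hrel : ∀ {i j : ℤ}, (ComplexShape.up ℤ).Rel i j → (ComplexShape.up ℤ).Rel (i + n) (j + n) := by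
    rintro i _ rfl
    change i + n + 1 = i + 1 + n
    lia
  have hz : ∀ {M : Type u} [AddCommGroup M] {m : M}, (n.negOnePow : ℤ) • m = 0 → m = 0 := by
    intro M _ m hm
    rw [← negOnePow_smul_smul n m, hm, smul_zero]
  constructor
  · intro i j l hij hjl β hβ hD γ hγ hφ
    obtain ⟨δ, hδ, hδβ⟩ := h.inj (i + n) (j + n) (l + n) (hrel hij) (hrel hjl) β hβ
      (hz ((shift_d_apply n j l β).symm.trans hD)) ((n.negOnePow : ℤ) • γ) (zsmul_mem hγ _)
      (hφ.trans (map_zsmul _ _ _).symm)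
    refine ⟨(n.negOnePow : ℤ) • δ, zsmul_mem hδ _, ?_⟩
    refine Eq.trans ?_ (shift_d_apply n i j _).symm
    rw [map_zsmul, negOnePow_smul_smul]
    exact hδβ
  · intro i j l hij hjl β hβ hD
    obtain ⟨δ, hδ, hδ0, γ, hγ, hβγ⟩ := h.surj (i + n) (j + n) (l + n) (hrel hij) (hrel hjl) β hβ
      (hz ((shift_d_apply n j l β).symm.trans hD))
    refine ⟨δ, hδ, ?_, (n.negOnePow : ℤ) • γ, zsmul_mem hγ _, hβγ.trans (congrArg _ ?_)⟩
    · exact (shift_d_apply n j l δ).trans ((congrArg _ hδ0).trans (zsmul_zero _))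
    · refine Eq.trans ?_ (shift_d_apply n i j _).symm
      rw [map_zsmul, negOnePow_smul_smul]

end Shift

end ExtendShift

end Toric

end

noncomputable section

namespace Toric

/-! ### Criteria for isomorphisms on compactly supported cohomology -/

section Criteria

open DerivedCategory.Plus (Q)

section Shape

variable {k : Type u} [CommRing k] {V : Type u} [NormedAddCommGroup V] [NormedSpace ℝ V]

/-- The subcomplexes `A ⊆ A'` differ only in terms on which `A` and `A'` decrease along the segments
from `p`, and they agree at `p`. -/
structure RadialStep {J : Type*} {c : ComplexShape J} {W : HomologicalComplex (ModuleCat.{u} k) c}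
    (A A' : ∀ q, TopCat.of V → Submodule k (W.X q)) (U : Set V) (p : V) : Prop where
  le : ∀ q x, A q x ≤ A' q x
  isOpen : ∀ q β, IsOpen {x : V | β ∈ A' q x}
  d_mem : ∀ i j, ∀ x ∈ U, ∀ β ∈ A' i x, W.d i j β ∈ A j x
  ext : ∀ q, ∀ y ∈ U, ∀ β ∈ A' q y, ∃ γ, β - γ ∈ A q y ∧ ∀ v ∈ segment ℝ p y, γ ∈ A' q v
  dec : ∀ q, ∀ y ∈ U, ∀ x ∈ segment ℝ p y, ∀ β ∈ A' q x, β ∈ A q y → β ∈ A q x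
  center : ∀ q, A' q p ≤ A q p

lemma RadialStep.extend {J J' : Type*} {c : ComplexShape J} {c' : ComplexShape J'}
    {W : HomologicalComplex (ModuleCat.{u} k) c} {A A' : ∀ q, TopCat.of V → Submodule k (W.X q)}
    {U : Set V} {p : V} (h : RadialStep A A' U p) (e : c.Embedding c') :
    RadialStep (extendA e A) (extendA e A') U p := by
  refine ⟨fun q => ?_, fun q => ?_, fun i j => ?_, fun q => ?_, fun q => ?_, fun q => ?_⟩
  · have key : ∀ (o : Option J) (x), optionA A o x ≤ optionA A' o x
      | none => fun x => le_top
      | some i => h.le i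
    exact key (e.r q)
  · have key : ∀ (o : Option J) (β), IsOpen {x : V | β ∈ optionA A' o x}
      | none => fun β => isOpen_univ
      | some i => h.isOpen i
    exact key (e.r q)
  · have key : ∀ (o o' : Option J), ∀ x ∈ U, ∀ β ∈ optionA A' o x,
        HomologicalComplex.extend.d W o o' β ∈ optionA A o' x
      | _, none => fun x _ β _ => trivial
      | none, some j => fun x _ β _ => by
        rw [eq_zero_of_none β, map_zero]
        exact zero_mem _
      | some i, some j => h.d_mem i j
    exact key (e.r i) (e.r j)
  · have key : ∀ (o : Option J), ∀ y ∈ U, ∀ β ∈ optionA A' o y, ∃ γ, β - γ ∈ optionA A o y ∧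
        ∀ v ∈ segment ℝ p y, γ ∈ optionA A' o v
      | none => fun y _ β _ => ⟨β, trivial, fun _ _ => trivial⟩
      | some i => h.ext i
    exact key (e.r q)
  · have key : ∀ (o : Option J), ∀ y ∈ U, ∀ x ∈ segment ℝ p y, ∀ β ∈ optionA A' o x,
        β ∈ optionA A o y → β ∈ optionA A o x
      | none => fun _ _ _ _ _ _ _ => trivial
      | some i => h.dec i
    exact key (e.r q)
  · have key : ∀ (o : Option J), optionA A' o p ≤ optionA A o p
      | none => fun _ _ => trivial
      | some i => h.center i
    exact key (e.r q)

lemma RadialStep.shift {W : CochainComplex (ModuleCat.{u} k) ℤ}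
    {A A' : ∀ q, TopCat.of V → Submodule k (W.X q)} {U : Set V} {p : V} (h : RadialStep A A' U p)
    (n : ℤ) : RadialStep (shiftA n A) (shiftA n A') U p :=
  ⟨fun _ => h.le _, fun _ => h.isOpen _, fun i j x hx β hβ =>
    zsmul_mem (h.d_mem (i + n) (j + n) x hx β hβ) _, fun _ => h.ext _, fun _ => h.dec _,
    fun _ => h.center _⟩

lemma RadialStep.coneAcyclic [ProperSpace V] {W : CochainComplex (ModuleCat.{u} k) ℤ}
    {A A' : ∀ q, TopCat.of V → Submodule k (W.X q)} {U : Opens (TopCat.of V)} {p : V}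
    (h : RadialStep A A' (U : Set V) p) (hp : p ∈ U) (hU : StarConvex ℝ p (U : Set V))
    {K L I J : CochainComplex (Sh k (TopCat.of V)) ℤ} {P : Presentation K W A}
    {P' : Presentation L W A'} {f : K ⟶ L} {φ : W ⟶ W} (hφ : φ = 𝟙 W) (hf : P.Compat P' f φ)
    (hI : IsFlasqueCx I) (hJ : IsFlasqueCx J) {w : K ⟶ I} {w' : L ⟶ J}
    [QuasiIso w] [QuasiIso w'] {g : I ⟶ J} (hg : f ≫ w' = w ≫ g) :
    FlabbyCx.ConeAcyclic (flabbyHom hI hJ g) (U : Set V) := by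
  subst hφ
  have hr : (FlabbyCx.cone (flabbyHom hI hJ g)).IsRadial (U : Set V) p :=
    FlabbyCx.isRadial_cone (RI := P.rep hI w) (RJ := P'.rep hJ w') h.le
      (fun q x β hβ => hf.germ_eq hI hJ hg hβ) hU
      (fun q x β hβ => (h.isOpen q β).mem_nhds hβ)
      (fun q x hx β hβ => h.d_mem q (q + 1) x hx β hβ) h.ext h.dec h.center
  intro q s hs hds
  exact hr.exists_eq_d U.isOpen hp hU hs hds

end Shape

section PlusShift

variable (k : Type u) [CommRing k] (X : TopCat.{u})

/-- A complex in nonnegative degrees, shifted by `n` to the left. -/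
def plusShift (n : ℕ) : CochainComplex (Sh k X) ℕ ⥤ CochainComplex.Plus (Sh k X) :=
  ObjectProperty.lift _
    (ComplexShape.embeddingUpNat.extendFunctor _ ⋙
      shiftFunctor (CochainComplex (Sh k X) ℤ) (n : ℤ))
    (fun K => ⟨-(n : ℤ), CochainComplex.isStrictlyGE_shift
      (K.extend ComplexShape.embeddingUpNat) 0 _ _ (by simp)⟩)

variable {k X} in
/-- The complex underlying `plusShift`. -/
abbrev plusObj (n : ℕ) (K : CochainComplex (Sh k X) ℕ) : CochainComplex (Sh k X) ℤ :=
  (shiftFunctor (CochainComplex (Sh k X) ℤ) (n : ℤ)).obj (K.extend ComplexShape.embeddingUpNat)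

end PlusShift

variable {k : Type u} [CommRing k] {X : TopCat.{u}} [T2Space X] (n : ℕ) (U : Opens X)
  {K L : CochainComplex (Sh k X) ℕ} {W W' : CochainComplex (ModuleCat.{u} k) ℕ}
  {A : ∀ q, X → Submodule k (W.X q)} {A' : ∀ q, X → Submodule k (W'.X q)}

/-- The presentation of a complex of sheaves that is placed in degrees at least `-n`. -/
def Presentation.plusShift (P : Presentation K W A) :=
  (P.extend ComplexShape.embeddingUpNat).shift (n : ℤ)

/-- The conditions for the map of subcomplexes at `x` induced by `φ` to be a quasi-isomorphism. -/
structure QuasiAtNat (A : ∀ q, X → Submodule k (W.X q)) (A' : ∀ q, X → Submodule k (W'.X q))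
    (φ : W ⟶ W') (x : X) : Prop extends QuasiAt A A' φ x where
  inj_zero : ∀ β ∈ A 0 x, W.d 0 1 β = 0 → φ.f 0 β = 0 → β = 0
  surj_zero : ∀ β ∈ A' 0 x, W'.d 0 1 β = 0 → ∃ δ ∈ A 0 x, W.d 0 1 δ = 0 ∧ β = φ.f 0 δ

variable [HasDerivedCategory.{w₁} (Sh k X)] [HasDerivedCategory.{w₂} (ModuleCat.{u} k)]

lemma isIso_of_quasiAt [LocallyCompactSpace X] [NormalSpace X] {P : Presentation K W A}
    {P' : Presentation L W' A'} {f : K ⟶ L} {φ : W ⟶ W'} (h : P.Compat P' f φ)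
    (hx : ∀ x ∈ U, QuasiAtNat A A' φ x) :
    IsIso ((gammaC (k := k) U).rightDerivedFunctorPlus.map (Q.map ((plusShift k X n).map f))) := by
  refine isIso_rightDerived_map U _ fun I J hI hJ (w : plusObj n K ⟶ I)
    (w' : plusObj n L ⟶ J) g (hw : QuasiIso w) (hw' : QuasiIso w') hg => ?_
  refine coneAcyclic_of_exactAt _ U.isOpen fun x hxU => ?_
  exact ((h.extend ComplexShape.embeddingUpNat).shift (n : ℤ)).exactAt_cone hI hJ hg
    (((hx x hxU).toQuasiAt.extend_embeddingUpNat (hx x hxU).inj_zero (hx x hxU).surj_zero).shift n)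

lemma isIso_rightDerivedExt_of_eq_bot [LocallyCompactSpace X] [NormalSpace X]
    (P : Presentation K W A) (h : ∀ x ∉ U, ∀ q, A q x = ⊥) :
    IsIso ((rightDerivedExt (k := k) (le_top : U ≤ ⊤)).app (Q.obj ((plusShift k X n).obj K))) := by
  refine isIso_rightDerivedExt U _ fun I hI (w : plusObj n K ⟶ I) (hw : QuasiIso w) x
    hx => ?_
  refine (P.plusShift n).exactAt_of_eq_bot hI w fun q => ?_
  have key : ∀ o : Option ℕ, optionA A o x = ⊥
    | none => (Submodule.eq_bot_iff _).2 fun β _ => eq_zero_of_none β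
    | some i => h x hx i
  exact key _

end Criteria

section RadialCriterion

open DerivedCategory.Plus (Q)

variable {k : Type u} [CommRing k] {V : Type u} [NormedAddCommGroup V] [NormedSpace ℝ V]
  [ProperSpace V] (n : ℕ) (U : Opens (TopCat.of V))
  {K L : CochainComplex (Sh k (TopCat.of V)) ℕ} {W : CochainComplex (ModuleCat.{u} k) ℕ}
  {A A' : ∀ q, TopCat.of V → Submodule k (W.X q)}
  [HasDerivedCategory.{w₁} (Sh k (TopCat.of V))] [HasDerivedCategory.{w₂} (ModuleCat.{u} k)]

lemma isIso_of_radialStep {P : Presentation K W A} {P' : Presentation L W A'} {f : K ⟶ L}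
    (h : P.Compat P' f (𝟙 W)) {p : V} (hr : RadialStep A A' (U : Set V) p) (hp : p ∈ U)
    (hU : StarConvex ℝ p (U : Set V)) :
    IsIso ((gammaC (k := k) U).rightDerivedFunctorPlus.map
      (Q.map ((plusShift k (TopCat.of V) n).map f))) := by
  refine isIso_rightDerived_map U _ fun I J hI hJ (w : plusObj n K ⟶ I)
    (w' : plusObj n L ⟶ J) g (hw : QuasiIso w) (hw' : QuasiIso w') hg => ?_
  refine ((hr.extend ComplexShape.embeddingUpNat).shift (n : ℤ)).coneAcyclic hp hU ?_
    ((h.extend ComplexShape.embeddingUpNat).shift (n : ℤ)) hI hJ hg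
  rw [HomologicalComplex.extendMap_id]
  exact CategoryTheory.Functor.map_id _ _

end RadialCriterion

end Toric

end

noncomputable section

namespace Toric

/-! ### Čech complexes of families of submodules -/

section Cech

/-- A family of submodules of `Q`, depending on the simplices of `S` and on a point of `X`, that
increases with the simplex and can only increase locally. -/
structure CechFam (k : Type u) [CommRing k] (S Q : Type u) [AddCommGroup Q] [Module k Q]
    (X : TopCat.{u}) where
  F : ∀ {p : ℕ}, (Fin (p + 1) → S) → X → Submodule k Q
  mono : ∀ {p : ℕ} (I : Fin (p + 2) → S) (i : Fin (p + 2)) (x : X), F (I ∘ i.succAbove) x ≤ F I x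
  isOpen : ∀ {p : ℕ} (I : Fin (p + 1) → S) (w : Q), IsOpen {x | w ∈ F I x}

variable {k : Type u} [CommRing k] {S S' S'' Q Q' Q'' : Type u} [AddCommGroup Q] [Module k Q]
  [AddCommGroup Q'] [Module k Q'] [AddCommGroup Q''] [Module k Q''] {X : TopCat.{u}}

namespace CechFam

/-- The alternating cochains with values in the family at `x`. -/
def stalk (𝓕 : CechFam k S Q X) (p : ℕ) (x : X) : Submodule k (altCochains k S Q p) where
  carrier := {c | ∀ I, c.1 I ∈ 𝓕.F I x}
  zero_mem' _ := zero_mem _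
  add_mem' ha hb I := add_mem (ha I) (hb I)
  smul_mem' r _ ha I := Submodule.smul_mem _ r (ha I)

lemma altD_mem_stalk (𝓕 : CechFam k S Q X) (p : ℕ) (x : X) (c : altCochains k S Q p)
    (hc : c ∈ 𝓕.stalk p x) : altD k S Q p c ∈ 𝓕.stalk (p + 1) x := by
  intro I
  change ∑ i : Fin (p + 2), (-1 : ℤ) ^ (i : ℕ) • c.1 (I ∘ i.succAbove) ∈ _
  exact sum_mem fun i _ => zsmul_mem (𝓕.mono I i x (hc _)) _

/-- The family of Čech complexes. -/
def lc [Finite S] (𝓕 : CechFam k S Q X) : LcCx k X where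
  W p := altCochains k S Q p
  D p := altD k S Q p
  D_D p c := altD_altD p c
  A := 𝓕.stalk
  D_mem := 𝓕.altD_mem_stalk
  isOpen p c := by
    have : {x | c ∈ 𝓕.stalk p x} = ⋂ I, {x | c.1 I ∈ 𝓕.F I x} := by
      ext x
      rw [Set.mem_iInter]
      rfl
    rw [this]
    exact isOpen_iInter_of_finite fun I => 𝓕.isOpen I _

end CechFam

/-- The map on cochains induced by a map of index sets and a linear map of coefficients. -/
def altPull (f : S' → S) (g : Q →ₗ[k] Q') (p : ℕ) :
    altCochains k S Q p →ₗ[k] altCochains k S' Q' p where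
  toFun c := ⟨fun I => g (c.1 (f ∘ I)), fun I π => by
      dsimp only
      rw [← Function.comp_assoc, c.2.1 (f ∘ I) π, map_zsmul], fun I hI => by
      dsimp only
      rw [c.2.2 (f ∘ I) fun h => hI h.of_comp, map_zero]⟩
  map_add' a b := by ext I; simp
  map_smul' r a := by ext I; simp

lemma altPull_altD (f : S' → S) (g : Q →ₗ[k] Q') (p : ℕ) (c : altCochains k S Q p) :
    altPull f g (p + 1) (altD k S Q p c) = altD k S' Q' p (altPull f g p c) := by
  ext I
  simp [altPull, altD, cechD, Function.comp_assoc]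

namespace CechFam

/-- The constant family. -/
def const (k : Type u) [CommRing k] (S Q : Type u) [AddCommGroup Q] [Module k Q] (X : TopCat.{u}) :
    CechFam k S Q X where
  F _ _ := ⊤
  mono _ _ _ := le_rfl
  isOpen _ _ := by simp

/-- The family equal to `𝓕'` on the simplices whose set of vertices is in `𝒯`, to `𝓕` otherwise. -/
def mix (𝓕 𝓕' : CechFam k S Q X) (hle : ∀ {p : ℕ} (I : Fin (p + 1) → S) x, 𝓕.F I x ≤ 𝓕'.F I x)
    (𝒯 : Set (Set S)) (h𝒯 : ∀ T ∈ 𝒯, ∀ T', T ⊆ T' → T' ∈ 𝒯) : CechFam k S Q X where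
  F I x := by
    classical exact if Set.range I ∈ 𝒯 then 𝓕'.F I x else 𝓕.F I x
  mono I i x := by
    have hr : Set.range (I ∘ i.succAbove) ⊆ Set.range I := Set.range_comp_subset_range _ _
    split_ifs with h1 h2 h2
    · exact 𝓕'.mono I i x
    · exact absurd (h𝒯 _ h1 _ hr) h2
    · exact (𝓕.mono I i x).trans (hle I x)
    · exact 𝓕.mono I i x
  isOpen I w := by
    split_ifs
    · exact 𝓕'.isOpen I w
    · exact 𝓕.isOpen I w

section Mix

variable {𝓕 𝓕' : CechFam k S Q X} {hle : ∀ {p : ℕ} (I : Fin (p + 1) → S) x, 𝓕.F I x ≤ 𝓕'.F I x}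
  {𝒯 𝒯' : Set (Set S)} {h𝒯 : ∀ T ∈ 𝒯, ∀ T', T ⊆ T' → T' ∈ 𝒯}
  {h𝒯' : ∀ T ∈ 𝒯', ∀ T', T ⊆ T' → T' ∈ 𝒯'} {p : ℕ} {I : Fin (p + 1) → S} {x : X}

lemma mix_of_mem (hI : Set.range I ∈ 𝒯) : (mix 𝓕 𝓕' hle 𝒯 h𝒯).F I x = 𝓕'.F I x :=
  if_pos hI

lemma mix_of_notMem (hI : Set.range I ∉ 𝒯) : (mix 𝓕 𝓕' hle 𝒯 h𝒯).F I x = 𝓕.F I x :=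
  if_neg hI

lemma le_mix : 𝓕.F I x ≤ (mix 𝓕 𝓕' hle 𝒯 h𝒯).F I x := by
  by_cases h : Set.range I ∈ 𝒯
  · rw [mix_of_mem h]
    exact hle I x
  · rw [mix_of_notMem h]

lemma mix_le : (mix 𝓕 𝓕' hle 𝒯 h𝒯).F I x ≤ 𝓕'.F I x := by
  by_cases h : Set.range I ∈ 𝒯
  · rw [mix_of_mem h]
  · rw [mix_of_notMem h]
    exact hle I x

lemma mix_mono (h : 𝒯 ⊆ 𝒯') : (mix 𝓕 𝓕' hle 𝒯 h𝒯).F I x ≤ (mix 𝓕 𝓕' hle 𝒯' h𝒯').F I x := by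
  by_cases hI : Set.range I ∈ 𝒯
  · rw [mix_of_mem hI, mix_of_mem (h hI)]
  · rw [mix_of_notMem hI]
    exact le_mix

end Mix

/-- The part of a cochain on the simplices whose set of vertices is `T`. -/
def part (T : Set S) {p : ℕ} (c : altCochains k S Q p) : altCochains k S Q p :=
  ⟨fun I => by classical exact if Set.range I = T then c.1 I else 0, fun I π => by
    dsimp only
    rw [EquivLike.range_comp I π]
    split_ifs
    · exact c.2.1 I π
    · rw [smul_zero], fun I hI => by
    dsimp only
    rw [c.2.2 I hI, ite_self]⟩

lemma part_of_eq {T : Set S} {p : ℕ} {c : altCochains k S Q p} {I : Fin (p + 1) → S}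
    (h : Set.range I = T) : (part T c).1 I = c.1 I :=
  if_pos h

lemma part_of_ne {T : Set S} {p : ℕ} {c : altCochains k S Q p} {I : Fin (p + 1) → S}
    (h : Set.range I ≠ T) : (part T c).1 I = 0 :=
  if_neg h

variable [Finite S] [Finite S'] [Finite S'']

/-- The morphism of Čech complexes induced by a map of index sets and a linear map of
coefficients. -/
def pull (𝓕 : CechFam k S Q X) (𝓕' : CechFam k S' Q' X) (f : S' → S) (g : Q →ₗ[k] Q')
    (h : ∀ {p : ℕ} (I : Fin (p + 1) → S') (x : X), ∀ w ∈ 𝓕.F (f ∘ I) x, g w ∈ 𝓕'.F I x) :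
    𝓕.lc.Hom 𝓕'.lc where
  f := altPull f g
  comm := altPull_altD f g
  mem _ x _ hc I := h I x _ (hc (f ∘ I))

lemma pull_comp (𝓕 : CechFam k S Q X) (𝓕' : CechFam k S' Q' X) (𝓕'' : CechFam k S'' Q'' X)
    (f : S' → S) (g : Q →ₗ[k] Q') (f' : S'' → S') (g' : Q' →ₗ[k] Q'') (h h' h'') :
    (𝓕.pull 𝓕' f g h).sheafMap ≫ (𝓕'.pull 𝓕'' f' g' h').sheafMap =
      (𝓕.pull 𝓕'' (f ∘ f') (g' ∘ₗ g) h'').sheafMap := by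
  ext p : 1
  rfl

lemma pull_id (𝓕 : CechFam k S Q X) (h) : (𝓕.pull 𝓕 id LinearMap.id h).sheafMap = 𝟙 _ := by
  ext p : 1
  rfl

lemma isIso_pull (𝓕 𝓕' : CechFam k S Q X)
    (he : ∀ {p : ℕ} (I : Fin (p + 1) → S) (x : X), 𝓕.F I x = 𝓕'.F I x) (h) :
    IsIso (𝓕.pull 𝓕' id LinearMap.id h).sheafMap := by
  have h' : ∀ {p : ℕ} (I : Fin (p + 1) → S) (x : X), ∀ w ∈ 𝓕'.F (id ∘ I) x,
      (LinearMap.id : Q →ₗ[k] Q) w ∈ 𝓕.F I x := fun I x w hw => (he I x).symm ▸ hw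
  refine ⟨(𝓕'.pull 𝓕 id LinearMap.id h').sheafMap, ?_, ?_⟩
  · exact (pull_comp 𝓕 𝓕' 𝓕 id LinearMap.id id LinearMap.id _ _ (fun _ _ _ hw => hw)).trans (pull_id _ _)
  · exact (pull_comp 𝓕' 𝓕 𝓕' id LinearMap.id id LinearMap.id _ _ (fun _ _ _ hw => hw)).trans (pull_id _ _)

end CechFam

section Radial

variable {V : Type u} [NormedAddCommGroup V] [NormedSpace ℝ V] [Finite S]

/-- The condition on two families under which changing the terms at `T` does not change the
cohomology with compact supports in `U`. -/
def IsRadialPair (𝓕 𝓕' : CechFam k S Q (TopCat.of V)) (U : Set V) (T : Set S) (p : V) : Prop :=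
  ∀ {n : ℕ} (I : Fin (n + 1) → S), Set.range I = T →
    (∀ y ∈ U, ∀ x ∈ segment ℝ p y, 𝓕.F I y ≤ 𝓕.F I x) ∧
    (∀ y ∈ U, ∀ x ∈ segment ℝ p y, 𝓕'.F I y ≤ 𝓕'.F I x) ∧ 𝓕'.F I p ≤ 𝓕.F I p

open CechFam in
lemma IsRadialPair.radialStep {𝓕 𝓕' : CechFam k S Q (TopCat.of V)}
    {hle : ∀ {p : ℕ} (I : Fin (p + 1) → S) x, 𝓕.F I x ≤ 𝓕'.F I x} {U : Set V} {T : Set S} {p : V}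
    (h : IsRadialPair 𝓕 𝓕' U T p) {𝒯 : Set (Set S)} (h𝒯 : ∀ T ∈ 𝒯, ∀ T', T ⊆ T' → T' ∈ 𝒯)
    (h𝒯' : ∀ T' ∈ 𝒯 \ {T}, ∀ T'', T' ⊆ T'' → T'' ∈ 𝒯 \ {T}) :
    RadialStep (W := 𝓕.lc.modCx) (mix 𝓕 𝓕' hle (𝒯 \ {T}) h𝒯').stalk (mix 𝓕 𝓕' hle 𝒯 h𝒯).stalk
      U p := by
  have heq : ∀ {n : ℕ} {I : Fin (n + 1) → S} {x : TopCat.of V}, Set.range I ≠ T →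
      (mix 𝓕 𝓕' hle (𝒯 \ {T}) h𝒯').F I x = (mix 𝓕 𝓕' hle 𝒯 h𝒯).F I x := by
    intro n I x hI
    by_cases hI' : Set.range I ∈ 𝒯
    · rw [mix_of_mem hI', mix_of_mem (𝒯 := 𝒯 \ {T}) ⟨hI', hI⟩]
    · rw [mix_of_notMem hI', mix_of_notMem fun h => hI' h.1]
  have hT : ∀ {n : ℕ} {I : Fin (n + 1) → S} {x : TopCat.of V}, Set.range I = T →
      (mix 𝓕 𝓕' hle (𝒯 \ {T}) h𝒯').F I x = 𝓕.F I x :=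
    fun hI => mix_of_notMem fun h => h.2 hI
  have hdec : ∀ {n : ℕ} {I : Fin (n + 1) → S}, Set.range I = T → ∀ y ∈ U, ∀ x ∈ segment ℝ p y,
      (mix 𝓕 𝓕' hle 𝒯 h𝒯).F I y ≤ (mix 𝓕 𝓕' hle 𝒯 h𝒯).F I x := by
    intro n I hI y hy x hx
    by_cases hI' : Set.range I ∈ 𝒯
    · rw [mix_of_mem hI', mix_of_mem hI']
      exact (h I hI).2.1 y hy x hx
    · rw [mix_of_notMem hI', mix_of_notMem hI']
      exact (h I hI).1 y hy x hx
  have hd : ∀ (q : ℕ) (x : TopCat.of V), x ∈ U → ∀ c ∈ (mix 𝓕 𝓕' hle 𝒯 h𝒯).stalk q x,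
      altD k S Q q c ∈ (mix 𝓕 𝓕' hle (𝒯 \ {T}) h𝒯').stalk (q + 1) x := by
    intro q x hx c hc I
    by_cases hI : Set.range I = T
    swap
    · rw [heq hI]
      exact altD_mem_stalk (mix 𝓕 𝓕' hle 𝒯 h𝒯) q x c hc I
    by_cases hinj : Function.Injective I
    swap
    · rw [(altD k S Q q c).2.2 I hinj]
      exact zero_mem _
    change ∑ i : Fin (q + 2), (-1 : ℤ) ^ (i : ℕ) • c.1 (I ∘ i.succAbove) ∈ _
    refine sum_mem fun i _ => zsmul_mem ?_ _
    refine CechFam.mono (mix 𝓕 𝓕' hle (𝒯 \ {T}) h𝒯') I i x ?_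
    rw [heq]
    · exact hc _
    · intro h'
      have : I i ∈ Set.range (I ∘ i.succAbove) := by
        rw [h', ← hI]
        exact ⟨i, rfl⟩
      obtain ⟨j, hj⟩ := this
      exact Fin.succAbove_ne i j (hinj hj)
  have hext : ∀ (q : ℕ) (y : TopCat.of V), y ∈ U → ∀ c ∈ (mix 𝓕 𝓕' hle 𝒯 h𝒯).stalk q y,
      ∃ γ, c - γ ∈ (mix 𝓕 𝓕' hle (𝒯 \ {T}) h𝒯').stalk q y ∧
        ∀ v ∈ segment ℝ p y, γ ∈ (mix 𝓕 𝓕' hle 𝒯 h𝒯).stalk q v := by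
    intro q y hy c hc
    refine ⟨part T c, fun I => ?_, fun v hv I => ?_⟩
    · change c.1 I - (part T c).1 I ∈ _
      by_cases hI : Set.range I = T
      · rw [part_of_eq hI, sub_self]
        exact zero_mem _
      · rw [part_of_ne hI, sub_zero, heq hI]
        exact hc I
    · by_cases hI : Set.range I = T
      · rw [part_of_eq hI]
        exact hdec hI y hy v hv (hc I)
      · rw [part_of_ne hI]
        exact zero_mem _
  refine ⟨fun q x c hc I => mix_mono Set.sdiff_subset (hc I), fun q c =>
    (mix 𝓕 𝓕' hle 𝒯 h𝒯).lc.isOpen q c, fun i j x hx c hc => ?_, hext,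
    fun q y hy x hx c hc hc' I => ?_, fun q c hc I => ?_⟩
  · by_cases hij : i + 1 = j
    · subst hij
      refine (congrArg (· ∈ (mix 𝓕 𝓕' hle (𝒯 \ {T}) h𝒯').stalk (i + 1) x)
        (𝓕.lc.modCx_d i c)).mpr ?_
      exact hd i x hx c hc
    · rw [𝓕.lc.modCx.shape i j hij]
      exact zero_mem ((mix 𝓕 𝓕' hle (𝒯 \ {T}) h𝒯').stalk j x)
  · by_cases hI : Set.range I = T
    · rw [hT hI]
      refine (h I hI).1 y hy x hx ?_
      rw [← hT hI]
      exact hc' I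
    · rw [heq hI]
      exact hc I
  · by_cases hI : Set.range I = T
    · rw [hT hI]
      exact (h I hI).2.2 (mix_le (hc I))
    · rw [heq hI]
      exact hc I

variable [ProperSpace V] [HasDerivedCategory.{w₁} (Sh k (TopCat.of V))]
  [HasDerivedCategory.{w₂} (ModuleCat.{u} k)]

open CechFam in
/-- Two families of Čech complexes have the same cohomology with compact supports in `U` if they are
radial with respect to some point for each set of vertices. -/
theorem isIso_of_isRadialPair (n : ℕ) (U : Opens (TopCat.of V))
    (𝓕 𝓕' : CechFam k S Q (TopCat.of V))
    (hle : ∀ {p : ℕ} (I : Fin (p + 1) → S) x, 𝓕.F I x ≤ 𝓕'.F I x)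
    (h : ∀ T : Set S, ∃ p ∈ U, StarConvex ℝ p (U : Set V) ∧ IsRadialPair 𝓕 𝓕' (U : Set V) T p) :
    IsIso ((gammaC (k := k) U).rightDerivedFunctorPlus.map (DerivedCategory.Plus.Q.map
      ((plusShift k (TopCat.of V) n).map
        (𝓕.pull 𝓕' id LinearMap.id fun I x _ hw => hle I x hw).sheafMap))) := by
  have key : ∀ (m : ℕ) (𝒯 : Set (Set S)) (h𝒯 : ∀ T ∈ 𝒯, ∀ T', T ⊆ T' → T' ∈ 𝒯), 𝒯.ncard = m →
      IsIso ((gammaC (k := k) U).rightDerivedFunctorPlus.map (DerivedCategory.Plus.Q.map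
      ((plusShift k (TopCat.of V) n).map
        (𝓕.pull (mix 𝓕 𝓕' hle 𝒯 h𝒯) id LinearMap.id fun I x w hw => le_mix hw).sheafMap))) := by
    intro m
    induction m with
    | zero =>
      intro 𝒯 h𝒯 hm
      rw [Set.ncard_eq_zero] at hm
      subst hm
      have := isIso_pull 𝓕 (mix 𝓕 𝓕' hle ∅ h𝒯) (fun I x => (mix_of_notMem (by simp)).symm)
        fun I x w hw => le_mix hw
      infer_instance
    | succ m ih =>
      intro 𝒯 h𝒯 hm
      obtain ⟨T, hT⟩ : 𝒯.Nonempty := Set.nonempty_of_ncard_ne_zero (by lia)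
      obtain ⟨T, hT⟩ := Set.Finite.exists_minimal (Set.toFinite 𝒯) ⟨T, hT⟩
      have h𝒯' : ∀ T' ∈ 𝒯 \ {T}, ∀ T'', T' ⊆ T'' → T'' ∈ 𝒯 \ {T} := by
        rintro T' ⟨h1, h2⟩ T'' h3
        refine ⟨h𝒯 _ h1 _ h3, ?_⟩
        rintro rfl
        exact h2 (h3.antisymm (hT.2 h1 h3))
      have h1 := ih _ h𝒯' (by rw [Set.ncard_sdiff_singleton_of_mem hT.1, hm]; rfl)
      obtain ⟨p, hp, hU, hr⟩ := h T
      have h2 := isIso_of_radialStep n U (f := ((mix 𝓕 𝓕' hle (𝒯 \ {T}) h𝒯').pull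
        (mix 𝓕 𝓕' hle 𝒯 h𝒯) id LinearMap.id fun I x w hw => mix_mono Set.sdiff_subset hw).sheafMap)
        (P := (mix 𝓕 𝓕' hle (𝒯 \ {T}) h𝒯').lc.presentation)
        (P' := (mix 𝓕 𝓕' hle 𝒯 h𝒯).lc.presentation) (LcCx.Hom.compat _)
        (hr.radialStep h𝒯 h𝒯') hp hU
      have e := pull_comp 𝓕 (mix 𝓕 𝓕' hle (𝒯 \ {T}) h𝒯') (mix 𝓕 𝓕' hle 𝒯 h𝒯) id LinearMap.id id
        LinearMap.id (fun I x w hw => le_mix hw) (fun I x w hw => mix_mono Set.sdiff_subset hw)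
        (fun I x w hw => le_mix hw)
      have e' := congrArg (fun f => (gammaC (k := k) U).rightDerivedFunctorPlus.map
        (DerivedCategory.Plus.Q.map ((plusShift k (TopCat.of V) n).map f))) e
      simp only [Functor.map_comp] at e'
      exact e' ▸ inferInstance
  have h1 := key _ Set.univ (fun _ _ _ _ => trivial) rfl
  have h2 := isIso_pull (mix 𝓕 𝓕' hle Set.univ fun _ _ _ _ => trivial) 𝓕'
    (fun I x => mix_of_mem trivial) fun I x w hw => mix_le hw
  have e := pull_comp 𝓕 (mix 𝓕 𝓕' hle Set.univ fun _ _ _ _ => trivial) 𝓕' id LinearMap.id id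
    LinearMap.id (fun I x w hw => le_mix hw) (fun I x w hw => mix_le hw)
    (fun I x w hw => hle I x hw)
  have e' := congrArg (fun f => (gammaC (k := k) U).rightDerivedFunctorPlus.map
    (DerivedCategory.Plus.Q.map ((plusShift k (TopCat.of V) n).map f))) e
  simp only [Functor.map_comp] at e'
  exact e' ▸ inferInstance

end Radial

end Cech

end Toric

end

noncomputable section

namespace Toric

/-! ### Contractible Čech complexes -/

section Contraction

variable {k : Type u} [CommRing k] {S S' Q Q' : Type u} [AddCommGroup Q] [Module k Q]
  [AddCommGroup Q'] [Module k Q'] {X : TopCat.{u}}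

/-- The contraction of alternating cochains with a vertex. -/
def altCone (s : S) {p : ℕ} (c : altCochains k S Q (p + 1)) : altCochains k S Q p :=
  ⟨fun I => c.1 (Fin.cons s I), fun I π => by
    have e : (Fin.cons s (I ∘ π) : Fin (p + 2) → S) =
        (Fin.cons s I : Fin (p + 2) → S) ∘ Equiv.Perm.decomposeFin.symm (0, π) := by
      ext i
      refine Fin.cases ?_ (fun j => ?_) i
      · simp
      · simp
    dsimp only
    rw [e, c.2.1]
    simp, fun I hI => c.2.2 _ fun h => hI (Fin.cons_injective_iff.1 h).2⟩

lemma cechD_cons {p : ℕ} (c : (Fin (p + 2) → S) → Q) (s : S) (I : Fin (p + 2) → S) :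
    cechD c (Fin.cons s I) = c I - cechD (fun I => c (Fin.cons s I)) I := by
  have e : ∀ j : Fin (p + 2), (Fin.cons s I : Fin (p + 3) → S) ∘ j.succ.succAbove =
      Fin.cons s (I ∘ j.succAbove) := by
    intro j
    ext i
    refine Fin.cases ?_ (fun l => ?_) i
    · simp
    · simp
  have e0 : (Fin.cons s I : Fin (p + 3) → S) ∘ (0 : Fin (p + 3)).succAbove = I := by
    ext i
    simp
  rw [cechD, Fin.sum_univ_succ, e0, cechD, sub_eq_add_neg, ← Finset.sum_neg_distrib]
  simp [e, pow_succ]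

lemma altD_altCone {s : S} {p : ℕ} {c : altCochains k S Q (p + 1)} (hc : altD k S Q (p + 1) c = 0) :
    altD k S Q p (altCone s c) = c := by
  ext I
  have h : cechD c.1 (Fin.cons s I) = 0 := congrArg (fun c : altCochains k S Q (p + 2) =>
    c.1 (Fin.cons s I)) hc
  rw [cechD_cons, sub_eq_zero] at h
  exact h.symm

lemma eq_of_altD_eq_zero {c : altCochains k S Q 0} (hc : altD k S Q 0 c = 0) (I J : Fin 1 → S) :
    c.1 I = c.1 J := by
  have h : cechD c.1 ![J 0, I 0] = 0 := congrArg (fun c : altCochains k S Q 1 =>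
    c.1 ![J 0, I 0]) hc
  have e0 : (![J 0, I 0] ∘ (0 : Fin 2).succAbove : Fin 1 → S) = I := by
    ext i
    fin_cases i
    rfl
  have e1 : (![J 0, I 0] ∘ (1 : Fin 2).succAbove : Fin 1 → S) = J := by
    ext i
    fin_cases i
    rfl
  rw [cechD, Fin.sum_univ_two, e0, e1] at h
  simpa [add_neg_eq_zero] using h

/-- The constant `0`-cochain. -/
def altConst (k : Type u) [CommRing k] (S : Type u) {Q : Type u} [AddCommGroup Q] [Module k Q]
    (w : Q) : altCochains k S Q 0 :=
  have : Subsingleton (Fin (0 + 1)) := inferInstanceAs (Subsingleton (Fin 1))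
  ⟨fun _ => w, fun I π => by simp [Subsingleton.elim π 1], fun I hI =>
    absurd (Function.injective_of_subsingleton I) hI⟩

lemma altD_altConst (w : Q) : altD k S Q 0 (altConst k S w) = 0 := by
  ext I
  change cechD (fun _ => w) I = 0
  simp [cechD, Fin.sum_univ_two]

namespace CechFam

/-- The Čech complex at `x` is contracted by the vertex `s`. -/
def ContractibleAt (𝓕 : CechFam k S Q X) (s : S) (x : X) : Prop :=
  ∀ {p : ℕ} (I : Fin (p + 1) → S), 𝓕.F (Fin.cons s I : Fin (p + 2) → S) x ≤ 𝓕.F I x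

lemma ContractibleAt.exists_eq {𝓕 : CechFam k S Q X} {s : S} {x : X} (h : 𝓕.ContractibleAt s x)
    {p : ℕ} {c : altCochains k S Q (p + 1)} (hc : c ∈ 𝓕.stalk (p + 1) x)
    (hd : altD k S Q (p + 1) c = 0) : ∃ b ∈ 𝓕.stalk p x, c = altD k S Q p b :=
  ⟨altCone s c, fun I => h I (hc _), (altD_altCone hd).symm⟩

lemma ContractibleAt.const_mem {𝓕 : CechFam k S Q X} {s : S} {x : X} (h : 𝓕.ContractibleAt s x)
    {w : Q} (hw : w ∈ 𝓕.F (fun _ : Fin 1 => s) x) : altConst k S w ∈ 𝓕.stalk 0 x := by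
  intro I
  refine h I (𝓕.mono _ 1 x ?_)
  have e : (Fin.cons s I : Fin 2 → S) ∘ (1 : Fin 2).succAbove = fun _ => s := by
    ext i
    fin_cases i
    rfl
  rw [e]
  exact hw

variable [Finite S] [Finite S']

lemma quasiAtNat_pull (𝓕 : CechFam k S Q X) (𝓕' : CechFam k S' Q' X) (f : S' → S) (g : Q →ₗ[k] Q')
    (h) {x : X} {s : S} {s' : S'} (hs : 𝓕.ContractibleAt s x) (hs' : 𝓕'.ContractibleAt s' x)
    (hinj : ∀ w ∈ 𝓕.F (fun _ : Fin 1 => s) x, g w = 0 → w = 0)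
    (hsurj : ∀ w' ∈ 𝓕'.F (fun _ : Fin 1 => s') x, ∃ w ∈ 𝓕.F (fun _ : Fin 1 => s) x, g w = w') :
    QuasiAtNat 𝓕.lc.A 𝓕'.lc.A (𝓕.pull 𝓕' f g h).modMap x where
  inj := by
    rintro i _ _ rfl rfl c hc hd - - -
    obtain ⟨b, hb, e⟩ := hs.exists_eq hc ((𝓕.lc.modCx_d (i + 1) c).symm.trans hd)
    exact ⟨b, hb, e.trans (𝓕.lc.modCx_d i b).symm⟩
  surj := by
    rintro i _ _ rfl rfl c hc hd
    obtain ⟨b, hb, e⟩ := hs'.exists_eq hc ((𝓕'.lc.modCx_d (i + 1) c).symm.trans hd)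
    refine ⟨0, zero_mem (𝓕.stalk (i + 1) x), map_zero _, b, hb, ?_⟩
    rw [map_zero, zero_add]
    exact e.trans (𝓕'.lc.modCx_d i b).symm
  inj_zero := by
    intro c hc hd h0
    replace hd : altD k S Q 0 c = 0 := (𝓕.lc.modCx_d 0 c).symm.trans hd
    have h1 : g (Subtype.val (p := (· ∈ altCochains k S Q 0)) c (f ∘ fun _ => s')) = 0 :=
      congrArg (fun c : altCochains k S' Q' 0 => c.1 fun _ => s') h0
    refine Subtype.ext (funext fun I => ?_)
    refine (eq_of_altD_eq_zero hd I fun _ => s).trans ?_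
    refine hinj _ (hc _) ?_
    rw [← h1]
    exact congrArg g (eq_of_altD_eq_zero hd _ _)
  surj_zero := by
    intro c hc hd
    replace hd : altD k S' Q' 0 c = 0 := (𝓕'.lc.modCx_d 0 c).symm.trans hd
    obtain ⟨w, hw, e⟩ := hsurj _ (hc _)
    refine ⟨altConst k S w, hs.const_mem hw, ?_, ?_⟩
    · exact (𝓕.lc.modCx_d 0 _).trans (altD_altConst w)
    · refine Subtype.ext (funext fun I => ?_)
      exact (eq_of_altD_eq_zero hd I fun _ => s').trans e.symm

end CechFam

end Contraction

end Toric

end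

noncomputable section

namespace Toric

/-! ### Quasi-isomorphisms on stalks -/

section Stalks

open Opposite

lemma FlabbyCx.exactAt_cone_of_germ {X : Type*} [TopologicalSpace X] {I J : FlabbyCx X}
    {f : FlabbyCx.Hom I J} {x : X}
    (hinj : ∀ q (a : I.M (q + 1)), I.germ x (I.d _ a) = 0 → ∀ b : J.M q,
      J.germ x (f.f _ a) = J.germ x (J.d q b) → ∃ c, I.germ x a = I.germ x (I.d q c))
    (hsurj : ∀ q (b : J.M (q + 1)), J.germ x (J.d _ b) = 0 → ∃ a, I.germ x (I.d _ a) = 0 ∧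
      ∃ c, J.germ x b = J.germ x (f.f _ a) + J.germ x (J.d q c)) :
    (cone f).ExactAt x := by
  rintro q ⟨a, b⟩ hab
  obtain ⟨h1, h2⟩ := germ_cone_d.1 hab
  obtain ⟨c, hc⟩ := hinj _ a h1 (-b) (by rw [map_neg, map_neg, eq_neg_iff_add_eq_zero, h2])
  obtain ⟨a', ha', c', hc'⟩ := hsurj q (b + f.f _ c) (by
    rw [map_add, ← f.comm, map_add, ← f.germ_congr hc]
    exact (add_comm _ _).trans h2)
  refine ⟨(a' - c, c'), germ_cone.2 ⟨?_, ?_⟩⟩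
  · change I.germ x a = I.germ x (-I.d _ (a' - c))
    rw [hc, map_sub, neg_sub, map_sub, ha', sub_zero]
  · change J.germ x b = J.germ x (f.f _ (a' - c) + J.d _ c')
    rw [map_add] at hc'
    rw [eq_sub_of_add_eq hc', map_add, map_sub, map_sub]
    abel

variable {k : Type u} [CommRing k] {X : TopCat.{u}}

lemma IsFlasqueCx.germ_d_eq {I : CochainComplex (Sh k X) ℤ} (hI : IsFlasqueCx I) {x : X} {q : ℤ}
    (a : (I.X q).presheaf.obj (op ⊤)) :
    stalkMap (I.d q (q + 1)) x (gGerm (I.X q) x a) = gGerm (I.X (q + 1)) x (hI.cx.d q a) :=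
  stalkMap_germ (I.d q (q + 1)) x (U := ⊤) trivial a

lemma exactAt_cone_of_quasiIso {I J : CochainComplex (Sh k X) ℤ} (hI : IsFlasqueCx I)
    (hJ : IsFlasqueCx J) (g : I ⟶ J) {x : X} (h : QuasiIso (stalkCxMap g x)) :
    (FlabbyCx.cone (flabbyHom hI hJ g)).ExactAt x := by
  rw [quasiIso_iff_elementwise] at h
  have hg : ∀ {q} (a : (I.X q).presheaf.obj (op ⊤)), stalkMap (g.f q) x (gGerm (I.X q) x a) =
      gGerm (J.X q) x ((flabbyHom hI hJ g).f q a) := fun a =>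
    stalkMap_germ (g.f _) x (U := ⊤) trivial a
  refine FlabbyCx.exactAt_cone_of_germ (fun q a ha b hab => ?_) fun q b hb => ?_
  · obtain ⟨c, hc⟩ := (h q).1 (gGerm (I.X (q + 1)) x a)
      ((hI.germ_d_eq a).trans (FlabbyCx.germ_eq_zero.1 ha)) (gGerm (J.X q) x b)
      ((hg a).trans ((hJ.germ_eq_iff.1 hab).trans (hJ.germ_d_eq b).symm))
    obtain ⟨c, rfl⟩ := hI.exists_germ c
    exact ⟨c, hI.germ_eq_iff.2 (hc.trans (hI.germ_d_eq c))⟩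
  · obtain ⟨a, ha, c, hc⟩ := (h q).2 (gGerm (J.X (q + 1)) x b)
      ((hJ.germ_d_eq b).trans (FlabbyCx.germ_eq_zero.1 hb))
    obtain ⟨a, rfl⟩ := hI.exists_germ a
    obtain ⟨c, rfl⟩ := hJ.exists_germ c
    refine ⟨a, FlabbyCx.germ_eq_zero.2 ((hI.germ_d_eq a).symm.trans ha), c, ?_⟩
    refine Eq.trans ?_ (map_add (hJ.cx.germ x (q := q + 1)) _ _)
    refine hJ.germ_eq_iff.2 (hc.trans ?_)
    refine Eq.trans ?_ (map_add (gGerm (J.X (q + 1)) x).hom _ _).symm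
    exact congrArg₂ (· + ·) (hg a) (hJ.germ_d_eq c)

variable [T2Space X] [LocallyCompactSpace X] [NormalSpace X]
  [HasDerivedCategory.{w₁} (Sh k X)] [HasDerivedCategory.{w₂} (ModuleCat.{u} k)]

open DerivedCategory.Plus (Q)

lemma isIso_of_quasiIso_stalk (U : Opens X) {K L : CochainComplex.Plus (Sh k X)} (f : K ⟶ L)
    (h : ∀ x ∈ U, QuasiIso (stalkCxMap f.hom x)) :
    IsIso ((gammaC (k := k) U).rightDerivedFunctorPlus.map (Q.map f)) := by
  refine isIso_rightDerived_map U f fun I J hI hJ w w' g _ _ hg =>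
    coneAcyclic_of_exactAt _ U.isOpen fun x hx => exactAt_cone_of_quasiIso hI hJ g ?_
  have := h x hx
  have e : stalkCxMap f.hom x ≫ stalkCxMap w' x = stalkCxMap w x ≫ stalkCxMap g x := by
    rw [← Functor.map_comp, ← Functor.map_comp, hg]
  have h1 : QuasiIso (stalkCxMap w x ≫ stalkCxMap g x) := by
    rw [← e]
    infer_instance
  exact quasiIso_of_comp_left (stalkCxMap w x) _

lemma isIso_gammaCUnit_of_flasque (U : Opens X) (K : CochainComplex.Plus (Sh k X))
    (hK : IsFlasqueCx K.obj) : IsIso (gammaCUnit (k := k) U K) :=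
  isIso_gammaCUnit U K hK fun _ hJ w _ => coneAcyclic_of_exactAt _ U.isOpen fun x _ =>
    exactAt_cone_of_quasiIso hK hJ w (quasiIso_stalk w x)

end Stalks

/-! ### Skyscraper sheaves -/

section Sky

open Opposite

variable {k : Type u} [CommRing k] {X : TopCat.{u}} (p : X)

/-- The skyscraper presheaf. -/
def skyPresheaf (M : ModuleCat.{u} k) : TopCat.Presheaf (ModuleCat.{u} k) X where
  obj U := ModuleCat.of k (∀ x : U.unop, PLift (x.1 = p) → M)
  map f := ModuleCat.ofHom
    { toFun := fun s x h => s ⟨x.1, f.unop.le x.2⟩ h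
      map_add' := fun _ _ => rfl
      map_smul' := fun _ _ => rfl }
  map_id _ := rfl
  map_comp _ _ := rfl

/-- The skyscraper sheaf with value `M` at the point `p`. -/
def sky (M : ModuleCat.{u} k) : Sh k X :=
  ⟨skyPresheaf p M, (TopCat.Presheaf.isSheaf_iff_isSheaf_comp (forget (ModuleCat.{u} k)) _).2
    (TopCat.Presheaf.toTypes_isSheaf X fun x => PLift (x = p) → M)⟩

variable (k) in
/-- The skyscraper sheaf as a functor. -/
def skyFunctor : ModuleCat.{u} k ⥤ Sh k X where
  obj M := sky p M
  map {M _} f := ObjectProperty.homMk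
    { app := fun U => ModuleCat.ofHom
        { toFun := fun (s : ∀ x : U.unop, PLift (x.1 = p) → M) x h => f (s x h)
          map_add' := fun _ _ => funext fun _ => funext fun _ => map_add f.hom _ _
          map_smul' := fun _ _ => funext fun _ => funext fun _ => map_smul f.hom _ _ }
      naturality := fun _ _ _ => rfl }
  map_id _ := rfl
  map_comp _ _ := rfl

lemma isFlasque_sky (M : ModuleCat.{u} k) : IsFlasque (sky p M) := by
  classical
  intro U s
  refine ⟨(fun x h => if hx : x.1 ∈ U then
    (show ∀ x : U, PLift (x.1 = p) → M from s) ⟨x.1, hx⟩ h else 0 :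
    ∀ x : (⊤ : Opens X), PLift (x.1 = p) → M), ?_⟩
  refine funext fun x => funext fun h => ?_
  exact dif_pos x.2

lemma isFlasque_of_isZero {F : Sh k X} (hF : Limits.IsZero F) : IsFlasque F := fun U _ =>
  ⟨0, (subsingleton_of_isZero hF (op U)).elim _ _⟩

variable [T2Space X]

lemma isZero_stalk_sky (M : ModuleCat.{u} k) {x : X} (hx : x ≠ p) :
    Limits.IsZero ((stalkAt k x).obj (sky p M)) := by
  refine ModuleCat.isZero_of_iff_subsingleton.2 (subsingleton_of_forall_eq 0 fun s => ?_)
  obtain ⟨U, hxU, s, rfl⟩ := (sky p M).presheaf.exists_germ_eq s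
  refine Eq.trans ?_ (map_zero ((sky p M).presheaf.germ U x hxU).hom)
  refine TopCat.Presheaf.germ_ext (sky p M).presheaf (U ⊓ ⟨{p}ᶜ, isOpen_compl_singleton⟩)
    ⟨hxU, hx⟩ (homOfLE inf_le_left) (homOfLE inf_le_left) ?_
  exact funext fun y => funext fun h => absurd h.down y.2.2

/-- The compactly supported sections of a skyscraper sheaf. -/
def gammaCSky (M : ModuleCat.{u} k) : (gammaC (k := k) ⊤).obj (sky p M) ≅ M where
  hom := ModuleCat.ofHom
    { toFun := fun s : compactSections ⊤ (sky p M) =>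
        (show ∀ x : (⊤ : Opens X), PLift (x.1 = p) → M from s.1) ⟨p, trivial⟩ ⟨rfl⟩
      map_add' := fun _ _ => rfl
      map_smul' := fun _ _ => rfl }
  inv := ModuleCat.ofHom
    { toFun := fun m => (⟨(fun _ _ => m : ∀ x : (⊤ : Opens X), PLift (x.1 = p) → M),
        {p}, isCompact_singleton, by simp, funext fun y => funext fun h => absurd h.down y.2⟩ :
        compactSections ⊤ (sky p M))
      map_add' := fun _ _ => rfl
      map_smul' := fun _ _ => rfl }
  hom_inv_id := by
    ext s
    refine Subtype.ext (funext fun x => funext fun h => ?_)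
    obtain ⟨x, hx⟩ := x
    obtain ⟨rfl⟩ := h
    rfl
  inv_hom_id := rfl

variable (k) in
/-- The compactly supported sections of skyscraper sheaves, naturally. -/
def gammaCSkyIso : skyFunctor k p ⋙ gammaC (k := k) ⊤ ≅ 𝟭 _ :=
  NatIso.ofComponents (gammaCSky p) fun _ => rfl

end Sky

end Toric

end

noncomputable section

namespace Toric

/-! ### The cohomology of skyscraper sheaves -/

section SkyCohomology

open DerivedCategory.Plus (Q Qh)

variable (k : Type u) [CommRing k] {X : TopCat.{u}} (p : X)

/-- A skyscraper sheaf as a complex in degree `0`. -/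
def skyPlus : ModuleCat.{u} k ⥤ CochainComplex.Plus (Sh k X) :=
  ObjectProperty.lift _ (skyFunctor k p ⋙ HomologicalComplex.single (Sh k X) (ComplexShape.up ℤ) 0)
    (fun M => ⟨0, inferInstanceAs (CochainComplex.IsStrictlyGE
      ((CochainComplex.singleFunctor (Sh k X) 0).obj (sky p M)) 0)⟩)

lemma isFlasqueCx_skyPlus (M : ModuleCat.{u} k) : IsFlasqueCx ((skyPlus k p).obj M).obj where
  flasque q := by
    by_cases hq : q = 0
    · subst hq
      exact isFlasque_sky p M
    · exact isFlasque_of_isZero (HomologicalComplex.isZero_single_obj_X _ _ _ _ hq)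
  bounded := ((skyPlus k p).obj M).property

variable [T2Space X] [HasDerivedCategory.{w₂} (ModuleCat.{u} k)] 

/-- The homology of the complex of compactly supported sections. -/
def homologyGammaCIso (U : Opens X) :
    HomotopyCategory.Plus.quotient (Sh k X) ⋙ (gammaC (k := k) U).mapHomotopyCategoryPlus ⋙ Qh ⋙
      DerivedCategory.Plus.homologyFunctor (ModuleCat.{u} k) 0 ≅
    CochainComplex.Plus.ι (Sh k X) ⋙ (gammaC (k := k) U).mapHomologicalComplex (ComplexShape.up ℤ) ⋙
      HomologicalComplex.homologyFunctor (ModuleCat.{u} k) (ComplexShape.up ℤ) 0 :=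
  Functor.isoWhiskerLeft (HomotopyCategory.Plus.quotient (Sh k X) ⋙
    (gammaC (k := k) U).mapHomotopyCategoryPlus ⋙ HomotopyCategory.Plus.ι _)
      (DerivedCategory.homologyFunctorFactorsh (ModuleCat.{u} k) 0) ≪≫
  Functor.isoWhiskerLeft (CochainComplex.Plus.ι (Sh k X) ⋙
    (gammaC (k := k) U).mapHomologicalComplex (ComplexShape.up ℤ))
      (HomotopyCategory.homologyFunctorFactors (ModuleCat.{u} k) (ComplexShape.up ℤ) 0)

/-- The homology of the compactly supported sections of skyscraper sheaves. -/
def homologyGammaCSkyIso :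
    skyPlus k p ⋙ CochainComplex.Plus.ι (Sh k X) ⋙
      (gammaC (k := k) ⊤).mapHomologicalComplex (ComplexShape.up ℤ) ⋙
      HomologicalComplex.homologyFunctor (ModuleCat.{u} k) (ComplexShape.up ℤ) 0 ≅ 𝟭 _ :=
  Functor.isoWhiskerRight (Functor.isoWhiskerLeft (skyFunctor k p)
    (HomologicalComplex.singleMapHomologicalComplex (gammaC (k := k) (⊤ : Opens X))
      (ComplexShape.up ℤ) 0)) (HomologicalComplex.homologyFunctor _ _ 0) ≪≫
  Functor.isoWhiskerLeft (skyFunctor k p ⋙ gammaC (k := k) ⊤)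
    (HomologicalComplex.homologyFunctorSingleIso (ModuleCat.{u} k) (ComplexShape.up ℤ) 0) ≪≫
  gammaCSkyIso k p

variable [LocallyCompactSpace X] [NormalSpace X] [HasDerivedCategory.{w₁} (Sh k X)]

/-- The unit of the derived functor on skyscraper sheaves. -/
def skyUnitIso : skyPlus k p ⋙ HomotopyCategory.Plus.quotient (Sh k X) ⋙
      (gammaC (k := k) ⊤).mapHomotopyCategoryPlus ⋙ Qh ≅
    skyPlus k p ⋙ Q ⋙ (gammaC (k := k) ⊤).rightDerivedFunctorPlus :=
  NatIso.ofComponents (fun M =>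
    have := isIso_gammaCUnit_of_flasque ⊤ _ (isFlasqueCx_skyPlus k p M)
    asIso (gammaCUnit (k := k) ⊤ ((skyPlus k p).obj M)))
    fun f => gammaCUnit_naturality ⊤ ((skyPlus k p).map f)

/-- The compactly supported cohomology of skyscraper sheaves. -/
def cohomologyCSkyIso : skyPlus k p ⋙ Q ⋙ cohomologyC (k := k) 0 ⊤ ≅ 𝟭 _ :=
  Functor.isoWhiskerRight (skyUnitIso k p).symm
    (DerivedCategory.Plus.homologyFunctor (ModuleCat.{u} k) 0) ≪≫
  Functor.isoWhiskerLeft (skyPlus k p) (homologyGammaCIso k ⊤) ≪≫ homologyGammaCSkyIso k p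

end SkyCohomology

end Toric

end

noncomputable section

namespace Toric

/-! ### Morphisms to complexes in one degree -/

section ToSingle

variable {k : Type u} [CommRing k] {X : TopCat.{u}} {K L : CochainComplex (Sh k X) ℕ} {F G : Sh k X}
  {n : ℕ}

lemma extend_d_comp (ε : K.X n ⟶ F) (h : ∀ m, m + 1 = n → K.d m n ≫ ε = 0) :
    ((n : ℤ).negOnePow • (K.extend ComplexShape.embeddingUpNat).d (-1 + (n : ℤ)) (0 + (n : ℤ))) ≫
      (K.extendXIso ComplexShape.embeddingUpNat (i := n) (i' := 0 + (n : ℤ)) (by simp)).hom ≫ ε =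
      0 := by
  cases n with
  | zero =>
    refine Limits.IsZero.eq_of_src (K.isZero_extend_X _ _ fun i => ?_) _ _
    intro hi
    have : (i : ℤ) = -1 + 0 := hi
    lia
  | succ m =>
    rw [K.extend_d_eq ComplexShape.embeddingUpNat (i := m) (j := m + 1) (by simp) (by simp)]
    rw [Units.smul_def, Preadditive.zsmul_comp]
    simp [h m rfl]

/-- The morphism from a complex in nonnegative degrees, shifted by `n`, to a sheaf in degree `0`. -/
def toSingle (ε : K.X n ⟶ F) (h : ∀ m, m + 1 = n → K.d m n ≫ ε = 0) :
    plusObj n K ⟶ (HomologicalComplex.single (Sh k X) (ComplexShape.up ℤ) 0).obj F :=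
  HomologicalComplex.mkHomToSingle (K := plusObj n K)
    ((K.extendXIso ComplexShape.embeddingUpNat (i := n) (i' := 0 + (n : ℤ)) (by simp)).hom ≫ ε) (by
      rintro i hi
      obtain rfl : i = -1 := by
        have : i + 1 = 0 := hi
        lia
      exact extend_d_comp ε h)

lemma toSingle_f_zero (ε : K.X n ⟶ F) (h : ∀ m, m + 1 = n → K.d m n ≫ ε = 0) :
    (toSingle ε h).f 0 =
      ((K.extendXIso ComplexShape.embeddingUpNat (i := n) (i' := 0 + (n : ℤ)) (by simp)).hom ≫ ε) ≫
      (HomologicalComplex.singleObjXSelf (ComplexShape.up ℤ) 0 F).inv :=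
  HomologicalComplex.mkHomToSingle_f _ _

lemma toSingle_naturality (ε : K.X n ⟶ F) (h : ∀ m, m + 1 = n → K.d m n ≫ ε = 0) (ε' : L.X n ⟶ G)
    (h' : ∀ m, m + 1 = n → L.d m n ≫ ε' = 0) (f : K ⟶ L) (g : F ⟶ G) (hfg : f.f n ≫ ε' = ε ≫ g) :
    ((plusShift k X n).map f).hom ≫ toSingle ε' h' =
      toSingle ε h ≫ (HomologicalComplex.single (Sh k X) (ComplexShape.up ℤ) 0).map g := by
  refine HomologicalComplex.to_single_hom_ext ?_
  have e1 : ((plusShift k X n).map f).hom.f 0 =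
      (K.extendXIso ComplexShape.embeddingUpNat (i := n) (i' := 0 + (n : ℤ)) (by simp)).hom ≫
      f.f n ≫ (L.extendXIso ComplexShape.embeddingUpNat (i := n) (i' := 0 + (n : ℤ)) (by simp)).inv :=
    HomologicalComplex.extendMap_f f ComplexShape.embeddingUpNat (by simp)
  have e2 : ∀ (a : (K.extend ComplexShape.embeddingUpNat).X (0 + (n : ℤ)) ⟶
      (L.extend ComplexShape.embeddingUpNat).X (0 + (n : ℤ)))
      (b : (L.extend ComplexShape.embeddingUpNat).X (0 + (n : ℤ)) ⟶
        ((HomologicalComplex.single (Sh k X) (ComplexShape.up ℤ) 0).obj G).X 0)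
      (c : (K.extend ComplexShape.embeddingUpNat).X (0 + (n : ℤ)) ⟶
        ((HomologicalComplex.single (Sh k X) (ComplexShape.up ℤ) 0).obj F).X 0),
      ((plusShift k X n).map f).hom.f 0 = a → (toSingle ε' h').f 0 = b → (toSingle ε h).f 0 = c →
      a ≫ b = c ≫ ((HomologicalComplex.single (Sh k X) (ComplexShape.up ℤ) 0).map g).f 0 →
      (((plusShift k X n).map f).hom ≫ toSingle ε' h').f 0 =
      (toSingle ε h ≫ (HomologicalComplex.single (Sh k X) (ComplexShape.up ℤ) 0).map g).f 0 := by
    rintro a b c rfl rfl rfl h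
    exact h
  refine e2 _ _ _ e1 (toSingle_f_zero ε' h') (toSingle_f_zero ε h) ?_
  rw [HomologicalComplex.single_map_f_self]
  simp [hfg]

lemma quasiIso_stalk_toSingle (ε : K.X n ⟶ F) (h : ∀ m, m + 1 = n → K.d m n ≫ ε = 0) (x : X)
    (hε : IsIso ((stalkAt k x).map ε))
    (hK : ∀ m ≠ n, Limits.IsZero ((stalkAt k x).obj (K.X m))) :
    QuasiIso (stalkCxMap (toSingle ε h) x) := by
  have : ∀ q, IsIso ((stalkCxMap (toSingle ε h) x).f q) := by
    intro q
    by_cases hq : q = 0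
    · subst hq
      have h1 : IsIso ((stalkAt k x).map (((K.extendXIso ComplexShape.embeddingUpNat (i := n)
          (i' := 0 + (n : ℤ)) (by simp)).hom ≫ ε) ≫
          (HomologicalComplex.singleObjXSelf (ComplexShape.up ℤ) 0 F).inv)) := by
        rw [CategoryTheory.Functor.map_comp, CategoryTheory.Functor.map_comp]
        infer_instance
      exact (congrArg (fun f => IsIso ((stalkAt k x).map f)) (toSingle_f_zero ε h)).mpr h1
    · have h1 : Limits.IsZero ((stalkCx ((HomologicalComplex.single (Sh k X)
          (ComplexShape.up ℤ) 0).obj F) x).X q) :=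
        (stalkAt k x).map_isZero (HomologicalComplex.isZero_single_obj_X _ _ _ _ hq)
      have h2 : Limits.IsZero ((stalkCx (plusObj n K) x).X q) := by
        rcases lt_or_ge (q + n) 0 with hqn | hqn
        · refine (stalkAt k x).map_isZero (K.isZero_extend_X ComplexShape.embeddingUpNat (q + n)
            fun i hi => ?_)
          have : (i : ℤ) = q + n := hi
          lia
        · obtain ⟨m, hm⟩ := Int.eq_ofNat_of_zero_le hqn
          refine (hK m ?_).of_iso ((stalkAt k x).mapIso (K.extendXIso ComplexShape.embeddingUpNat
            (i := m) (i' := q + n) hm.symm))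
          rintro rfl
          lia
      exact ⟨0, h2.eq_of_src _ _, h1.eq_of_src _ _⟩
  have := HomologicalComplex.Hom.isIso_of_components (stalkCxMap (toSingle ε h) x)
  infer_instance

end ToSingle

/-! ### Complexes of locally constant sections that are supported at a point -/

section SkyMap

open Opposite DerivedCategory.Plus

variable {k : Type u} [CommRing k] {X : TopCat.{u}} (p : X)

/-- The evaluation at `p` of locally constant sections. -/
def skyEval {W : Type u} [AddCommGroup W] [Module k W] (A : X → Submodule k W) (M : ModuleCat.{u} k)
    (e : W →ₗ[k] M) : lcSheaf A ⟶ sky p M :=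
  ObjectProperty.homMk
    { app := fun U => ModuleCat.ofHom
        { toFun := fun (s : lcSections A U.unop) (x : U.unop) (_ : PLift (x.1 = p)) => e (s.1 x)
          map_add' := fun _ _ => funext fun _ => funext fun _ => map_add e _ _
          map_smul' := fun _ _ => funext fun _ => funext fun _ => map_smul e _ _ }
      naturality := fun _ _ _ => rfl }

lemma sky_germ_eq_iff (M : ModuleCat.{u} k) {U V : Opens X} (hU : p ∈ U) (hV : p ∈ V)
    (s : ∀ x : U, PLift (x.1 = p) → M) (t : ∀ x : V, PLift (x.1 = p) → M) :
    (sky p M).presheaf.germ U p hU s = (sky p M).presheaf.germ V p hV t ↔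
      s ⟨p, hU⟩ ⟨rfl⟩ = t ⟨p, hV⟩ ⟨rfl⟩ := by
  constructor
  · intro h
    obtain ⟨O, hO, i, j, e⟩ := (sky p M).presheaf.germ_eq p hU hV s t h
    exact congrArg (fun s : ∀ x : O, PLift (x.1 = p) → M => s ⟨p, hO⟩ ⟨rfl⟩) e
  · intro h
    refine TopCat.Presheaf.germ_ext (sky p M).presheaf (U ⊓ V) ⟨hU, hV⟩ (homOfLE inf_le_left)
      (homOfLE inf_le_right) ?_
    refine funext fun x => funext fun hx => ?_
    obtain ⟨x, hx'⟩ := x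
    obtain ⟨rfl⟩ := hx
    exact h

lemma isIso_stalk_skyEval {W : Type u} [AddCommGroup W] [Module k W] (A : X → Submodule k W)
    (hA : ∀ β, IsOpen {x | β ∈ A x}) (M : ModuleCat.{u} k) (e : W →ₗ[k] M)
    (hinj : ∀ w ∈ A p, e w = 0 → w = 0) (hsurj : ∀ m, ∃ w ∈ A p, e w = m) :
    IsIso ((stalkAt k p).map (skyEval p A M e)) := by
  rw [ConcreteCategory.isIso_iff_bijective]
  have key : ∀ β : A p, stalkMap (skyEval p A M e) p (lcGerm A hA p β) =
      (sky p M).presheaf.germ ⟨_, hA β.1⟩ p β.2 (fun _ _ => e β.1 :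
        ∀ x : (⟨_, hA β.1⟩ : Opens X), PLift (x.1 = p) → M) := fun β => stalkMap_germ _ _ _ _
  constructor
  · refine (injective_iff_map_eq_zero _).2 fun s hs => ?_
    obtain ⟨β, rfl⟩ := (lcGerm_bijective A hA p).2 s
    have h1 := (key β).symm.trans (hs.trans (map_zero ((sky p M).presheaf.germ ⊤ p trivial).hom).symm)
    have h2 := (sky_germ_eq_iff p M _ _ _ _).1 h1
    have : β = 0 := Subtype.ext (hinj β.1 β.2 h2)
    rw [this]
    exact map_zero (lcGerm A hA p)
  · intro s
    obtain ⟨U, hU, s, rfl⟩ := (sky p M).presheaf.exists_germ_eq s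
    obtain ⟨w, hw, h⟩ := hsurj ((show ∀ x : U, PLift (x.1 = p) → M from s) ⟨p, hU⟩ ⟨rfl⟩)
    exact ⟨lcGerm A hA p ⟨w, hw⟩, (key _).trans ((sky_germ_eq_iff p M _ _ _ _).2 h)⟩

namespace LcCx

variable (C : LcCx k X) (n : ℕ) (M : ModuleCat.{u} k) (e : C.W n →ₗ[k] M)

lemma isZero_stalk_of_eq_bot {m : ℕ} (h : C.A m p = ⊥) :
    Limits.IsZero ((stalkAt k p).obj (C.sheafCx.X m)) := by
  refine ModuleCat.isZero_of_iff_subsingleton.2 (subsingleton_of_forall_eq 0 fun s => ?_)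
  obtain ⟨β, rfl⟩ := (C.presentation.γ_bijective m p).2 s
  change C.A m p at β
  have : β = 0 := Subtype.ext ((Submodule.mem_bot k).1 ((congrArg (β.1 ∈ ·) h).mp β.2))
  rw [this]
  exact map_zero (lcGerm (C.A m) (C.isOpen m) p)

/-- Evaluation at `p` on a term of the complex of sheaves. -/
def skyEval : C.sheafCx.X n ⟶ sky p M := Toric.skyEval p (C.A n) M e

variable {M} in
lemma sheafCx_d_skyEval {m : ℕ} (h : C.A m p = ⊥) {n : ℕ} (e : C.W n →ₗ[k] M) :
    C.sheafCx.d m n ≫ C.skyEval p n M e = 0 := by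
  by_cases hmn : m + 1 = n
  · subst hmn
    rw [C.sheafCx_d]
    refine ObjectProperty.hom_ext _ (NatTrans.ext (funext fun U => ?_))
    ext s
    refine funext fun x => funext fun hx => ?_
    obtain ⟨x, hxU⟩ := x
    obtain ⟨rfl⟩ := hx
    have h0 : (show lcSections (C.A m) U.unop from s).1 ⟨x, hxU⟩ = 0 :=
      (Submodule.mem_bot k).1 ((congrArg (_ ∈ ·) h).mp
        ((show lcSections (C.A m) U.unop from s).2.2 ⟨x, hxU⟩))
    exact (congrArg (fun w => e (C.D m w)) h0).trans (by rw [map_zero, map_zero]; rfl)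
  · rw [C.sheafCx.shape m n hmn, Limits.zero_comp]

variable {M n} in
lemma sheafCx_d_skyEval_of_forall (h : ∀ m ≠ n, C.A m p = ⊥) (m : ℕ) (hm : m + 1 = n) :
    C.sheafCx.d m n ≫ C.skyEval p n M e = 0 :=
  C.sheafCx_d_skyEval p (h m (by lia)) e

/-- The morphism to a skyscraper sheaf given by evaluation at `p`. -/
def skyHom (h : ∀ m ≠ n, C.A m p = ⊥) : (plusShift k X n).obj C.sheafCx ⟶ (skyPlus k p).obj M :=
  ObjectProperty.homMk (toSingle (C.skyEval p n M e) (C.sheafCx_d_skyEval_of_forall p e h))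

lemma skyHom_naturality (h : ∀ m ≠ n, C.A m p = ⊥) (C' : LcCx k X) (M' : ModuleCat.{u} k)
    (e' : C'.W n →ₗ[k] M') (h' : ∀ m ≠ n, C'.A m p = ⊥) (f : C.Hom C') (g : M ⟶ M')
    (hfg : ∀ w, e' (f.f n w) = g (e w)) :
    (plusShift k X n).map f.sheafMap ≫ C'.skyHom p n M' e' h' =
      C.skyHom p n M e h ≫ (skyPlus k p).map g := by
  refine ObjectProperty.hom_ext _ ?_
  refine toSingle_naturality _ (C.sheafCx_d_skyEval_of_forall p e h) _
    (C'.sheafCx_d_skyEval_of_forall p e' h') f.sheafMap ((skyFunctor k p).map g) ?_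
  refine ObjectProperty.hom_ext _ (NatTrans.ext (funext fun U => ?_))
  ext s
  exact funext fun x => funext fun hx => hfg _

variable [T2Space X]

lemma quasiIso_stalk_skyHom (h : ∀ m ≠ n, C.A m p = ⊥) (hinj : ∀ w ∈ C.A n p, e w = 0 → w = 0)
    (hsurj : ∀ m, ∃ w ∈ C.A n p, e w = m)
    (hex : ∀ x ≠ p, QuasiAtNat C.A (fun _ _ => ⊥) (0 : C.modCx ⟶ C.modCx) x) (x : X) :
    QuasiIso (stalkCxMap (C.skyHom p n M e h).hom x) := by
  by_cases hx : x = p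
  · subst hx
    exact quasiIso_stalk_toSingle _ (C.sheafCx_d_skyEval_of_forall x e h) x
      (isIso_stalk_skyEval x (C.A n) (C.isOpen n) M e hinj hsurj)
      fun m hm => C.isZero_stalk_of_eq_bot x (h m hm)
  · have h1 : ∀ q, Limits.IsZero ((stalkCx ((skyPlus k p).obj M).obj x).X q) := by
      intro q
      by_cases hq : q = 0
      · subst hq
        exact isZero_stalk_sky p M hx
      · exact (stalkAt k x).map_isZero (HomologicalComplex.isZero_single_obj_X _ _ _ _ hq)
    have h2 := ((hex x hx).toQuasiAt.extend_embeddingUpNat (hex x hx).inj_zero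
      (hex x hx).surj_zero).shift (n : ℤ)
    have P := C.presentation.plusShift n
    rw [quasiIso_iff_elementwise]
    refine fun q => ⟨fun s hs _ _ => ?_, fun s _ => ?_⟩
    · obtain ⟨⟨β, hβ⟩, rfl⟩ := (P.γ_bijective (q + 1) x).2 s
      obtain ⟨δ, hδ, hδβ⟩ := h2.inj q (q + 1) (q + 1 + 1) rfl rfl β hβ (by
        have := (P.γ_bijective (q + 1 + 1) x).1 (((P.γ_d hβ).symm.trans hs).trans (map_zero _).symm)
        exact congrArg Subtype.val this) 0 (zero_mem _) (by
        rw [HomologicalComplex.extendMap_zero, Functor.map_zero, map_zero]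
        rfl)
      refine ⟨P.γ q x ⟨δ, hδ⟩, Eq.trans ?_ (P.γ_d hδ).symm⟩
      exact congrArg _ (Subtype.ext hδβ)
    · have := ModuleCat.subsingleton_of_isZero (h1 (q + 1))
      exact ⟨0, map_zero _, 0, Subsingleton.elim _ _⟩

end LcCx

end SkyMap

end Toric

end

noncomputable section

namespace Toric

/-! ### The top compactly supported cohomology of a vector space -/

section Simplex

variable {k : Type u} [CommRing k] {ι : Type u} [Fintype ι]

/-- The linear forms that define the open simplicial cones of the standard complete fan. -/
def simplexForm : Option ι → (ι → ℝ) → ℝ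
  | some i => fun v => v i
  | none => fun v => -∑ i, v i

lemma continuous_simplexForm (j : Option ι) : Continuous (simplexForm j) := by
  cases j with
  | none => exact (continuous_finsetSum _ fun i _ => continuous_apply i).neg
  | some i => exact continuous_apply i

lemma simplexForm_combo (j : Option ι) (a b : ℝ) (v w : ι → ℝ) :
    simplexForm j (a • v + b • w) = a * simplexForm j v + b * simplexForm j w := by
  cases j with
  | none =>
    simp only [simplexForm, Pi.add_apply, Pi.smul_apply, smul_eq_mul, Finset.sum_add_distrib,
      ← Finset.mul_sum]
    ring
  | some i => simp [simplexForm]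

lemma sum_simplexForm (v : ι → ℝ) : ∑ j, simplexForm j v = 0 := by
  simp [Fintype.sum_option, simplexForm]

lemma simplexForm_zero (j : Option ι) : simplexForm j 0 = 0 := by
  cases j <;> simp [simplexForm]

/-- The open convex set defined by the forms that do not belong to `T`. -/
def simplexOpen (T : Set (Option ι)) : Set (ι → ℝ) := {v | ∀ j ∉ T, 0 < simplexForm j v}

lemma isOpen_simplexOpen (T : Set (Option ι)) : IsOpen (simplexOpen T) := by
  have : simplexOpen T = ⋂ j, ⋂ (_ : j ∉ T), {v | 0 < simplexForm j v} := by
    ext v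
    simp [simplexOpen]
  rw [this]
  exact isOpen_iInter_of_finite fun j => isOpen_iInter_of_finite fun _ =>
    isOpen_lt continuous_const (continuous_simplexForm j)

lemma convex_simplexOpen (T : Set (Option ι)) : Convex ℝ (simplexOpen T) := by
  intro v hv w hw a b ha hb hab j hj
  rw [simplexForm_combo]
  rcases ha.eq_or_lt with rfl | ha
  · obtain rfl : b = 1 := by simpa using hab
    simpa using hw j hj
  · exact add_pos_of_pos_of_nonneg (mul_pos ha (hv j hj)) (mul_nonneg hb (hw j hj).le)

lemma simplexOpen_nonempty {T : Set (Option ι)} (hT : T.Nonempty) : (simplexOpen T).Nonempty := by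
  classical
  obtain ⟨t, ht⟩ := hT
  cases t with
  | none =>
    refine ⟨fun _ => 1, fun j hj => ?_⟩
    cases j with
    | none => exact absurd ht hj
    | some j => simp [simplexForm]
  | some i =>
    refine ⟨Function.update (fun _ => 1) i (-(Fintype.card ι : ℝ)), fun j hj => ?_⟩
    cases j with
    | none =>
      have h1 := Finset.add_sum_erase Finset.univ
        (Function.update (fun _ : ι => (1 : ℝ)) i (-(Fintype.card ι : ℝ))) (Finset.mem_univ i)
      have h2 : ∑ x ∈ Finset.univ.erase i,
          Function.update (fun _ : ι => (1 : ℝ)) i (-(Fintype.card ι : ℝ)) x =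
          ∑ x ∈ Finset.univ.erase i, (1 : ℝ) :=
        Finset.sum_congr rfl fun x hx => Function.update_of_ne (Finset.ne_of_mem_erase hx) _ _
      have h3 : ((Finset.univ.erase i).card : ℝ) + 1 = Fintype.card ι := by
        exact_mod_cast Finset.card_erase_add_one (Finset.mem_univ i)
      rw [h2, Function.update_self] at h1
      simp only [Finset.sum_const, nsmul_eq_mul, mul_one] at h1
      change 0 < -_
      rw [← h1]
      linarith
    | some j =>
      have : j ≠ i := by
        rintro rfl
        exact hj ht
      simp [simplexForm, this]

variable {Q Q' : Type u} [AddCommGroup Q] [Module k Q] [AddCommGroup Q'] [Module k Q']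

variable (k ι Q) in
/-- The family of Čech complexes of the complement of the origin. -/
def simplexFam : CechFam k (Option ι) Q (space ι) where
  F I v := by classical exact if v ∈ simplexOpen (Set.range I) then ⊤ else ⊥
  mono I i v := by
    split_ifs with h1 h2
    · exact le_rfl
    · exact absurd (fun j hj => h1 j fun h => hj (Set.range_comp_subset_range _ _ h)) h2
    · exact bot_le
    · exact bot_le
  isOpen I w := by
    by_cases hw : w = 0
    · subst hw
      simp
    · convert isOpen_simplexOpen (Set.range I) using 1
      ext v
      by_cases hv : v ∈ simplexOpen (Set.range I)
      · simp [hv]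
      · simp [hv, hw]

lemma simplexFam_of_mem {p : ℕ} {I : Fin (p + 1) → Option ι} {v : space ι}
    (h : v ∈ simplexOpen (Set.range I)) : (simplexFam k ι Q).F I v = ⊤ :=
  if_pos h

lemma simplexFam_of_notMem {p : ℕ} {I : Fin (p + 1) → Option ι} {v : space ι}
    (h : v ∉ simplexOpen (Set.range I)) : (simplexFam k ι Q).F I v = ⊥ :=
  if_neg h

lemma isRadialPair_simplexFam (T : Set (Option ι)) : ∃ p : ι → ℝ,
    IsRadialPair (simplexFam k ι Q) (CechFam.const k (Option ι) Q (space ι)) Set.univ T p := by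
  by_cases hT : T.Nonempty
  · obtain ⟨p, hp⟩ := simplexOpen_nonempty hT
    refine ⟨p, fun I hI => ⟨fun y _ x hx => ?_, fun _ _ _ _ => le_rfl, ?_⟩⟩
    · by_cases hy : y ∈ simplexOpen (Set.range I)
      · rw [simplexFam_of_mem ((convex_simplexOpen _).segment_subset (hI ▸ hp) hy hx)]
        exact le_top
      · rw [simplexFam_of_notMem hy]
        exact bot_le
    · rw [simplexFam_of_mem (hI ▸ hp)]
      exact le_top
  · refine ⟨0, fun I hI => absurd ?_ hT⟩
    rw [← hI]
    exact Set.range_nonempty I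

lemma exists_simplexForm_pos {v : ι → ℝ} (hv : v ≠ 0) : ∃ j, 0 < simplexForm j v := by
  by_contra! h
  refine hv (funext fun i => ?_)
  have := (Finset.sum_eq_zero_iff_of_nonpos fun j _ => h j).1 (sum_simplexForm v) (some i)
    (Finset.mem_univ _)
  exact this

lemma contractibleAt_simplexFam {v : space ι} {j : Option ι} (hj : 0 < simplexForm j v) :
    (simplexFam k ι Q).ContractibleAt j v := by
  intro p I
  by_cases h : v ∈ simplexOpen (Set.range (Fin.cons j I : Fin (p + 2) → Option ι))
  · rw [simplexFam_of_mem (I := I)]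
    · exact le_top
    · intro l hl
      by_cases hlj : l = j
      · rw [hlj]
        exact hj
      · refine h l ?_
        rw [Fin.range_cons]
        simp [hlj, hl]
  · rw [simplexFam_of_notMem h]
    exact bot_le

lemma simplexFam_vertex {v : space ι} {j : Option ι} (hj : 0 < simplexForm j v) :
    (simplexFam k ι Q).F (fun _ : Fin 1 => j) v = ⊥ := by
  refine simplexFam_of_notMem fun h => ?_
  have h1 : ∀ l, 0 < simplexForm l v := by
    intro l
    by_cases hl : l = j
    · rw [hl]
      exact hj
    · exact h l (by simpa using fun h => hl h)
  exact (Finset.sum_pos (fun l _ => h1 l) ⟨none, Finset.mem_univ _⟩).ne' (sum_simplexForm v)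

lemma quasiAtNat_simplexFam {v : space ι} (hv : v ≠ 0) :
    QuasiAtNat (simplexFam k ι Q).lc.A (fun _ _ => ⊥) 
      (0 : (simplexFam k ι Q).lc.modCx ⟶ (simplexFam k ι Q).lc.modCx) v := by
  obtain ⟨s, hs⟩ := exists_simplexForm_pos hv
  have hc : (simplexFam k ι Q).ContractibleAt s v := contractibleAt_simplexFam hs
  refine { inj := ?_, surj := ?_, inj_zero := ?_, surj_zero := ?_ }
  · rintro i _ _ rfl rfl c h hd _ _ _
    obtain ⟨b, hb, e⟩ := hc.exists_eq h (((simplexFam k ι Q).lc.modCx_d (i + 1) c).symm.trans hd)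
    exact ⟨b, hb, e.trans ((simplexFam k ι Q).lc.modCx_d i b).symm⟩
  · rintro i j l _ _ β hβ _
    refine ⟨0, zero_mem ((simplexFam k ι Q).lc.A j v), map_zero _, 0, zero_mem _, ?_⟩
    rw [map_zero, map_zero, add_zero]
    exact (Submodule.mem_bot k).1 hβ
  · intro c h hd _
    replace hd : altD k (Option ι) Q 0 c = 0 := ((simplexFam k ι Q).lc.modCx_d 0 c).symm.trans hd
    refine Subtype.ext (funext fun I => ?_)
    refine (eq_of_altD_eq_zero hd I fun _ => s).trans ?_
    have := h (fun _ => s)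
    rw [simplexFam_vertex hs] at this
    exact (Submodule.mem_bot k).1 this
  · intro β hβ _
    refine ⟨0, zero_mem ((simplexFam k ι Q).lc.A 0 v), map_zero _, ?_⟩
    rw [map_zero]
    exact (Submodule.mem_bot k).1 hβ

lemma zero_mem_simplexOpen {T : Set (Option ι)} (h : (0 : ι → ℝ) ∈ simplexOpen T) (j : Option ι) :
    j ∈ T := by
  by_contra hj
  have := h j hj
  rw [simplexForm_zero] at this
  exact this.false

lemma bijective_of_ne_zero {p : ℕ} {c : altCochains k (Option ι) Q p}
    (hc : c ∈ (simplexFam k ι Q).stalk p 0) {I : Fin (p + 1) → Option ι} (h : c.1 I ≠ 0) :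
    Function.Bijective I := by
  constructor
  · by_contra hI
    exact h (c.2.2 I hI)
  · by_contra hI
    have := hc I
    rw [simplexFam_of_notMem fun h => hI fun j => zero_mem_simplexOpen h j] at this
    exact h ((Submodule.mem_bot k).1 this)

lemma stalk_simplexFam_zero {m : ℕ} (hm : m ≠ Fintype.card ι) :
    (simplexFam k ι Q).stalk m 0 = ⊥ := by
  refine (Submodule.eq_bot_iff _).2 fun c hc => Subtype.ext (funext fun I => ?_)
  by_contra h
  have := Fintype.card_of_bijective (bijective_of_ne_zero hc h)
  simp at this
  exact hm this

variable (ι) in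
/-- An enumeration of the vertices. -/
def simplexEquiv : Fin (Fintype.card ι + 1) ≃ Option ι :=
  (Fintype.equivFinOfCardEq Fintype.card_option).symm

variable (k ι Q) in
/-- Evaluation of the top cochains. -/
def simplexEval : altCochains k (Option ι) Q (Fintype.card ι) →ₗ[k] Q where
  toFun c := c.1 (simplexEquiv ι)
  map_add' _ _ := rfl
  map_smul' _ _ := rfl

lemma simplexEval_injective {c : altCochains k (Option ι) Q (Fintype.card ι)}
    (hc : c ∈ (simplexFam k ι Q).stalk _ 0) (h : simplexEval k ι Q c = 0) : c = 0 := by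
  refine Subtype.ext (funext fun I => ?_)
  by_contra h'
  let π := (Equiv.ofBijective I (bijective_of_ne_zero hc h')).trans (simplexEquiv ι).symm
  have e : I = simplexEquiv ι ∘ π := by
    ext1 i
    simp [π]
  have h1 := c.2.1 (simplexEquiv ι) π
  rw [← e] at h1
  refine h' (h1.trans ?_)
  rw [show c.1 (simplexEquiv ι) = 0 from h, smul_zero]
  rfl

lemma simplexEval_surjective (w : Q) :
    ∃ c ∈ (simplexFam k ι Q).stalk (Fintype.card ι) 0, simplexEval k ι Q c = w := by
  classical
  let s : (Fin (Fintype.card ι + 1) → Option ι) → ℤ := fun I => if h : Function.Bijective I then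
    (Equiv.Perm.sign ((Equiv.ofBijective I h).trans (simplexEquiv ι).symm) : ℤ) else 0
  have hs : ∀ (I : Fin (Fintype.card ι + 1) → Option ι) (π : Equiv.Perm (Fin (Fintype.card ι + 1))),
      s (I ∘ π) = (Equiv.Perm.sign π : ℤ) * s I := by
    intro I π
    by_cases h : Function.Bijective I
    · have h' : Function.Bijective (I ∘ π) := h.comp π.bijective
      simp only [s, dif_pos h, dif_pos h']
      have e : (Equiv.ofBijective (I ∘ π) h').trans (simplexEquiv ι).symm =
          ((Equiv.ofBijective I h).trans (simplexEquiv ι).symm) * π := by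
        ext i
        simp
      rw [e, Equiv.Perm.sign_mul]
      push_cast
      ring
    · have h' : ¬ Function.Bijective (I ∘ π) := fun h' => h (by
        have := h'.comp π.symm.bijective
        rwa [Function.comp_assoc, Equiv.self_comp_symm, Function.comp_id] at this)
      simp only [s, dif_neg h, dif_neg h', mul_zero]
  have hs0 : ∀ I, ¬ Function.Bijective I → s I = 0 := fun I h => dif_neg h
  refine ⟨⟨fun I => s I • w, fun I π => ?_, fun I hI => ?_⟩, fun I => ?_, ?_⟩
  · dsimp only
    rw [hs, mul_smul]
  · dsimp only
    rw [hs0 I fun h => hI h.1, zero_smul]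
  · dsimp only
    by_cases h : Function.Bijective I
    · rw [simplexFam_of_mem]
      · trivial
      · intro j hj
        exact absurd (h.2 j) hj
    · rw [hs0 I h, zero_smul]
      exact zero_mem _
  · change s (simplexEquiv ι) • w = w
    have : s (simplexEquiv ι) = 1 := by
      have e : (Equiv.ofBijective (simplexEquiv ι) (simplexEquiv ι).bijective).trans
          (simplexEquiv ι).symm = 1 := by
        ext i
        simp
      simp only [s, dif_pos (simplexEquiv ι).bijective, e]
      simp
    rw [this, one_smul]

/-! ### The cohomology of constant Čech complexes -/

open DerivedCategory.Plus (Q)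

variable [HasDerivedCategory.{w₁} (Sh k (space ι))] [HasDerivedCategory.{w₂} (ModuleCat.{u} k)]

variable (k ι) in
/-- The compactly supported cohomology on `U` of a complex placed in degrees at least `-dim`. -/
abbrev hyper (U : Opens (space ι)) : CochainComplex (Sh k (space ι)) ℕ ⥤ ModuleCat.{u} k :=
  plusShift k (space ι) (Fintype.card ι) ⋙ DerivedCategory.Plus.Q ⋙ cohomologyC (k := k) 0 U

lemma isIso_hyper {U : Opens (space ι)} {K L : CochainComplex (Sh k (space ι)) ℕ} {f : K ⟶ L}
    (h : IsIso ((gammaC (k := k) U).rightDerivedFunctorPlus.map (DerivedCategory.Plus.Q.map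
      ((plusShift k (space ι) (Fintype.card ι)).map f)))) : IsIso ((hyper k ι U).map f) :=
  inferInstanceAs (IsIso ((DerivedCategory.Plus.homologyFunctor (ModuleCat.{u} k) 0).map
    ((gammaC (k := k) U).rightDerivedFunctorPlus.map (DerivedCategory.Plus.Q.map
      ((plusShift k (space ι) (Fintype.card ι)).map f)))))

variable (k ι Q) in
/-- The inclusion of the simplicial family in the constant one. -/
def simplexIncl : (simplexFam k ι Q).lc.Hom (CechFam.const k (Option ι) Q (space ι)).lc :=
  (simplexFam k ι Q).pull _ id LinearMap.id fun _ _ _ _ => trivial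

instance isIso_hyper_simplexIncl : IsIso ((hyper k ι ⊤).map (simplexIncl k ι Q).sheafMap) := by
  refine isIso_hyper (isIso_of_isRadialPair _ ⊤ (simplexFam k ι Q)
    (CechFam.const k (Option ι) Q (space ι)) (fun _ _ => le_top) fun T => ?_)
  obtain ⟨p, hp⟩ := isRadialPair_simplexFam (k := k) (Q := Q) T
  exact ⟨p, trivial, starConvex_univ p, hp⟩

variable (k ι Q) in
/-- The morphism from the simplicial family to the skyscraper sheaf at the origin. -/
def simplexSky : (plusShift k (space ι) (Fintype.card ι)).obj (simplexFam k ι Q).lc.sheafCx ⟶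
    (skyPlus k (X := space ι) (0 : ι → ℝ)).obj (ModuleCat.of k Q) :=
  (simplexFam k ι Q).lc.skyHom (0 : ι → ℝ) (Fintype.card ι) (ModuleCat.of k Q) (simplexEval k ι Q)
    fun _ hm => by exact stalk_simplexFam_zero hm

instance isIso_simplexSky :
    IsIso ((cohomologyC (k := k) 0 ⊤).map (DerivedCategory.Plus.Q.map (simplexSky k ι Q))) := by
  have : IsIso ((gammaC (k := k) ⊤).rightDerivedFunctorPlus.map
      (DerivedCategory.Plus.Q.map (simplexSky k ι Q))) :=
    isIso_of_quasiIso_stalk ⊤ _ fun x _ => LcCx.quasiIso_stalk_skyHom _ _ _ _ _ _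
      (fun c hc h => simplexEval_injective hc h) (fun w => simplexEval_surjective w)
      (fun x hx => quasiAtNat_simplexFam hx) x
  exact inferInstanceAs (IsIso ((DerivedCategory.Plus.homologyFunctor (ModuleCat.{u} k) 0).map
    ((gammaC (k := k) ⊤).rightDerivedFunctorPlus.map
      (DerivedCategory.Plus.Q.map (simplexSky k ι Q)))))

variable (k ι Q) in
/-- The compactly supported cohomology of the constant Čech complex. -/
def hyperConst : (hyper k ι ⊤).obj (CechFam.const k (Option ι) Q (space ι)).lc.sheafCx ≅
    ModuleCat.of k Q :=
  (asIso ((hyper k ι ⊤).map (simplexIncl k ι Q).sheafMap)).symm ≪≫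
    asIso ((cohomologyC (k := k) 0 ⊤).map (DerivedCategory.Plus.Q.map (simplexSky k ι Q))) ≪≫
    (cohomologyCSkyIso k (X := space ι) (0 : ι → ℝ)).app (ModuleCat.of k Q)

lemma inv_comp_square {C : Type*} [Category* C] {A B D E A' B' D' E' : C} {i : A ⟶ B} [IsIso i]
    {i' : A' ⟶ B'} [IsIso i'] {s : A ⟶ D} {s' : A' ⟶ D'} {t : D ⟶ E} {t' : D' ⟶ E'} {a : A ⟶ A'}
    {b : B ⟶ B'} {d : D ⟶ D'} {e : E ⟶ E'} (h1 : a ≫ i' = i ≫ b) (h2 : a ≫ s' = s ≫ d)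
    (h3 : d ≫ t' = t ≫ e) : b ≫ inv i' ≫ s' ≫ t' = (inv i ≫ s ≫ t) ≫ e := by
  rw [Category.assoc, Category.assoc, ← h3, ← reassoc_of% h2, IsIso.eq_inv_comp, ← reassoc_of% h1,
    IsIso.hom_inv_id_assoc]

lemma hyperConst_naturality (g : Q →ₗ[k] Q') (h) :
    (hyper k ι ⊤).map ((CechFam.const k (Option ι) Q (space ι)).pull
      (CechFam.const k (Option ι) Q' (space ι)) id g h).sheafMap ≫ (hyperConst k ι Q').hom =
    (hyperConst k ι Q).hom ≫ ModuleCat.ofHom g := by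
  have hm : ∀ {p : ℕ} (I : Fin (p + 1) → Option ι) (x : space ι),
      ∀ w ∈ (simplexFam k ι Q).F (id ∘ I) x, g w ∈ (simplexFam k ι Q').F I x := by
    intro p I x w hw
    by_cases hx : x ∈ simplexOpen (Set.range I)
    · rw [simplexFam_of_mem hx]
      trivial
    · rw [Function.id_comp, simplexFam_of_notMem hx] at hw
      rw [(Submodule.mem_bot k).1 hw, map_zero]
      exact zero_mem _
  let G := (simplexFam k ι Q).pull (simplexFam k ι Q') id g hm
  have e1 : G.sheafMap ≫ (simplexIncl k ι Q').sheafMap = (simplexIncl k ι Q).sheafMap ≫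
      ((CechFam.const k (Option ι) Q (space ι)).pull
      (CechFam.const k (Option ι) Q' (space ι)) id g h).sheafMap := by
    ext p : 1
    rfl
  have e2 : (plusShift k (space ι) (Fintype.card ι)).map G.sheafMap ≫ simplexSky k ι Q' =
      simplexSky k ι Q ≫ (skyPlus k (X := space ι) (0 : ι → ℝ)).map (ModuleCat.ofHom g) :=
    LcCx.skyHom_naturality _ _ _ _ _ _ _ _ _ _ _ _ fun w => rfl
  have e3 := (cohomologyCSkyIso k (X := space ι) (0 : ι → ℝ)).hom.naturality (ModuleCat.ofHom g)
  have e1' := congrArg (hyper k ι ⊤).map e1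
  have e2' := congrArg (fun f => (cohomologyC (k := k) 0 ⊤).map (DerivedCategory.Plus.Q.map f)) e2
  simp only [Functor.map_comp] at e1' e2'
  exact inv_comp_square e1' e2' e3

end Simplex

end Toric

end

noncomputable section
namespace Toric

/-! ### Convex geometry of the cones of a fan -/

section Geometry

variable {ι : Type u} [Fintype ι]

lemma pos_dotProduct_of_mem_hull {s : Set (ι → ℝ)} {u : ι → ℝ}
    (h : ∀ g ∈ s, g ≠ 0 → 0 < u ⬝ᵥ g) {x : ι → ℝ} (hx : x ∈ PointedCone.hull ℝ s) :
    x = 0 ∨ 0 < u ⬝ᵥ x := by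
  induction hx using Submodule.span_induction with
  | mem g hg => exact or_iff_not_imp_left.2 (h g hg)
  | zero => exact .inl rfl
  | add x y _ _ hx hy =>
    rcases hx with rfl | hx
    · simpa using hy
    rcases hy with rfl | hy
    · simpa using Or.inr hx
    exact .inr (by rw [dotProduct_add]; exact add_pos hx hy)
  | smul a x _ hx =>
    rcases hx with rfl | hx
    · simp
    rcases eq_or_lt_of_le a.2 with ha | ha
    · exact .inl (by rw [show a = 0 from Subtype.ext ha.symm, zero_smul])
    · refine .inr ?_
      rw [show a • x = (a : ℝ) • x from rfl, dotProduct_smul, smul_eq_mul]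
      exact mul_pos ha hx

lemma mem_openDual_hull {s : Set (ι → ℝ)} {χ : ι → ℤ} {v : ι → ℝ} :
    v ∈ openDual (PointedCone.hull ℝ s) χ ↔
      ∀ g ∈ s, g ≠ 0 → toReal χ ⬝ᵥ g < v ⬝ᵥ g := by
  refine ⟨fun h g hg => h g (PointedCone.subset_hull hg), fun h x hx hx0 => ?_⟩
  have := pos_dotProduct_of_mem_hull (u := v - toReal χ)
    (fun g hg hg0 => by rw [sub_dotProduct]; exact sub_pos.2 (h g hg hg0)) hx
  rw [sub_dotProduct, sub_pos] at this
  exact this.resolve_left hx0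

lemma isOpen_openDual_hull {s : Set (ι → ℝ)} (hs : s.Finite) (χ : ι → ℤ) :
    IsOpen (openDual (PointedCone.hull ℝ s) χ) := by
  have : openDual (PointedCone.hull ℝ s) χ =
      ⋂ g ∈ s, {v : ι → ℝ | g ≠ 0 → toReal χ ⬝ᵥ g < v ⬝ᵥ g} := by
    ext v
    simp [mem_openDual_hull]
  rw [this]
  refine hs.isOpen_biInter fun g _ => ?_
  by_cases hg : g = 0
  · simp [hg]
  · simpa [hg] using isOpen_lt continuous_const
      (by fun_prop : Continuous fun v : ι → ℝ => v ⬝ᵥ g)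

lemma convex_openDual (σ : PointedCone ℝ (ι → ℝ)) (χ : ι → ℤ) : Convex ℝ (openDual σ χ) := by
  intro v hv w hw a b ha hb hab x hx hx0
  rw [add_dotProduct, smul_dotProduct, smul_dotProduct, smul_eq_mul, smul_eq_mul]
  have h1 := hv x hx hx0
  have h2 := hw x hx hx0
  have hb' : b = 1 - a := by linarith
  rcases eq_or_lt_of_le ha with rfl | ha
  · simpa [hb'] using h2
  · have h3 := mul_pos ha (sub_pos.2 h1)
    have h4 := mul_nonneg hb (sub_pos.2 h2).le
    calc toReal χ ⬝ᵥ x = a * toReal χ ⬝ᵥ x + b * toReal χ ⬝ᵥ x := by rw [← add_mul, hab, one_mul]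
      _ < _ := by linarith

/-- A linear subspace that meets a cone inside a face is separated from any finite set of points
of the cone off the face. -/
lemma exists_dotProduct_eq_zero_pos {σ τ : PointedCone ℝ (ι → ℝ)} (hτ : τ.IsFaceOf σ)
    (L : Submodule ℝ (ι → ℝ)) (hL : ∀ x ∈ L, x ∈ σ → x ∈ τ) {G : Set (ι → ℝ)} (hG : G.Finite)
    (hGσ : ∀ g ∈ G, g ∈ σ ∧ g ∉ τ) :
    ∃ u : ι → ℝ, (∀ l ∈ L, u ⬝ᵥ l = 0) ∧ ∀ g ∈ G, 0 < u ⬝ᵥ g := by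
  classical
  have hconv : Convex ℝ {x | x ∈ σ ∧ x ∉ τ} := by
    intro x hx y hy a b ha hb hab
    refine ⟨add_mem (σ.smul_mem ha hx.1) (σ.smul_mem hb hy.1), fun h => ?_⟩
    rcases eq_or_lt_of_le ha with rfl | ha
    · exact hy.2 (by simpa [show b = 1 by linarith] using h)
    · exact hx.2 (hτ.mem_of_smul_add_mem hx.1 (σ.smul_mem hb hy.1) ha h)
  have hsub : convexHull ℝ G ⊆ {x | x ∈ σ ∧ x ∉ τ} := convexHull_min hGσ hconv
  have hdisj : Disjoint (convexHull ℝ G) (L : Set (ι → ℝ)) :=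
    Set.disjoint_left.2 fun x hx hxL => (hsub hx).2 (hL x hxL (hsub hx).1)
  obtain ⟨f, u, v, hf, huv, hfL⟩ := geometric_hahn_banach_compact_closed
    (convex_convexHull ℝ G) (hG.isCompact_convexHull ℝ) L.convex L.closed_of_finiteDimensional hdisj
  have hv : v < 0 := by simpa using hfL 0 L.zero_mem
  have h0 : ∀ l ∈ L, f l = 0 := by
    intro l hl
    by_contra h
    have := hfL (((v - 1) / f l) • l) (L.smul_mem _ hl)
    rw [map_smul, smul_eq_mul, div_mul_cancel₀ _ h] at this
    linarith
  have hdot : ∀ x, (fun i => - f (Pi.single i 1)) ⬝ᵥ x = - f x := by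
    intro x
    have hx : x = ∑ i, x i • (Pi.single i (1 : ℝ) : ι → ℝ) := by
      ext j
      simp [Finset.sum_apply, Pi.single_apply]
    conv_rhs => rw [hx, map_sum]
    simp [dotProduct, mul_comm]
  refine ⟨fun i => - f (Pi.single i 1), fun l hl => by rw [hdot, h0 l hl, neg_zero],
    fun g hg => ?_⟩
  rw [hdot]
  have := hf g (subset_convexHull ℝ G hg)
  linarith

lemma bot_isFaceOf {V : Type*} [AddCommGroup V] [Module ℝ V] {σ : PointedCone ℝ V}
    (h : ∀ x ∈ σ, -x ∈ σ → x = 0) : (⊥ : PointedCone ℝ V).IsFaceOf σ := by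
  refine ⟨bot_le, ?_⟩
  intro x y a hx hy ha h0
  have h0 : a • x + y = 0 := by simpa using h0
  have : a • x = 0 := h _ (σ.smul_mem ha.le hx) (by rwa [neg_eq_of_add_eq_zero_right h0])
  simpa [ha.ne'] using this

/-- A strongly convex cone with finitely many generators has an interior point of its dual. -/
lemma exists_pos_of_stronglyConvex {s : Set (ι → ℝ)} (hs : s.Finite)
    (h : ∀ x ∈ PointedCone.hull ℝ s, -x ∈ PointedCone.hull ℝ s → x = 0) :
    ∃ u : ι → ℝ, ∀ x ∈ PointedCone.hull ℝ s, x ≠ 0 → 0 < u ⬝ᵥ x := by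
  obtain ⟨u, -, hu⟩ := exists_dotProduct_eq_zero_pos (bot_isFaceOf h) ⊥
    (fun x hx _ => by simpa using hx) (hs.subset (Set.sdiff_subset (t := {0})))
    (fun g hg => ⟨PointedCone.subset_hull hg.1, by simpa using hg.2⟩)
  exact ⟨u, fun x hx hx0 =>
    (pos_dotProduct_of_mem_hull (fun g hg hg0 => hu g ⟨hg, hg0⟩) hx).resolve_left hx0⟩

/-- Far along a positive direction lie points of any finite number of sets `(χ + σ^∨)°`. -/
lemma exists_forall_ge_add_smul_mem_openDual {s : Set (ι → ℝ)} (hs : s.Finite) {u p : ι → ℝ}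
    {C : Set (ι → ℤ)} (hC : C.Finite)
    (h : ∀ g ∈ s, g ≠ 0 → 0 < u ⬝ᵥ g ∨ (u ⬝ᵥ g = 0 ∧ ∀ χ ∈ C, toReal χ ⬝ᵥ g < p ⬝ᵥ g)) :
    ∃ R : ℝ, ∀ r ≥ R, ∀ χ ∈ C, p + r • u ∈ openDual (PointedCone.hull ℝ s) χ := by
  have key : ∀ᶠ r : ℝ in Filter.atTop, ∀ χ ∈ C, ∀ g ∈ s, g ≠ 0 →
      toReal χ ⬝ᵥ g < (p + r • u) ⬝ᵥ g := by
    rw [hC.eventually_all]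
    intro χ hχ
    rw [hs.eventually_all]
    intro g hg
    by_cases hg0 : g = 0
    · exact Filter.Eventually.of_forall fun r h => absurd hg0 h
    simp only [add_dotProduct, smul_dotProduct, smul_eq_mul]
    rcases h g hg hg0 with h | ⟨h, h'⟩
    · filter_upwards [(Filter.tendsto_id.atTop_mul_const h).eventually_gt_atTop
        (toReal χ ⬝ᵥ g - p ⬝ᵥ g)] with r hr _
      simp only [id] at hr
      linarith
    · refine Filter.Eventually.of_forall fun r _ => ?_
      rw [h, mul_zero, add_zero]
      exact h' χ hχ
  obtain ⟨R, hR⟩ := Filter.eventually_atTop.1 key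
  exact ⟨R, fun r hr χ hχ => mem_openDual_hull.2 (hR r hr χ hχ)⟩

variable {Δ : Fan ι}

lemma Fan.Cone.exists_hull (σ : Δ.Cone) :
    ∃ s : Set (ι → ℝ), s.Finite ∧ σ.1 = PointedCone.hull ℝ s := by
  obtain ⟨s, hs⟩ := Δ.rational σ.1 σ.2
  exact ⟨_, s.finite_toSet.image _, hs⟩

lemma Fan.Cone.isOpen_openDual (σ : Δ.Cone) (χ : ι → ℤ) : IsOpen (openDual σ.1 χ) := by
  obtain ⟨s, hs, e⟩ := σ.exists_hull
  rw [e]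
  exact isOpen_openDual_hull hs χ

/-- Finitely many of the sets `(χ + σ^∨)°` have a common point. -/
lemma Fan.Cone.exists_mem_openDual (σ : Δ.Cone) {C : Set (ι → ℤ)} (hC : C.Finite) :
    ∃ p, ∀ χ ∈ C, p ∈ openDual σ.1 χ := by
  obtain ⟨s, hs, e⟩ := σ.exists_hull
  have hσ := Δ.stronglyConvex σ.1 σ.2
  rw [e] at hσ ⊢
  obtain ⟨u, hu⟩ := exists_pos_of_stronglyConvex hs hσ
  obtain ⟨R, hR⟩ := exists_forall_ge_add_smul_mem_openDual hs (u := u) (p := 0) hC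
    (fun g hg hg0 => .inl (hu g (PointedCone.subset_hull hg) hg0))
  exact ⟨_, hR R le_rfl⟩

/-- If `α ∉ σ`, a half-space `α < t` meets the intersection of finitely many of the sets
`(χ + σ^∨)°`, provided that `α` generates a ray of the fan. -/
lemma Fan.Cone.exists_mem_openDual_lt (σ : Δ.Cone) {ρ : Δ.Cone} {α : ι → ℤ}
    (hα : IsRayGenerator ρ α) (hσα : toReal α ∉ σ.1) {C : Set (ι → ℤ)} (hC : C.Finite) (t : ℝ) :
    ∃ p, toReal α ⬝ᵥ p < t ∧ ∀ χ ∈ C, p ∈ openDual σ.1 χ := by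
  obtain ⟨s, hs, e⟩ := σ.exists_hull
  have hσ := Δ.stronglyConvex σ.1 σ.2
  have hins : ∀ x ∈ PointedCone.hull ℝ (insert (-toReal α) s), ∃ a : ℝ, 0 ≤ a ∧ ∃ y ∈ σ.1,
      x = y - a • toReal α := by
    intro x hx
    obtain ⟨a, y, hy, rfl⟩ := Submodule.mem_span_insert.1 hx
    refine ⟨a, a.2, y, by rw [e]; exact hy, ?_⟩
    rw [show a • (-toReal α) = (a : ℝ) • (-toReal α) from rfl, smul_neg]
    abel
  have hpos : ∀ a : ℝ, 0 ≤ a → ∀ y ∈ σ.1, y = a • toReal α → a = 0 := by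
    intro a ha y hy hya
    by_contra h
    refine hσα ?_
    have := σ.1.smul_mem (inv_nonneg.2 ha) hy
    rwa [hya, smul_smul, inv_mul_cancel₀ h, one_smul] at this
  have hstr : ∀ x ∈ PointedCone.hull ℝ (insert (-toReal α) s),
      -x ∈ PointedCone.hull ℝ (insert (-toReal α) s) → x = 0 := by
    intro x hx hx'
    obtain ⟨a, ha, y, hy, h1⟩ := hins x hx
    obtain ⟨b, hb, z, hz, h2⟩ := hins (-x) hx'
    have h3 : y + z = (a + b) • toReal α := by
      rw [h1] at h2
      rw [add_smul]
      linear_combination - h2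
    have h4 := hpos _ (add_nonneg ha hb) _ (add_mem hy hz) h3
    have ha0 : a = 0 := by linarith
    have hb0 : b = 0 := by linarith
    rw [ha0, hb0, add_zero, zero_smul] at h3
    have : y = 0 := hσ y hy (by rwa [neg_eq_of_add_eq_zero_right h3])
    rw [h1, this, ha0, zero_smul, sub_zero]
  obtain ⟨u, hu⟩ := exists_pos_of_stronglyConvex (hs.insert _) hstr
  have hα0 : toReal α ≠ 0 := by
    intro h
    exact hα.1 (funext fun i => by simpa [toReal] using congrFun h i)
  have huα : u ⬝ᵥ toReal α < 0 := by
    have := hu _ (PointedCone.subset_hull (Set.mem_insert _ _)) (neg_ne_zero.2 hα0)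
    rw [dotProduct_neg] at this
    linarith
  rw [e]
  obtain ⟨R, hR⟩ := exists_forall_ge_add_smul_mem_openDual hs (u := u) (p := 0) hC
    (fun g hg hg0 => .inl (hu g (PointedCone.subset_hull (Set.mem_insert_of_mem _ hg)) hg0))
  obtain ⟨r, hr, hr'⟩ := ((Filter.eventually_ge_atTop R).and
    ((Filter.tendsto_id.atTop_mul_const_of_neg huα).eventually_lt_atBot t)).exists
  refine ⟨_, ?_, hR r hr⟩
  rw [zero_add, dotProduct_smul, dotProduct_comm, smul_eq_mul]
  exact hr'

lemma toReal_dotProduct_toReal (a b : ι → ℤ) : toReal a ⬝ᵥ toReal b = ((a ⬝ᵥ b : ℤ) : ℝ) := by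
  simp [toReal, dotProduct]

/-- If `α ∈ σ`, the slab `j < α < t` meets the intersection of finitely many of the sets
`(χ + σ^∨)°` with `⟨α, χ⟩ ≤ j`, provided that `α` generates a ray of the fan. -/
lemma Fan.Cone.exists_mem_openDual_slab (σ : Δ.Cone) {ρ : Δ.Cone} {α : ι → ℤ}
    (hα : IsRayGenerator ρ α) (hσα : toReal α ∈ σ.1) {C : Set (ι → ℤ)} (hC : C.Finite) {j : ℤ}
    {t : ℝ} (hjt : (j : ℝ) < t) (hCj : ∀ χ ∈ C, α ⬝ᵥ χ ≤ j) :
    ∃ p, toReal α ⬝ᵥ p < t ∧ ∀ χ ∈ C, p ∈ openDual σ.1 χ := by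
  obtain ⟨s, hs, e⟩ := σ.exists_hull
  have hρσ : ρ.1 ≤ σ.1 := by
    rw [hα.2]
    exact Submodule.span_le.2 (by simpa using hσα)
  have hface : ρ.1.IsFaceOf σ.1 := by
    have := Δ.inter_isFaceOf σ.1 σ.2 ρ.1 ρ.2
    rwa [inf_eq_right.2 hρσ] at this
  have hα0 : toReal α ≠ 0 := by
    intro h
    exact hα.1 (funext fun i => by simpa [toReal] using congrFun h i)
  have hmem : ∀ x, x ∈ ρ.1 → ∃ a : ℝ, 0 ≤ a ∧ a • toReal α = x := by
    intro x hx
    rw [hα.2] at hx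
    obtain ⟨a, rfl⟩ := Submodule.mem_span_singleton.1 hx
    exact ⟨a, a.2, rfl⟩
  obtain ⟨u, hu0, hu⟩ := exists_dotProduct_eq_zero_pos hface (ℝ ∙ toReal α)
    (by
      intro x hx hxσ
      obtain ⟨a, rfl⟩ := Submodule.mem_span_singleton.1 hx
      rcases le_or_gt 0 a with ha | ha
      · exact ρ.1.smul_mem ha hα.mem
      · exfalso
        have h1 : -toReal α ∈ σ.1 := by
          have := σ.1.smul_mem (inv_nonneg.2 (neg_nonneg.2 ha.le)) hxσ
          rwa [smul_smul, inv_neg, neg_mul, inv_mul_cancel₀ ha.ne, neg_one_smul] at this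
        exact hα0 (Δ.stronglyConvex σ.1 σ.2 _ hσα h1))
    (hs.subset (Set.sdiff_subset (t := (ρ.1 : Set (ι → ℝ)))))
    (fun g hg => ⟨by rw [e]; exact PointedCone.subset_hull hg.1, hg.2⟩)
  have huα : u ⬝ᵥ toReal α = 0 := hu0 _ (Submodule.mem_span_singleton_self _)
  have hnorm : 0 < toReal α ⬝ᵥ toReal α := by
    rw [lt_iff_le_and_ne]
    refine ⟨Finset.sum_nonneg fun i _ => mul_self_nonneg _, fun h => hα0 ?_⟩
    exact dotProduct_self_eq_zero.1 h.symm
  let p : ι → ℝ := (((j + t) / 2) / (toReal α ⬝ᵥ toReal α)) • toReal α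
  have hp : p ⬝ᵥ toReal α = (j + t) / 2 := by
    rw [smul_dotProduct, smul_eq_mul, div_mul_cancel₀ _ hnorm.ne']
  rw [e]
  obtain ⟨R, hR⟩ := exists_forall_ge_add_smul_mem_openDual hs (u := u) (p := p) hC
    (by
      intro g hg hg0
      by_cases hgρ : g ∈ ρ.1
      · right
        obtain ⟨a, ha, rfl⟩ := hmem g hgρ
        have ha : 0 < a := lt_of_le_of_ne ha fun h => hg0 (by rw [← h, zero_smul])
        refine ⟨by rw [dotProduct_smul, huα, smul_zero], fun χ hχ => ?_⟩
        rw [dotProduct_smul, dotProduct_smul, smul_eq_mul, smul_eq_mul, hp,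
          toReal_dotProduct_toReal, dotProduct_comm]
        refine mul_lt_mul_of_pos_left ?_ ha
        have : ((α ⬝ᵥ χ : ℤ) : ℝ) ≤ j := by exact_mod_cast hCj χ hχ
        linarith
      · exact .inl (hu g ⟨hg, hgρ⟩))
  refine ⟨_, ?_, hR R le_rfl⟩
  rw [dotProduct_comm, add_dotProduct, hp, smul_dotProduct, huα, smul_zero]
  linarith

end Geometry
end Toric
end

noncomputable section
namespace Toric

/-! ### Homogeneous generators and the Klyachko filtrations -/

section Generators

lemma inf_iSup_le_of_iSupIndep {k V J : Type*} [Ring k] [AddCommGroup V] [Module k V]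
    {D N : J → Submodule k V} (hD : iSupIndep D) (hN : N ≤ D) (m : J) : D m ⊓ ⨆ i, N i ≤ N m := by
  rintro x ⟨hx, hx'⟩
  rw [SetLike.mem_coe, iSup_split_single N m] at hx'
  obtain ⟨a, ha, b, hb, rfl⟩ := Submodule.mem_sup.1 hx'
  have hbD : b ∈ D m := by simpa using sub_mem hx (hN m ha)
  have : b = 0 := Submodule.disjoint_def.1 (hD m) b hbD
    ((iSup₂_mono fun i _ => hN i : (⨆ (i) (_ : i ≠ m), N i) ≤ _) hb)
  simpa [this] using ha

variable {ι : Type u} [Fintype ι] {k : Type u} [CommRing k] {Δ : Fan ι} (E : Bundle k Δ)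

lemma Bundle.value_single_smul (σ : Δ.Cone) (s : semigroup σ.1) (p : E.sec σ) :
    E.value σ ((AddMonoidAlgebra.single s 1 : Coord k σ.1) • p) = E.value σ p := by
  rw [E.value_smul]
  simp [evalOne]

lemma Bundle.value_res {σ τ : Δ.Cone} (h : τ ≤ σ) (p : E.sec σ) :
    E.value τ (E.res h p) = E.value σ p := by
  simp [Bundle.value, E.res_res]

lemma Bundle.value_zero (p : E.sec Δ.zero) : E.value Δ.zero p = E.fiberMk p :=
  congrArg E.fiberMk (E.res_refl _ p)

lemma Bundle.value_surjective (σ : Δ.Cone) : Function.Surjective (E.value σ) := by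
  intro e
  obtain ⟨q, rfl⟩ := E.fiberMk_surjective e
  obtain ⟨s, p, -, hp⟩ := E.res_surj (Δ.zero_le σ) q
  refine ⟨p, ?_⟩
  rw [← E.value_res (Δ.zero_le σ), hp, E.value_single_smul, E.value_zero]

/-- A homogeneous section of a restriction agrees at `x₀` with a homogeneous section over the
larger chart, whose degree differs by a character that is a unit on the smaller chart. -/
lemma Bundle.exists_value_eq {σ τ : Δ.Cone} (h : τ ≤ σ) {m : ι → ℤ} {q : E.sec τ}
    (hq : q ∈ E.deg τ m) : ∃ s ∈ semigroup τ.1, -s ∈ semigroup τ.1 ∧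
      ∃ p ∈ E.deg σ (s + m), E.value σ p = E.value τ q := by
  obtain ⟨s, p, hs, hp⟩ := E.res_surj h q
  have hmem := E.single_smul_mem τ ⟨s.1, semigroup_anti h s.2⟩ 1 m q hq
  have hsup : E.res h p ∈ ⨆ m, (E.deg σ m).map (E.res h) := by
    rw [← Submodule.map_iSup, (E.isInternal σ).submodule_iSup_eq_top]
    exact Submodule.mem_map_of_mem Submodule.mem_top
  rw [hp] at hsup
  obtain ⟨p', hp', hpp⟩ := inf_iSup_le_of_iSupIndep (E.isInternal τ).submodule_iSupIndep
    (fun m => Submodule.map_le_iff_le_comap.2 fun p hp => E.res_mem h m p hp) _ ⟨hmem, hsup⟩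
  refine ⟨s.1, semigroup_anti h s.2, hs, p', hp', ?_⟩
  rw [← E.value_res h, hpp, E.value_single_smul]

/-- Over every chart the values of the homogeneous sections are spanned by the values of a finite
system of homogeneous generators. -/
lemma Bundle.exists_generators (σ : Δ.Cone) :
    ∃ (J : Type u) (_ : Finite J) (χ : J → ι → ℤ) (e : J → E.fiber),
      (∀ m, (E.deg σ m).map (E.value σ) =
        Submodule.span k (e '' {i | m - χ i ∈ semigroup σ.1})) ∧
      Submodule.span k (Set.range e) = ⊤ := by
  classical
  have htop : Submodule.span (Coord k σ.1) (⋃ m, (E.deg σ m : Set (E.sec σ))) = ⊤ := by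
    refine top_le_iff.1 fun p _ => ?_
    have hp : p ∈ ⨆ m, E.deg σ m := by
      rw [(E.isInternal σ).submodule_iSup_eq_top]
      trivial
    have hle : (⨆ m, E.deg σ m) ≤ (Submodule.span (Coord k σ.1)
        (⋃ m, (E.deg σ m : Set (E.sec σ)))).restrictScalars k :=
      iSup_le fun m q hq => Submodule.subset_span (Set.mem_iUnion.2 ⟨m, hq⟩)
    exact hle hp
  obtain ⟨G, hG, hspan⟩ := Submodule.fg_span_iff_fg_span_finset_subset _ |>.1
    (htop ▸ (E.finite σ).fg_top : (Submodule.span (Coord k σ.1)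
      (⋃ m, (E.deg σ m : Set (E.sec σ)))).FG)
  rw [htop] at hspan
  choose χ hχ using fun g : G => Set.mem_iUnion.1 (hG g.2)
  let N : (ι → ℤ) → Submodule k (E.sec σ) := fun m =>
    Submodule.span k {q | ∃ (g : G) (s : semigroup σ.1), s.1 + χ g = m ∧
      q = (AddMonoidAlgebra.single s 1 : Coord k σ.1) • g.1}
  have hN : N ≤ E.deg σ := by
    intro m
    refine Submodule.span_le.2 ?_
    rintro _ ⟨g, s, rfl, rfl⟩
    exact E.single_smul_mem σ s 1 _ _ (hχ g)
  have hgen : ∀ (a : Coord k σ.1) (g : G), a • g.1 ∈ ⨆ m, N m := by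
    intro a g
    induction a using AddMonoidAlgebra.induction_linear with
    | zero => simp
    | add a b ha hb => rw [add_smul]; exact add_mem ha hb
    | single s c =>
      have : (AddMonoidAlgebra.single s c : Coord k σ.1) • g.1 =
          c • (AddMonoidAlgebra.single s 1 : Coord k σ.1) • g.1 := by
        rw [← smul_assoc, AddMonoidAlgebra.smul_single, smul_eq_mul, mul_one]
      rw [this]
      exact Submodule.smul_mem _ _ (Submodule.mem_iSup_of_mem _
        (Submodule.subset_span ⟨g, s, rfl, rfl⟩))
  have hNtop : ∀ p, p ∈ ⨆ m, N m := by
    intro p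
    have hp : p ∈ Submodule.span (Coord k σ.1) (Set.range ((↑) : G → E.sec σ)) := by
      rw [Subtype.range_coe_subtype, Finset.setOfPred_mem, ← hspan]
      trivial
    obtain ⟨c, rfl⟩ := (Submodule.mem_span_range_iff_exists_fun _).1 hp
    exact sum_mem fun g _ => hgen _ g
  have hmap : ∀ m, (E.deg σ m).map (E.value σ) =
      Submodule.span k ((fun g : G => E.value σ g.1) '' {i | m - χ i ∈ semigroup σ.1}) := by
    intro m
    refine le_antisymm ?_ (Submodule.span_le.2 ?_)
    · refine (Submodule.map_mono fun p hp => inf_iSup_le_of_iSupIndep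
        (E.isInternal σ).submodule_iSupIndep hN m ⟨hp, hNtop p⟩).trans ?_
      refine Submodule.map_le_iff_le_comap.2 (Submodule.span_le.2 ?_)
      rintro _ ⟨g, s, rfl, rfl⟩
      refine Submodule.subset_span ⟨g, ?_, (E.value_single_smul σ s _).symm⟩
      rw [Set.mem_ofPred_eq, add_sub_cancel_right]
      exact s.2
    · rintro _ ⟨g, hg, rfl⟩
      refine ⟨(AddMonoidAlgebra.single (⟨m - χ g, hg⟩ : semigroup σ.1) 1 : Coord k σ.1) • g.1,
        ?_, E.value_single_smul σ _ _⟩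
      have := E.single_smul_mem σ ⟨m - χ g, hg⟩ 1 _ _ (hχ g)
      rwa [sub_add_cancel] at this
  refine ⟨G, inferInstance, χ, fun g => E.value σ g.1, hmap, top_le_iff.1 ?_⟩
  rw [← LinearMap.range_eq_top.2 (E.value_surjective σ), LinearMap.range_eq_map,
    ← (E.isInternal σ).submodule_iSup_eq_top, Submodule.map_iSup]
  refine iSup_le fun m => ?_
  rw [hmap]
  exact Submodule.span_mono (Set.image_subset_range _ _)

lemma Bundle.klyachko_eq_iSup (σ : Δ.Cone) (α : ι → ℤ) (hα : toReal α ∈ σ.1) (j : ℤ) :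
    E.klyachko σ α hα j = ⨆ (m : ι → ℤ) (_ : α ⬝ᵥ m ≤ j), (E.deg σ m).map (E.value σ) := by
  refine le_antisymm ?_ (iSup₂_le fun m hm => ?_)
  · rintro _ ⟨s, hs, rfl⟩
    refine AddSubgroup.closure_induction (p := fun s _ => E.curveValue σ α hα s ∈
      ⨆ (m : ι → ℤ) (_ : α ⬝ᵥ m ≤ j), (E.deg σ m).map (E.value σ)) ?_ ?_ ?_ ?_ hs
    · rintro _ ⟨n, m, p, hp, hj, rfl⟩
      rw [E.curveValue_curveTmul]
      refine Submodule.smul_mem _ _ (Submodule.mem_iSup_of_mem m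
        (Submodule.mem_iSup_of_mem (by lia) (Submodule.mem_map_of_mem hp)))
    · rw [map_zero]
      exact zero_mem _
    · intro x y _ _ hx hy
      rw [map_add]
      exact add_mem hx hy
    · intro x _ hx
      rw [map_neg]
      exact neg_mem hx
  · rintro _ ⟨p, hp, rfl⟩
    refine ⟨_, AddSubgroup.subset_closure
      ⟨(j - α ⬝ᵥ m).toNat, m, p, hp, by rw [Int.toNat_of_nonneg (by lia)]; ring, rfl⟩, ?_⟩
    rw [E.curveValue_curveTmul]
    simp

/-- The Klyachko filtration does not depend on the chart. -/
lemma Bundle.klyachko_eq_of_le {σ τ : Δ.Cone} (h : τ ≤ σ) (α : ι → ℤ) (hα : toReal α ∈ τ.1)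
    (j : ℤ) : E.klyachko τ α hα j = E.klyachko σ α (h hα) j := by
  rw [E.klyachko_eq_iSup, E.klyachko_eq_iSup]
  refine le_antisymm (iSup₂_le fun m hm => ?_) (iSup₂_le fun m hm => ?_)
  · rintro _ ⟨q, hq, rfl⟩
    obtain ⟨s, hs, hs', p, hp, hpq⟩ := E.exists_value_eq h hq
    have h1 := hs _ hα
    have h2 := hs' _ hα
    rw [toReal_dotProduct_toReal, dotProduct_comm] at h1 h2
    rw [dotProduct_neg] at h2
    have h1' : 0 ≤ α ⬝ᵥ s := by exact_mod_cast h1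
    have h2' : 0 ≤ -(α ⬝ᵥ s) := by exact_mod_cast h2
    refine Submodule.mem_iSup_of_mem (s + m) (Submodule.mem_iSup_of_mem ?_ ⟨p, hp, hpq⟩)
    rw [dotProduct_add]
    lia
  · rintro _ ⟨p, hp, rfl⟩
    exact Submodule.mem_iSup_of_mem m (Submodule.mem_iSup_of_mem hm
      ⟨E.res h p, E.res_mem h m p hp, E.value_res h p⟩)

lemma Bundle.klyachko_eq_span (σ : Δ.Cone) {J : Type*} (e : J → E.fiber) (χ : J → ι → ℤ)
    (h : ∀ m, (E.deg σ m).map (E.value σ) =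
      Submodule.span k (e '' {i | m - χ i ∈ semigroup σ.1}))
    (α : ι → ℤ) (hα : toReal α ∈ σ.1) (j : ℤ) :
    E.klyachko σ α hα j = Submodule.span k (e '' {i | α ⬝ᵥ χ i ≤ j}) := by
  rw [E.klyachko_eq_iSup]
  refine le_antisymm (iSup₂_le fun m hm => ?_) (Submodule.span_le.2 ?_)
  · rw [h]
    refine Submodule.span_mono (Set.image_mono fun i hi => ?_)
    have h1 := hi _ hα
    rw [toReal_dotProduct_toReal, dotProduct_comm, dotProduct_sub] at h1
    have h1' : 0 ≤ α ⬝ᵥ m - α ⬝ᵥ χ i := by exact_mod_cast h1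
    exact (by lia : α ⬝ᵥ χ i ≤ j)
  · rintro _ ⟨i, hi, rfl⟩
    refine Submodule.mem_iSup_of_mem (χ i) (Submodule.mem_iSup_of_mem hi ?_)
    rw [h]
    refine Submodule.subset_span ⟨i, ?_, rfl⟩
    rw [Set.mem_ofPred_eq, sub_self]
    exact zero_mem _

lemma Bundle.eventually_kappaStalk_le (σ : Δ.Cone) (v : ι → ℝ) :
    ∀ᶠ w in nhds v, E.kappaStalk σ v ≤ E.kappaStalk σ w := by
  obtain ⟨J, _, χ, e, h, -⟩ := E.exists_generators σ
  have : ∀ᶠ w in nhds v, ∀ i, v ∈ openDual σ.1 (χ i) → w ∈ openDual σ.1 (χ i) := by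
    rw [Filter.eventually_all]
    intro i
    by_cases hi : v ∈ openDual σ.1 (χ i)
    · filter_upwards [(σ.isOpen_openDual (χ i)).mem_nhds hi] with w hw _ using hw
    · exact Filter.Eventually.of_forall fun w h => absurd h hi
  filter_upwards [this] with w hw
  rw [E.kappaStalk_eq_span σ e χ h, E.kappaStalk_eq_span σ e χ h]
  exact Submodule.span_mono (Set.image_mono hw)

lemma Bundle.exists_radial_kappaStalk (σ : Δ.Cone) :
    ∃ p, E.kappaStalk σ p = ⊤ ∧
      ∀ y, ∀ x ∈ segment ℝ p y, E.kappaStalk σ y ≤ E.kappaStalk σ x := by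
  obtain ⟨J, _, χ, e, h, htop⟩ := E.exists_generators σ
  obtain ⟨p, hp⟩ := σ.exists_mem_openDual (Set.finite_range χ)
  rw [Set.forall_mem_range] at hp
  refine ⟨p, ?_, fun y x hx => ?_⟩
  · rw [E.kappaStalk_eq_span σ e χ h, ← htop, ← Set.image_univ]
    congr 2
    exact Set.eq_univ_of_forall hp
  · rw [E.kappaStalk_eq_span σ e χ h, E.kappaStalk_eq_span σ e χ h]
    exact Submodule.span_mono (Set.image_mono fun i hi =>
      (convex_openDual σ.1 (χ i)).segment_subset (hp i) hi hx)

lemma Bundle.exists_radial_kappaStalk_of_notMem (σ : Δ.Cone) {ρ : Δ.Cone} {α : ι → ℤ}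
    (hα : IsRayGenerator ρ α) (hσα : toReal α ∉ σ.1) (t : ℝ) :
    ∃ p, toReal α ⬝ᵥ p < t ∧ E.kappaStalk σ p = ⊤ ∧
      ∀ y, ∀ x ∈ segment ℝ p y, E.kappaStalk σ y ≤ E.kappaStalk σ x := by
  obtain ⟨J, _, χ, e, h, htop⟩ := E.exists_generators σ
  obtain ⟨p, hpt, hp⟩ := σ.exists_mem_openDual_lt hα hσα (Set.finite_range χ) t
  rw [Set.forall_mem_range] at hp
  refine ⟨p, hpt, ?_, fun y x hx => ?_⟩
  · rw [E.kappaStalk_eq_span σ e χ h, ← htop, ← Set.image_univ]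
    congr 2
    exact Set.eq_univ_of_forall hp
  · rw [E.kappaStalk_eq_span σ e χ h, E.kappaStalk_eq_span σ e χ h]
    exact Submodule.span_mono (Set.image_mono fun i hi =>
      (convex_openDual σ.1 (χ i)).segment_subset (hp i) hi hx)

lemma Bundle.exists_radial_kappaStalk_of_mem (σ : Δ.Cone) {ρ : Δ.Cone} {α : ι → ℤ}
    (hα : IsRayGenerator ρ α) (hσα : toReal α ∈ σ.1) {j : ℤ} {t : ℝ} (hjt : (j : ℝ) < t)
    (htj : t ≤ j + 1) :
    ∃ p, toReal α ⬝ᵥ p < t ∧ E.klyachko ρ α hα.mem j ≤ E.kappaStalk σ p ∧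
      ∀ y, toReal α ⬝ᵥ y < t → E.kappaStalk σ y ≤ E.klyachko ρ α hα.mem j ∧
        ∀ x ∈ segment ℝ p y, E.kappaStalk σ y ≤ E.kappaStalk σ x := by
  obtain ⟨J, _, χ, e, h, -⟩ := E.exists_generators σ
  have hρσ : ρ ≤ σ := by
    change ρ.1 ≤ σ.1
    rw [hα.2]
    exact Submodule.span_le.2 (by simpa using hσα)
  have hα0 : toReal α ≠ 0 := fun h0 =>
    hα.1 (funext fun i => by simpa [toReal] using congrFun h0 i)
  obtain ⟨p, hpt, hp⟩ := σ.exists_mem_openDual_slab hα hσα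
    (C := χ '' {i | α ⬝ᵥ χ i ≤ j}) (Set.toFinite _) hjt (by rintro _ ⟨i, hi, rfl⟩; exact hi)
  have hlow : ∀ y, toReal α ⬝ᵥ y < t → ∀ i, y ∈ openDual σ.1 (χ i) → α ⬝ᵥ χ i ≤ j := by
    intro y hy i hi
    have h1 := hi _ hσα hα0
    rw [toReal_dotProduct_toReal, dotProduct_comm y, dotProduct_comm (χ i)] at h1
    have h2 : ((α ⬝ᵥ χ i : ℤ) : ℝ) < ((j + 1 : ℤ) : ℝ) := by
      push_cast
      linarith
    exact Int.lt_add_one_iff.1 (by exact_mod_cast h2)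
  rw [E.klyachko_eq_of_le hρσ, E.klyachko_eq_span σ e χ h]
  refine ⟨p, hpt, ?_, fun y hy => ⟨?_, fun x hx => ?_⟩⟩
  · rw [E.kappaStalk_eq_span σ e χ h]
    exact Submodule.span_mono (Set.image_mono fun i hi => hp _ ⟨i, hi, rfl⟩)
  · rw [E.kappaStalk_eq_span σ e χ h]
    exact Submodule.span_mono (Set.image_mono (hlow y hy))
  · rw [E.kappaStalk_eq_span σ e χ h, E.kappaStalk_eq_span σ e χ h]
    exact Submodule.span_mono (Set.image_mono fun i hi =>
      (convex_openDual σ.1 (χ i)).segment_subset (hp _ ⟨i, hlow y hy i hi, rfl⟩) hi hx)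

end Generators
end Toric
end

noncomputable section
namespace Toric

/-! ### The Čech families of a bundle -/

section Families

variable {ι : Type u} [Fintype ι] {k : Type u} [CommRing k] {Δ : Fan ι}

instance : Finite Δ.Cone := Δ.finite

variable (E : Bundle k Δ)

/-- The family of the stalks of the terms of `κ(𝓔)`. -/
def Bundle.kappaFam : CechFam k Δ.Cone E.fiber (space ι) where
  F I v := E.kappaStalk (Δ.inter I) v
  mono I i v := E.kappaStalk_mono (Δ.inter_le I i) v
  isOpen I _ := isOpen_iff_eventually.2 fun v hv =>
    (E.eventually_kappaStalk_le (Δ.inter I) v).mono fun _ h => h hv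

/-- The extension by zero of the restriction of a family to an open set. -/
def CechFam.cut {S Q : Type u} [AddCommGroup Q] [Module k Q] {X : TopCat.{u}}
    (𝓕 : CechFam k S Q X) (U : Opens X) : CechFam k S Q X where
  F I x := by classical exact if x ∈ U then 𝓕.F I x else ⊥
  mono I i x := by
    split_ifs
    · exact 𝓕.mono I i x
    · exact le_rfl
  isOpen I w := by
    by_cases hw : w = 0
    · subst hw
      simp
    · convert (𝓕.isOpen I w).inter U.isOpen using 1
      ext x
      by_cases hx : x ∈ U <;> simp [hx, hw]

section Cut

variable {S Q : Type u} [AddCommGroup Q] [Module k Q] {X : TopCat.{u}} (𝓕 : CechFam k S Q X)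
  {U : Opens X} {x : X} {p : ℕ} {I : Fin (p + 1) → S}

lemma CechFam.cut_of_mem (h : x ∈ U) : (𝓕.cut U).F I x = 𝓕.F I x :=
  if_pos h

lemma CechFam.cut_of_notMem (h : x ∉ U) : (𝓕.cut U).F I x = ⊥ :=
  if_neg h

lemma CechFam.cut_le (I : Fin (p + 1) → S) (x : X) : (𝓕.cut U).F I x ≤ 𝓕.F I x := by
  by_cases h : x ∈ U
  · rw [cut_of_mem 𝓕 h]
  · rw [cut_of_notMem 𝓕 h]
    exact bot_le

lemma CechFam.stalk_cut_of_mem (h : x ∈ U) (q : ℕ) : (𝓕.cut U).stalk q x = 𝓕.stalk q x := by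
  ext c
  exact forall_congr' fun I => by rw [cut_of_mem 𝓕 h]

lemma CechFam.stalk_cut_of_notMem (h : x ∉ U) (q : ℕ) : (𝓕.cut U).stalk q x = ⊥ := by
  refine (Submodule.eq_bot_iff _).2 fun c hc => Subtype.ext (funext fun I => ?_)
  have := hc I
  rw [cut_of_notMem 𝓕 h] at this
  exact (Submodule.mem_bot k).1 this

variable [Finite S]

/-- The inclusion of the extension by zero. -/
def CechFam.cutIncl (U : Opens X) : (𝓕.cut U).lc.Hom 𝓕.lc :=
  (𝓕.cut U).pull 𝓕 id LinearMap.id fun I x _ hw => 𝓕.cut_le I x hw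

lemma CechFam.quasiAtNat_cutIncl (h : x ∈ U) :
    QuasiAtNat (𝓕.cut U).lc.A 𝓕.lc.A (𝓕.cutIncl U).modMap x where
  inj i j l _ _ β _ _ γ hγ e := ⟨γ, (𝓕.stalk_cut_of_mem h i).ge hγ, e⟩
  surj i j l _ _ β hβ hd := ⟨β, (𝓕.stalk_cut_of_mem h j).ge hβ, hd, 0, zero_mem (𝓕.lc.A i x), by
    rw [map_zero, add_zero]
    rfl⟩
  inj_zero β _ _ e := e
  surj_zero β hβ hd := ⟨β, (𝓕.stalk_cut_of_mem h 0).ge hβ, hd, rfl⟩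

end Cut

/-- The family equal to `N` on the simplices whose cones contain `x`, to the whole fibre
otherwise. -/
def Bundle.rayFam (x : ι → ℝ) (N : Submodule k E.fiber) :
    CechFam k Δ.Cone E.fiber (space ι) where
  F I _ := by classical exact if x ∈ (Δ.inter I).1 then N else ⊤
  mono I i v := by
    split_ifs with h1 h2 h2
    · exact le_rfl
    · exact le_top
    · exact absurd (Δ.inter_le I i h2) h1
    · exact le_rfl
  isOpen _ _ := isOpen_const

section Ray

variable {E} {x : ι → ℝ} {N : Submodule k E.fiber} {p : ℕ} {I : Fin (p + 1) → Δ.Cone} {v : space ι}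

lemma Bundle.rayFam_of_mem (h : x ∈ (Δ.inter I).1) : (E.rayFam x N).F I v = N :=
  if_pos h

lemma Bundle.rayFam_of_notMem (h : x ∉ (Δ.inter I).1) : (E.rayFam x N).F I v = ⊤ :=
  if_neg h

lemma Bundle.le_rayFam : N ≤ (E.rayFam x N).F I v := by
  by_cases h : x ∈ (Δ.inter I).1
  · rw [rayFam_of_mem h]
  · rw [rayFam_of_notMem h]
    exact le_top

lemma Fan.mem_inter : x ∈ (Δ.inter I).1 ↔ ∀ i, x ∈ (I i).1 := by
  simp [Fan.inter]

lemma Bundle.contractibleAt_rayFam {ρ : Δ.Cone} (h : x ∈ ρ.1) :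
    (E.rayFam x N).ContractibleAt ρ v := by
  intro p I
  by_cases hI : x ∈ (Δ.inter I).1
  · have : x ∈ (Δ.inter (Fin.cons ρ I : Fin (p + 2) → Δ.Cone)).1 := by
      rw [Fan.mem_inter] at hI ⊢
      exact Fin.cases h hI
    rw [rayFam_of_mem this, rayFam_of_mem hI]
  · rw [rayFam_of_notMem hI]
    exact le_top

end Ray

lemma CechFam.pull_comp_eq {S₀ S₁ S₂ S₃ Q₀ Q₁ Q₂ Q₃ : Type u} [Finite S₀] [Finite S₁] [Finite S₂]
    [Finite S₃] [AddCommGroup Q₀] [Module k Q₀] [AddCommGroup Q₁] [Module k Q₁] [AddCommGroup Q₂]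
    [Module k Q₂] [AddCommGroup Q₃] [Module k Q₃] {X : TopCat.{u}} {𝓕₀ : CechFam k S₀ Q₀ X}
    {𝓕₁ : CechFam k S₁ Q₁ X} {𝓕₂ : CechFam k S₂ Q₂ X} {𝓕₃ : CechFam k S₃ Q₃ X}
    {f₁ : S₁ → S₀} {f₁' : S₃ → S₁} {f₂ : S₂ → S₀} {f₂' : S₃ → S₂} {g₁ : Q₀ →ₗ[k] Q₁}
    {g₁' : Q₁ →ₗ[k] Q₃} {g₂ : Q₀ →ₗ[k] Q₂} {g₂' : Q₂ →ₗ[k] Q₃} {h₁ h₁' h₂ h₂'}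
    (hf : f₁ ∘ f₁' = f₂ ∘ f₂') (hg : g₁' ∘ₗ g₁ = g₂' ∘ₗ g₂) :
    (𝓕₀.pull 𝓕₁ f₁ g₁ h₁).sheafMap ≫ (𝓕₁.pull 𝓕₃ f₁' g₁' h₁').sheafMap =
      (𝓕₀.pull 𝓕₂ f₂ g₂ h₂).sheafMap ≫ (𝓕₂.pull 𝓕₃ f₂' g₂' h₂').sheafMap := by
  have key : ∀ {f f' : S₃ → S₀} {g g' : Q₀ →ₗ[k] Q₃} (h h'), f = f' → g = g' →
      (𝓕₀.pull 𝓕₃ f g h).sheafMap = (𝓕₀.pull 𝓕₃ f' g' h').sheafMap := by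
    rintro f _ g _ h h' rfl rfl
    rfl
  rw [pull_comp 𝓕₀ 𝓕₁ 𝓕₃ f₁ g₁ f₁' g₁' h₁ h₁' fun I x w hw => h₁' I x _ (h₁ (f₁' ∘ I) x w hw),
    pull_comp 𝓕₀ 𝓕₂ 𝓕₃ f₂ g₂ f₂' g₂' h₂ h₂' fun I x w hw => h₂' I x _ (h₂ (f₂' ∘ I) x w hw)]
  exact key _ _ hf hg

lemma CechFam.contractibleAt_const {S Q : Type u} [AddCommGroup Q] [Module k Q] {X : TopCat.{u}}
    (s : S) (x : X) : (CechFam.const k S Q X).ContractibleAt s x :=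
  fun _ => le_rfl

section Filtration

variable {ρ : Δ.Cone} {α : ι → ℤ} (hα : IsRayGenerator ρ α) {j : ℤ} {t : ℝ}

lemma Bundle.exists_radial_cut (hjt : (j : ℝ) < t) (htj : t ≤ j + 1) (σ : Δ.Cone) :
    ∃ p, toReal α ⬝ᵥ p < t ∧
      (∀ y, toReal α ⬝ᵥ y < t → ∀ x ∈ segment ℝ p y, E.kappaStalk σ y ≤ E.kappaStalk σ x) ∧
      (toReal α ∈ σ.1 → E.klyachko ρ α hα.mem j ≤ E.kappaStalk σ p) ∧
      (toReal α ∉ σ.1 → E.kappaStalk σ p = ⊤) := by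
  by_cases h : toReal α ∈ σ.1
  · obtain ⟨p, h1, h2, h3⟩ := E.exists_radial_kappaStalk_of_mem σ hα h hjt htj
    exact ⟨p, h1, fun y hy => (h3 y hy).2, fun _ => h2, fun h' => absurd h h'⟩
  · obtain ⟨p, h1, h2, h3⟩ := E.exists_radial_kappaStalk_of_notMem σ hα h t
    exact ⟨p, h1, fun y _ => h3 y, fun h' => absurd h' h, fun _ => h2⟩

lemma Bundle.cut_le_rayFam (hjt : (j : ℝ) < t) (htj : t ≤ j + 1) {p : ℕ}
    (I : Fin (p + 1) → Δ.Cone) (v : space ι) : (E.kappaFam.cut (halfSpace α t)).F I v ≤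
      (E.rayFam (toReal α) (E.klyachko ρ α hα.mem j)).F I v := by
  by_cases hv : v ∈ halfSpace α t
  · rw [CechFam.cut_of_mem _ hv]
    by_cases h : toReal α ∈ (Δ.inter I).1
    · rw [rayFam_of_mem h]
      obtain ⟨_, _, _, h3⟩ := E.exists_radial_kappaStalk_of_mem (Δ.inter I) hα h hjt htj
      exact (h3 v hv).1
    · rw [rayFam_of_notMem h]
      exact le_top
  · rw [CechFam.cut_of_notMem _ hv]
    exact bot_le

lemma convex_halfSpace (α : ι → ℤ) (t : ℝ) : Convex ℝ (halfSpace α t : Set (ι → ℝ)) :=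
  convex_halfSpace_lt (f := fun v => toReal α ⬝ᵥ v)
    ⟨fun _ _ => dotProduct_add _ _ _, fun _ _ => dotProduct_smul _ _ _⟩ t

lemma injective_and_map_range_eq {A B C P : ModuleCat.{u} k} {N : Submodule k C} {f : A ⟶ B}
    {φ : B ⟶ C} {r : P ⟶ A} [IsIso r] {e : P ⟶ ModuleCat.of k N} [IsIso e]
    (h : r ≫ f ≫ φ = e ≫ ModuleCat.ofHom N.subtype) :
    Function.Injective f ∧ Submodule.map φ.hom (LinearMap.range f.hom) = N := by
  have h' : f ≫ φ = inv r ≫ e ≫ ModuleCat.ofHom N.subtype := by rw [← h, IsIso.inv_hom_id_assoc]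
  have hb : Function.Bijective (inv r ≫ e) :=
    ConcreteCategory.bijective_of_isIso (inv r ≫ e)
  have hx : ∀ x, φ (f x) = ((inv r ≫ e) x).1 := fun x => ConcreteCategory.congr_hom h' x
  refine ⟨fun x y hxy => hb.1 (Subtype.ext ?_), le_antisymm ?_ fun c hc => ?_⟩
  · rw [← hx, ← hx, hxy]
  · rintro _ ⟨_, ⟨x, rfl⟩, rfl⟩
    exact (hx x).symm ▸ Subtype.prop _
  · obtain ⟨x, hxc⟩ := hb.2 ⟨c, hc⟩
    exact ⟨f x, ⟨x, rfl⟩, (hx x).trans (congrArg Subtype.val hxc)⟩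

end Filtration

/-! ### Comparison of cohomology -/

variable [HasDerivedCategory.{w₁} (Sh k (space ι))] [HasDerivedCategory.{w₂} (ModuleCat.{u} k)]

lemma isIso_hyper_pull {S S' Q Q' : Type u} [Finite S] [Finite S'] [AddCommGroup Q] [Module k Q]
    [AddCommGroup Q'] [Module k Q'] (U : Opens (space ι)) (𝓕 : CechFam k S Q (space ι))
    (𝓕' : CechFam k S' Q' (space ι)) (f : S' → S) (g : Q →ₗ[k] Q') (h)
    (hx : ∀ x ∈ U, QuasiAtNat 𝓕.lc.A 𝓕'.lc.A (𝓕.pull 𝓕' f g h).modMap x) :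
    IsIso ((hyper k ι U).map (𝓕.pull 𝓕' f g h).sheafMap) :=
  isIso_hyper (isIso_of_quasiAt _ U (P := 𝓕.lc.presentation) (P' := 𝓕'.lc.presentation)
    (LcCx.Hom.compat _) hx)

lemma isIso_hyper_const_pull {S S' : Type u} [Finite S] [Finite S'] [Nonempty S] [Nonempty S']
    (Q : Type u) [AddCommGroup Q] [Module k Q] (f : S' → S) (h) :
    IsIso ((hyper k ι ⊤).map ((CechFam.const k S Q (space ι)).pull
      (CechFam.const k S' Q (space ι)) f LinearMap.id h).sheafMap) := by
  obtain ⟨s⟩ := ‹Nonempty S›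
  obtain ⟨s'⟩ := ‹Nonempty S'›
  refine isIso_hyper_pull ⊤ _ _ f _ h fun x _ => ?_
  exact CechFam.quasiAtNat_pull _ _ f _ h (CechFam.contractibleAt_const s x)
    (CechFam.contractibleAt_const s' x) (fun w _ hw => hw) (fun w _ => ⟨w, trivial, rfl⟩)

/-- The morphism from `κ(𝓔)` to a constant Čech complex. -/
def Bundle.kappaToConst : E.kappaFam.lc.Hom (CechFam.const k (Option ι) E.fiber (space ι)).lc :=
  E.kappaFam.pull _ (fun _ => Δ.zero) LinearMap.id fun _ _ _ _ => trivial

instance : Nonempty Δ.Cone := ⟨Δ.zero⟩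

lemma Fan.exists_forall_range {V : Type*} [Nonempty V] {P : Δ.Cone → V → Prop}
    (h : ∀ σ, ∃ p, P σ p) (T : Set Δ.Cone) :
    ∃ p, ∀ {n : ℕ} (I : Fin (n + 1) → Δ.Cone), Set.range I = T → P (Δ.inter I) p := by
  have hinf : ∀ {n : ℕ} (I : Fin (n + 1) → Δ.Cone), Set.range I = T →
      (Δ.inter I).1 = ⨅ σ ∈ T, σ.1 := by
    rintro n I rfl
    rw [iInf_range]
    rfl
  by_cases hI : ∃ (n : ℕ) (I : Fin (n + 1) → Δ.Cone), Set.range I = T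
  · obtain ⟨n, I, hI⟩ := hI
    obtain ⟨p, hp⟩ := h (Δ.inter I)
    refine ⟨p, fun {m} J hJ => ?_⟩
    rwa [show Δ.inter J = Δ.inter I from Subtype.ext ((hinf J hJ).trans (hinf I hI).symm)]
  · push Not at hI
    exact ⟨Classical.arbitrary V, fun I hI' => absurd hI' (hI _ I)⟩

lemma Bundle.isIso_hyper_kappaIncl :
    IsIso ((hyper k ι ⊤).map (E.kappaFam.pull (CechFam.const k Δ.Cone E.fiber (space ι)) id
      LinearMap.id fun _ _ _ _ => trivial).sheafMap) := by
  refine isIso_hyper (isIso_of_isRadialPair _ ⊤ E.kappaFam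
    (CechFam.const k Δ.Cone E.fiber (space ι)) (fun _ _ => le_top) fun T => ?_)
  obtain ⟨p, hp⟩ := Fan.exists_forall_range E.exists_radial_kappaStalk T
  exact ⟨p, trivial, starConvex_univ p, fun I hI => ⟨fun y _ x hx => (hp I hI).2 y x hx,
    fun _ _ _ _ => le_rfl, (hp I hI).1.ge⟩⟩

instance Bundle.isIso_hyper_kappaToConst :
    IsIso ((hyper k ι ⊤).map E.kappaToConst.sheafMap) := by
  have h1 := E.isIso_hyper_kappaIncl
  have h2 := isIso_hyper_const_pull (k := k) (ι := ι) (S := Δ.Cone) (S' := Option ι) E.fiber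
    (fun _ => Δ.zero) fun _ _ _ _ => trivial
  have e : _ = E.kappaToConst.sheafMap := CechFam.pull_comp E.kappaFam
    (CechFam.const k Δ.Cone E.fiber (space ι)) (CechFam.const k (Option ι) E.fiber (space ι)) id
    LinearMap.id (fun _ => Δ.zero) LinearMap.id (fun _ _ _ _ => trivial) (fun _ _ _ _ => trivial)
    fun _ _ _ _ => trivial
  rw [← e, Functor.map_comp]
  infer_instance

section Filtration

variable {ρ : Δ.Cone} {α : ι → ℤ} (hα : IsRayGenerator ρ α) {j : ℤ} {t : ℝ}

lemma Bundle.isIso_hyper_cut_rayFam (hjt : (j : ℝ) < t) (htj : t ≤ j + 1) :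
    IsIso ((hyper k ι ⊤).map ((E.kappaFam.cut (halfSpace α t)).pull
      (E.rayFam (toReal α) (E.klyachko ρ α hα.mem j)) id LinearMap.id
      fun I x _ hw => E.cut_le_rayFam hα hjt htj I x hw).sheafMap) := by
  refine isIso_hyper (isIso_of_isRadialPair _ ⊤ (E.kappaFam.cut (halfSpace α t))
    (E.rayFam (toReal α) (E.klyachko ρ α hα.mem j)) (E.cut_le_rayFam hα hjt htj) fun T => ?_)
  obtain ⟨p, hp⟩ := Fan.exists_forall_range (E.exists_radial_cut hα hjt htj) T
  refine ⟨p, trivial, starConvex_univ p, fun I hI => ?_⟩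
  obtain ⟨hpt, hseg, hmem, hnot⟩ := hp I hI
  refine ⟨fun y _ x hx => ?_, fun _ _ _ _ => le_rfl, ?_⟩
  · by_cases hy : y ∈ halfSpace α t
    · have hxU : x ∈ halfSpace α t := (convex_halfSpace α t).segment_subset hpt hy hx
      rw [CechFam.cut_of_mem _ hy, CechFam.cut_of_mem _ hxU]
      exact hseg y hy x hx
    · rw [CechFam.cut_of_notMem _ hy]
      exact bot_le
  · rw [CechFam.cut_of_mem _ (show p ∈ halfSpace α t from hpt)]
    by_cases h : toReal α ∈ (Δ.inter I).1
    · rw [rayFam_of_mem h]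
      exact hmem h
    · exact (hnot h).ge.trans' le_top

lemma Bundle.isIso_hyper_const_rayFam (h : ∀ {p : ℕ} (I : Fin (p + 1) → Δ.Cone) (x : space ι),
      ∀ w ∈ (CechFam.const k PUnit.{u + 1} (E.klyachko ρ α hα.mem j) (space ι)).F
        ((fun _ => PUnit.unit) ∘ I) x, (E.klyachko ρ α hα.mem j).subtype w ∈
          (E.rayFam (toReal α) (E.klyachko ρ α hα.mem j)).F I x) :
    IsIso ((hyper k ι ⊤).map ((CechFam.const k PUnit.{u + 1} (E.klyachko ρ α hα.mem j)
      (space ι)).pull (E.rayFam (toReal α) (E.klyachko ρ α hα.mem j)) (fun _ => PUnit.unit)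
      (E.klyachko ρ α hα.mem j).subtype h).sheafMap) := by
  refine isIso_hyper_pull ⊤ _ _ _ _ h fun x _ => ?_
  refine CechFam.quasiAtNat_pull _ _ _ _ h (CechFam.contractibleAt_const PUnit.unit x)
    (Bundle.contractibleAt_rayFam hα.mem) (fun w _ hw => Subtype.ext hw) fun w hw => ?_
  rw [rayFam_of_mem (Fan.mem_inter.2 fun _ => hα.mem)] at hw
  exact ⟨⟨w, hw⟩, trivial, rfl⟩

/-- The compactly supported cohomology of the Čech family of `𝓔` is the generic stalk. -/
def Bundle.hyperKappaIso :
    (hyper k ι ⊤).obj E.kappaFam.lc.sheafCx ≅ ModuleCat.of k E.fiber :=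
  asIso ((hyper k ι ⊤).map E.kappaToConst.sheafMap) ≪≫ hyperConst k ι E.fiber

variable {E} in
/-- The action of a morphism of bundles on the Čech families. -/
def Bundle.Hom.kappaFamMap {E' : Bundle k Δ} (f : Bundle.Hom E E') :
    E.kappaFam.lc.Hom E'.kappaFam.lc :=
  E.kappaFam.pull E'.kappaFam id f.fiberMap
    fun I v _ hw => f.fiberMap_mem_kappaStalk (Δ.inter I) v hw

variable {E} in
lemma Bundle.hyperKappaIso_naturality {E' : Bundle k Δ} (f : Bundle.Hom E E') :
    (hyper k ι ⊤).map f.kappaFamMap.sheafMap ≫ E'.hyperKappaIso.hom =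
      E.hyperKappaIso.hom ≫ ModuleCat.ofHom f.fiberMap := by
  have e : f.kappaFamMap.sheafMap ≫ E'.kappaToConst.sheafMap = E.kappaToConst.sheafMap ≫
      ((CechFam.const k (Option ι) E.fiber (space ι)).pull
        (CechFam.const k (Option ι) E'.fiber (space ι)) id f.fiberMap
        fun _ _ _ _ => trivial).sheafMap := CechFam.pull_comp_eq rfl rfl
  have e' := congrArg (hyper k ι ⊤).map e
  simp only [Functor.map_comp] at e'
  have h := hyperConst_naturality (ι := ι) f.fiberMap fun _ _ _ _ => trivial
  simp only [Bundle.hyperKappaIso, Iso.trans_hom, asIso_hom, Category.assoc]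
  exact ((reassoc_of% e') _).trans (congrArg (_ ≫ ·) h)

variable (k Δ) in
/-- The compactly supported cohomology of `κ(𝓔)` is the generic stalk of `𝓔`. -/
def kappaIso : kappa k Δ ⋙ cohomologyC 0 ⊤ ≅ genericStalk k Δ :=
  NatIso.ofComponents (fun E => E.hyperKappaIso) fun f => Bundle.hyperKappaIso_naturality f

lemma isIso_cohomologyCExt_cut {S Q : Type u} [Finite S] [AddCommGroup Q] [Module k Q]
    (𝓕 : CechFam k S Q (space ι)) (U : Opens (space ι)) :
    IsIso ((cohomologyCExt (k := k) 0 (le_top : U ≤ ⊤)).app (DerivedCategory.Plus.Q.obj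
      ((plusShift k (space ι) (Fintype.card ι)).obj (𝓕.cut U).lc.sheafCx))) := by
  have := isIso_rightDerivedExt_of_eq_bot (Fintype.card ι) U (𝓕.cut U).lc.presentation
    fun x hx q => 𝓕.stalk_cut_of_notMem hx q
  exact inferInstanceAs (IsIso ((DerivedCategory.Plus.homologyFunctor (ModuleCat.{u} k) 0).map
    ((rightDerivedExt (k := k) (le_top : U ≤ ⊤)).app (DerivedCategory.Plus.Q.obj
      ((plusShift k (space ι) (Fintype.card ι)).obj (𝓕.cut U).lc.sheafCx)))))

lemma exists_isIso_comp_eq {C : Type*} [Category* C] {P B K L A H W N : C} {q : P ⟶ B}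
    [IsIso q] {b : K ⟶ B} [IsIso b] {x : L ⟶ K} [IsIso x] {i : L ⟶ A} [IsIso i] {ext : A ⟶ H}
    {i' : K ⟶ H} {θ : H ⟶ W} {β : B ⟶ W} {c : P ⟶ N} {s : N ⟶ W} (h1 : i ≫ ext = x ≫ i')
    (h2 : i' ≫ θ = b ≫ β) (h3 : q ≫ β = c ≫ s) :
    ∃ r : P ⟶ A, IsIso r ∧ r ≫ ext ≫ θ = c ≫ s := by
  refine ⟨q ≫ inv b ≫ inv x ≫ i, inferInstance, ?_⟩
  simp only [Category.assoc]
  rw [reassoc_of% h1, h2, IsIso.inv_hom_id_assoc, IsIso.inv_hom_id_assoc, h3]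

/-- The open Morse filtration of the cohomology of `κ(𝓔)` is the Klyachko filtration. -/
theorem Bundle.exists_isIso_filtration (hjt : (j : ℝ) < t) (htj : t ≤ j + 1) :
    ∃ (P : ModuleCat.{u} k) (r : P ⟶ (hyper k ι (halfSpace α t)).obj E.kappaFam.lc.sheafCx)
      (e : P ⟶ ModuleCat.of k (E.klyachko ρ α hα.mem j)), IsIso r ∧ IsIso e ∧
      r ≫ (cohomologyCExt (k := k) 0 (le_top : halfSpace α t ≤ ⊤)).app
        (DerivedCategory.Plus.Q.obj ((plusShift k (space ι) (Fintype.card ι)).obj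
          E.kappaFam.lc.sheafCx)) ≫ E.hyperKappaIso.hom =
      e ≫ ModuleCat.ofHom (E.klyachko ρ α hα.mem j).subtype := by
  let N := E.klyachko ρ α hα.mem j
  let 𝓑 := E.rayFam (toReal α) N
  let 𝓒 := CechFam.const k PUnit.{u + 1} N (space ι)
  have hq : ∀ {p : ℕ} (I : Fin (p + 1) → Δ.Cone) (x : space ι),
      ∀ w ∈ 𝓒.F ((fun _ => PUnit.unit) ∘ I) x, N.subtype w ∈ 𝓑.F I x :=
    fun I x w _ => Bundle.le_rayFam w.2
  let q := (𝓒.pull 𝓑 (fun _ => PUnit.unit) N.subtype hq).sheafMap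
  let b := ((E.kappaFam.cut (halfSpace α t)).pull 𝓑 id LinearMap.id
    fun I x _ hw => E.cut_le_rayFam hα hjt htj I x hw).sheafMap
  let i := (E.kappaFam.cutIncl (halfSpace α t)).sheafMap
  let β := (𝓑.pull (CechFam.const k (Option ι) E.fiber (space ι)) (fun _ => Δ.zero) LinearMap.id
    fun _ _ _ _ => trivial).sheafMap
  let c := (𝓒.pull (CechFam.const k (Option ι) N (space ι)) (fun _ => PUnit.unit) LinearMap.id
    fun _ _ _ _ => trivial).sheafMap
  let s := ((CechFam.const k (Option ι) N (space ι)).pull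
    (CechFam.const k (Option ι) E.fiber (space ι)) id N.subtype fun _ _ _ _ => trivial).sheafMap
  have hiso_q : IsIso ((hyper k ι ⊤).map q) := E.isIso_hyper_const_rayFam hα hq
  have hiso_b : IsIso ((hyper k ι ⊤).map b) := E.isIso_hyper_cut_rayFam hα hjt htj
  have hiso_i : IsIso ((hyper k ι (halfSpace α t)).map i) :=
    isIso_hyper_pull _ _ _ _ _ _ fun x hx => E.kappaFam.quasiAtNat_cutIncl hx
  have hiso_c : IsIso ((hyper k ι ⊤).map c) := isIso_hyper_const_pull N _ _
  have hiso_x := isIso_cohomologyCExt_cut E.kappaFam (halfSpace α t)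
  have e2 : i ≫ E.kappaToConst.sheafMap = b ≫ β := CechFam.pull_comp_eq rfl rfl
  have e3 : q ≫ β = c ≫ s := CechFam.pull_comp_eq rfl rfl
  have e1 : (hyper k ι (halfSpace α t)).map i ≫ _ = _ ≫ (hyper k ι ⊤).map i :=
    (cohomologyCExt (k := k) 0 (le_top : halfSpace α t ≤ ⊤)).naturality
      (DerivedCategory.Plus.Q.map ((plusShift k (space ι) (Fintype.card ι)).map i))
  have e2' := congrArg (hyper k ι ⊤).map e2
  have e3' := congrArg (hyper k ι ⊤).map e3
  rw [CategoryTheory.Functor.map_comp, CategoryTheory.Functor.map_comp] at e2' e3'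
  obtain ⟨r, hr, key⟩ := exists_isIso_comp_eq e1 e2' e3'
  have hs := hyperConst_naturality (ι := ι) N.subtype fun _ _ _ _ => trivial
  refine ⟨_, r, (hyper k ι ⊤).map c ≫ (hyperConst k ι N).hom, hr, inferInstance, ?_⟩
  have key' := congrArg (· ≫ (hyperConst k ι E.fiber).hom) key
  simp only [Category.assoc] at key' ⊢
  exact key'.trans (congrArg (_ ≫ ·) hs)

end Filtration

end Families
end Toric
end

theorem theorem1p1p5 {ι k : Type u} [Fintype ι] [CommRing k] [IsNoetherianRing k]
    [HasDerivedCategory.{w₁} (Toric.Sh k (Toric.space ι))]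
    [HasDerivedCategory.{w₂} (ModuleCat.{u} k)] (Δ : Toric.Fan ι) :
    ∃ φ : Toric.kappa k Δ ⋙ Toric.cohomologyC 0 ⊤ ≅ Toric.genericStalk k Δ,
      ∀ (E : Toric.Bundle k Δ) (ρ : Δ.Cone) (α : ι → ℤ) (hα : Toric.IsRayGenerator ρ α)
        (j : ℤ) (t : ℝ), (j : ℝ) < t → t ≤ j + 1 →
        Function.Injective ((Toric.cohomologyCExt 0
          (le_top : Toric.halfSpace α t ≤ ⊤)).app ((Toric.kappa k Δ).obj E)) ∧
        Submodule.map (φ.hom.app E).hom (LinearMap.range ((Toric.cohomologyCExt 0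
          (le_top : Toric.halfSpace α t ≤ ⊤)).app ((Toric.kappa k Δ).obj E)).hom) =
            E.klyachko ρ α hα.mem j := by
  refine ⟨Toric.kappaIso k Δ, fun E ρ α hα j t hjt htj => ?_⟩
  obtain ⟨P, r, e, hr, he, h⟩ := E.exists_isIso_filtration hα hjt htj
  have key := Toric.injective_and_map_range_eq h
  exact key
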